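/- Setting. Let $r\ge 3$, let $p_1,\dots,p_r$ be pairwise coprime positive integers with $p_2,\dots,p_r$ odd, and let $q_1,\dots,q_r$ be integers with $p_1\cdots p_r\sum_{j=1}^r q_j/p_j=1$. Let $\Sigma_{0,r}$ be the two-sphere with $r$ disjoint open disks removed, let $x_1,\dots,x_r$ be its boundary circles (oriented consistently), and let $X$ be the closed Seifert fibered $3$-manifold with Seifert invariants $\{0;(p_1/q_1),\dots,(p_r/q_r)\}$, that is, the integral homology sphere obtained from $\Sigma_{0,r}\times S^1$ (with fibre $h$) by gluing in $r$ solid tori, the meridian of the $j$-th one being attached to $x_j^{p_j}h^{-q_j}$. For a path connected space $Y$, the moduli space of flat $\mathrm{SU}(2)$-connections is $\mathcal M(Y)=\mathrm{Hom}(\pi_1(Y),\mathrm{SU}(2))/\mathrm{SU}(2)$ (holonomy representations up to conjugation, with the quotient of the topology of pointwise convergence), and $\mathcal M^{\mathrm{Irr}}(Y)\subseteq\mathcal M(Y)$ is the subspace of irreducible ones. For a tuple $C=(C_1,\dots,C_r)$ of conjugacy classes of $\mathrm{SU}(2)$, let $\mathcal M(\Sigma_{0,r},C)\subseteq\mathcal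 M(\Sigma_{0,r})$ be the subspace of flat connections whose holonomy around the $j$-th boundary component lies in $C_j$ for every $j$, and $\mathcal M^{\mathrm{Irr}}(\Sigma_{0,r},C)$ its subspace of irreducible connections. For $\underline\ell\in\mathbb Z^r$ let $C^{(\underline\ell)}_j$ be the conjugacy class of $\mathrm{diag}(e^{\pi i\ell_j/p_j},e^{-\pi i\ell_j/p_j})$. Let $\mathfrak L(p_1,\dots,p_r)$ be the set of all $\underline\ell\in\mathbb Z^r$ such that $0\le\ell_j\le p_j$ for all $j$, $\ell_j/p_j\notin\mathbb Z$ for at least three values of $j$, and $\ell_j$ is even for all $j\ge2$. Let $\mathfrak R(p_1,\dots,p_r)$ be the set of all $\underline\ell\in\mathfrak L(p_1,\dots,p_r)$ such that for every subset $J\subset\{1,\dots,r\}$ of odd cardinality $$\sum_{j\in J}\frac{p_j-\ell_j}{p_j}+\sum_{j\in\{1,\dots,r\}\setminus J}\frac{\ell_j}{p_j}>1 .$$ A section $s:\Sigma_{0,r}\to S^1$ of $\Sigma_{0,r}\times S^1\subset X$ that takes the value $1$ at the base point of $\Sigma_{0,r}$ and winds $n_j$ times around the fibre along $x_j$ is called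 normalized if $q_j+n_jp_j$, the second entry of the $j$-th Seifert invariant relative to $s$, is even for every $j\ge2$. (If $q_2,\dots,q_r$ are even, the constant section $1$ is normalized.) Let $\iota=\iota_s:\Sigma_{0,r}\hookrightarrow X$, $z\mapsto(z,s(z))$. Theorem. (1) For each $\underline\ell\in\mathfrak R(p_1,\dots,p_r)$ we have $\mathcal M(\Sigma_{0,r},C^{(\underline\ell)})=\mathcal M^{\mathrm{Irr}}(\Sigma_{0,r},C^{(\underline\ell)})$, and this moduli space is non-empty. (2) Normalized sections exist, and for every normalized section pullback with respect to $\iota$ induces a homeomorphism $$\mathcal M^{\mathrm{Irr}}(X)\;\cong\bigsqcup_{\underline\ell\in\mathfrak R(p_1,\dots,p_r)}\mathcal M^{\mathrm{Irr}}(\Sigma_{0,r},C^{(\underline\ell)}).$$ (3) In particular $\pi_0(\mathcal M^{\mathrm{Irr}}(X))$ is in bijection with $\mathfrak R(p_1,\dots,p_r)$: the bijection sends the path component of a class to the index $\underline\ell$ of the summand that contains its image under the homeomorphism of (2). -/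

import Mathlib

open scoped Matrix

/-! ## The group `SU(2)` -/

/-- The compact Lie group `SU(2)`, with the topology of a subspace of the `2 × 2` complex matrices. -/
abbrev SU2 : Type := Matrix.specialUnitaryGroup (Fin 2) ℂ

/-- The element `diag(e^{iθ}, e^{-iθ})` of `SU(2)`. -/
noncomputable def SU2.diag (θ : ℝ) : SU2 :=
  ⟨!![(Circle.exp θ : ℂ), 0; 0, (Circle.exp (-θ) : ℂ)], by
    have h1 : (Circle.exp θ : ℂ) * (Circle.exp (-θ) : ℂ) = 1 := by
      rw [← Circle.coe_mul, ← Circle.exp_add]; simp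
    have h2 : (Circle.exp (-θ) : ℂ) * (Circle.exp θ : ℂ) = 1 := by
      rw [mul_comm]; exact h1
    have h3 : (starRingEnd ℂ) (Circle.exp θ : ℂ) = (Circle.exp (-θ) : ℂ) := by
      rw [Circle.exp_neg, Circle.coe_inv_eq_conj]
    have h4 : (starRingEnd ℂ) (Circle.exp (-θ) : ℂ) = (Circle.exp θ : ℂ) := by
      rw [← h3, Complex.conj_conj]
    rw [Matrix.mem_specialUnitaryGroup_iff, Matrix.mem_unitaryGroup_iff]
    constructor
    · ext i j
      fin_cases i <;> fin_cases j <;>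
        simp [Matrix.mul_apply, Fin.sum_univ_two, Matrix.star_apply, -Circle.coe_exp,
          -Circle.exp_neg, h3, h4, h1, h2]
    · simp [Matrix.det_fin_two, -Circle.coe_exp, -Circle.exp_neg, h1]⟩

/-! ## Moduli spaces of flat `SU(2)`-connections

A flat `SU(2)`-connection on a path connected space `Y` is given, up to gauge equivalence, by its
holonomy representation `π₁(Y, y) → SU(2)`, up to conjugation. -/

section Moduli

variable (Y : Type) [TopologicalSpace Y] (y : Y)

/-- The set `Hom(π₁(Y, y), SU(2))` of holonomy representations. -/
abbrev HolRep : Type := FundamentalGroup Y y →* SU2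

/-- `Hom(π₁(Y, y), SU(2))` carries the topology of pointwise convergence. -/
noncomputable instance HolRep.instTopologicalSpace : TopologicalSpace (HolRep Y y) :=
  TopologicalSpace.induced (fun (ρ : HolRep Y y) (γ : FundamentalGroup Y y) => ρ γ) inferInstance

/-- Two representations are gauge equivalent if they are conjugate by an element of `SU(2)`. -/
noncomputable def gaugeSetoid : Setoid (HolRep Y y) where
  r ρ ρ' := ∃ g : SU2, ∀ γ, ρ' γ = g * ρ γ * g⁻¹
  iseqv :=
    { refl := fun _ => ⟨1, fun _ => by simp⟩
      symm := fun {_ _} ⟨g, hg⟩ => ⟨g⁻¹, fun γ => by rw [hg γ]; group⟩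
      trans := fun {_ _ _} ⟨g, hg⟩ ⟨k, hk⟩ => ⟨k * g, fun γ => by rw [hk γ, hg γ]; group⟩ }

/-- The moduli space `M(Y) = Hom(π₁(Y, y), SU(2)) / SU(2)` of flat `SU(2)`-connections. -/
def FlatModuli : Type := Quotient (gaugeSetoid Y y)

/-- `M(Y)` carries the quotient topology. -/
instance FlatModuli.instTopologicalSpace : TopologicalSpace (FlatModuli Y y) :=
  inferInstanceAs (TopologicalSpace (Quotient (gaugeSetoid Y y)))

variable {Y} {y}

/-- The gauge equivalence class of a flat connection. -/
noncomputable def FlatModuli.mk (ρ : HolRep Y y) : FlatModuli Y y := Quotient.mk (gaugeSetoid Y y) ρ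

/-- A flat connection is irreducible if its holonomy representation on `ℂ²` is irreducible: the only
invariant subspaces are `0` and `ℂ²`. -/
def HolRep.IsIrreducible (ρ : HolRep Y y) : Prop :=
  ∀ W : Submodule ℂ (Fin 2 → ℂ),
    (∀ γ, ∀ w ∈ W, (ρ γ : Matrix (Fin 2) (Fin 2) ℂ) *ᵥ w ∈ W) → W = ⊥ ∨ W = ⊤

variable (Y) (y) in
/-- The moduli space `M^Irr(Y) ⊆ M(Y)` of irreducible flat `SU(2)`-connections. -/
def irrModuli : Set (FlatModuli Y y) := FlatModuli.mk '' {ρ | ρ.IsIrreducible}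

/-- Pullback of (gauge equivalence classes of) flat connections along a pointed continuous map. -/
noncomputable def FlatModuli.pullback {Z : Type} [TopologicalSpace Z] {z : Z} (f : C(Z, Y)) (h : f z = y) :
    FlatModuli Y y → FlatModuli Z z :=
  Quotient.map (fun ρ => ρ.comp (FundamentalGroup.mapOfEq f h))
    (fun _ _ ⟨g, hg⟩ => ⟨g, fun _ => hg _⟩)

end Moduli

/-! ## The `r`-holed sphere -/

/-- The `r`-holed sphere `Σ_{0,r}`: the Riemann sphere with the open disks of radius `1/3` around
the points `0, 1, …, r - 1` removed. -/
def HoledSphere (r : ℕ) : Type :=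
  ((⋃ j : Fin r, ((↑) : ℂ → OnePoint ℂ) '' Metric.ball ((j : ℕ) : ℂ) (1 / 3))ᶜ :
    Set (OnePoint ℂ))

noncomputable instance HoledSphere.instTopologicalSpace (r : ℕ) : TopologicalSpace (HoledSphere r) :=
  instTopologicalSpaceSubtype

namespace HoledSphere

variable {r : ℕ}

variable (r) in
/-- The base point of the holed sphere: the point at infinity. -/
def base : HoledSphere r := ⟨OnePoint.infty, by simp⟩

theorem boundary_mem (j : Fin r) (u : Circle) :
    ((((j : ℕ) : ℂ) + u / 3 : ℂ) : OnePoint ℂ) ∈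
      ((⋃ j : Fin r, ((↑) : ℂ → OnePoint ℂ) '' Metric.ball ((j : ℕ) : ℂ) (1 / 3))ᶜ :
        Set (OnePoint ℂ)) := by
  simp only [Set.mem_compl_iff, Set.mem_iUnion, Set.mem_image, not_exists, not_and,
    OnePoint.coe_eq_coe]
  rintro k w hw rfl
  rw [Metric.mem_ball, dist_eq_norm] at hw
  have hu : ‖((u : ℂ) / 3)‖ = 1 / 3 := by simp [Circle.norm_coe]
  by_cases hjk : j = k
  · subst hjk
    rw [add_sub_cancel_left, hu] at hw
    exact lt_irrefl _ hw
  · have h1 : (1 : ℝ) ≤ ‖(((j : ℕ) : ℂ) - ((k : ℕ) : ℂ))‖ := by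
      have hz : ((j : ℕ) : ℤ) - ((k : ℕ) : ℤ) ≠ 0 := by
        intro h; exact hjk (Fin.ext (by omega))
      have h2 : (((j : ℕ) : ℂ) - ((k : ℕ) : ℂ)) = ((((j : ℕ) : ℤ) - ((k : ℕ) : ℤ) : ℤ) : ℂ) := by
        push_cast; ring
      rw [h2, Complex.norm_intCast]
      exact_mod_cast Int.one_le_abs hz
    have h3 : (((j : ℕ) : ℂ) - ((k : ℕ) : ℂ)) =
        (((j : ℕ) : ℂ) + u / 3 - ((k : ℕ) : ℂ)) - u / 3 := by ring
    have h4 := norm_sub_le (((j : ℕ) : ℂ) + u / 3 - ((k : ℕ) : ℂ)) ((u : ℂ) / 3)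
    rw [← h3, hu] at h4
    linarith

/-- The `j`-th boundary circle of the holed sphere, parametrized by the unit circle
(counterclockwise around the `j`-th removed disk, for every `j`). -/
noncomputable def boundary (j : Fin r) (u : Circle) : HoledSphere r :=
  ⟨((((j : ℕ) : ℂ) + u / 3 : ℂ) : OnePoint ℂ), boundary_mem j u⟩

theorem continuous_boundary (j : Fin r) : Continuous (boundary j) := by
  refine Continuous.subtype_mk (OnePoint.continuous_coe.comp ?_) _
  fun_prop

/-- The loop running once around the `j`-th boundary circle. -/
noncomputable def boundaryLoop (j : Fin r) : Path (boundary j 1) (boundary j 1) where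
  toFun t := boundary j (Circle.exp (2 * Real.pi * t))
  continuous_toFun := (continuous_boundary j).comp (by fun_prop)
  source' := by simp
  target' := by simp

/-- The flat connection `ρ` on the holed sphere has holonomy around the `j`-th boundary component
contained in the conjugacy class `c`. The boundary loop is connected to the base point by a path
`γ`; the conjugacy class of the holonomy does not depend on the choice of `γ`. -/
def HasHolonomy (ρ : HolRep (HoledSphere r) (base r)) (j : Fin r) (c : ConjClasses SU2) : Prop :=
  ∃ γ : Path (base r) (boundary j 1),
    ConjClasses.mk (ρ (FundamentalGroup.fromPath
      (Path.Homotopic.Quotient.mk (γ.trans ((boundaryLoop j).trans γ.symm))))) = c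

/-- The moduli space `M(Σ_{0,r}, C)` of flat `SU(2)`-connections on the holed sphere whose holonomy
around the `j`-th boundary component is contained in `C j`, for each `j`. -/
def moduli (C : Fin r → ConjClasses SU2) : Set (FlatModuli (HoledSphere r) (base r)) :=
  FlatModuli.mk '' {ρ | ∀ j, HasHolonomy ρ j (C j)}

/-- The subspace `M^Irr(Σ_{0,r}, C)` of irreducible flat connections in `M(Σ_{0,r}, C)`. -/
def irrModuli (C : Fin r → ConjClasses SU2) : Set (FlatModuli (HoledSphere r) (base r)) :=
  moduli C ∩ _root_.irrModuli (HoledSphere r) (base r)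

end HoledSphere

/-! ## The Seifert fibered manifold -/

section Seifert

variable {r : ℕ} (p : Fin r → ℕ) (q : Fin r → ℤ)

/-- The pieces from which the Seifert manifold is glued: `Σ_{0,r} × S¹` and `r` solid tori
`D² × S¹`. -/
abbrev SeifertPieces (r : ℕ) : Type :=
  (HoledSphere r × Circle) ⊕ (Fin r × (Metric.closedBall (0 : ℂ) 1 × Circle))

/-- The inclusion `S¹ = ∂D² ⊆ D²`. -/
def diskBoundary (u : Circle) : Metric.closedBall (0 : ℂ) 1 := ⟨u, by simp [Circle.norm_coe]⟩

/-- The gluing of the boundary torus of the `j`-th solid torus to the `j`-th boundary torus of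
`Σ_{0,r} × S¹`. With `x_j` the `j`-th boundary circle and `h` the fibre, the meridian of the solid
torus is attached to `x_j ^ p_j * h ^ (-q_j)`, and its longitude to `x_j ^ s_j * h ^ t_j`, where
`s_j` and `t_j` are Bézout coefficients, `q_j * s_j + p_j * t_j = gcd (q_j, p_j)`, so that the gluing
matrix has determinant one when `p_j` and `q_j` are coprime. -/
inductive SeifertGlue : SeifertPieces r → SeifertPieces r → Prop
  | glue (j : Fin r) (u v : Circle) :
      SeifertGlue (Sum.inr (j, (diskBoundary u, v)))
        (Sum.inl (HoledSphere.boundary j (u ^ p j * v ^ Int.gcdA (q j) (p j)),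
          u ^ (-q j) * v ^ Int.gcdB (q j) (p j)))

/-- The closed Seifert fibered `3`-manifold over the two-sphere with Seifert invariants
`{0; (p_1/q_1), …, (p_r/q_r)}`, as a quotient space of its pieces. -/
noncomputable def SeifertManifold : Type := Quot (SeifertGlue p q)

noncomputable instance SeifertManifold.instTopologicalSpace : TopologicalSpace (SeifertManifold p q) :=
  inferInstanceAs (TopologicalSpace (Quot (SeifertGlue p q)))

namespace SeifertManifold

/-- The base point `(∞, 1)` in the piece `Σ_{0,r} × S¹`. -/
noncomputable def base : SeifertManifold p q := Quot.mk _ (Sum.inl (HoledSphere.base r, 1))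

/-- The embedding `ι : Σ_{0,r} ↪ X`, `z ↦ (z, s z)`, given by a section `s` of the trivial circle
bundle `Σ_{0,r} × S¹ ⊆ X` over the holed sphere. -/
noncomputable def embed (s : C(HoledSphere r, Circle)) : C(HoledSphere r, SeifertManifold p q) where
  toFun z := Quot.mk _ (Sum.inl (z, s z))
  continuous_toFun := continuous_quot_mk.comp (continuous_inl.comp (by fun_prop))

theorem embed_base (s : C(HoledSphere r, Circle)) (hs : s (HoledSphere.base r) = 1) :
    embed p q s (HoledSphere.base r) = base p q := by
  change Quot.mk _ (Sum.inl (HoledSphere.base r, s (HoledSphere.base r))) = _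
  rw [hs]
  rfl

end SeifertManifold

/-- The section `s` winds `n` times around the fibre along the `j`-th boundary circle. -/
def HasWinding (s : C(HoledSphere r, Circle)) (j : Fin r) (n : ℤ) : Prop :=
  ∃ a : C(Circle, ℝ), ∀ u : Circle, s (HoledSphere.boundary j u) = u ^ n * Circle.exp (a u)

/-- The section `s` is normalized: it maps the base point to `1`, and the Seifert invariants of the
manifold with respect to `s`, which are `(p_j, q_j + n_j * p_j)` if `s` winds `n_j` times around the
fibre along the `j`-th boundary circle, have an even second entry for every `j` but the first. If
the `q_j` are even for every `j` but the first, then the constant section `1` is normalized. -/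
def IsNormalizedSection (s : C(HoledSphere r, Circle)) : Prop :=
  s (HoledSphere.base r) = 1 ∧
    ∀ j : Fin r, (j : ℕ) ≠ 0 → ∃ n : ℤ, HasWinding s j n ∧ Even (q j + n * p j)

/-! ## The sets `𝔏(p_1, …, p_r)` and `ℜ(p_1, …, p_r)` -/

/-- The set `𝔏(p_1, …, p_r)`. -/
def setL : Set (Fin r → ℤ) :=
  {ℓ | (∀ j, 0 ≤ ℓ j ∧ ℓ j ≤ p j) ∧
    3 ≤ (Finset.univ.filter fun j => ¬ ((p j : ℤ) ∣ ℓ j)).card ∧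
    ∀ j : Fin r, (j : ℕ) ≠ 0 → Even (ℓ j)}

/-- The set `ℜ(p_1, …, p_r)`. -/
def setR : Set (Fin r → ℤ) :=
  {ℓ | ℓ ∈ setL p ∧ ∀ J : Finset (Fin r), Odd J.card →
    1 < ∑ j ∈ J, ((p j : ℚ) - ℓ j) / p j + ∑ j ∈ Jᶜ, (ℓ j : ℚ) / p j}

/-- The tuple `C^(ℓ)` of conjugacy classes: `C_j` is the class of
`diag(e^{π i ℓ_j / p_j}, e^{-π i ℓ_j / p_j})`. -/
noncomputable def holClass (ℓ : Fin r → ℤ) (j : Fin r) : ConjClasses SU2 :=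
  ConjClasses.mk (SU2.diag (Real.pi * ℓ j / p j))

end Seifert

/-!
The fundamental groups and the topology of the moduli spaces are computed through representations.
A representation of a fundamental group in a group `G` is the same as a `G`-valued parallel
transport on paths (`Transport`), and van Kampen's theorem says that transports can be glued
(`Transport.Compatible.exists_glue`) and compared (`Transport.eq_of_cover`) on the members of an
open cover. The group `G` is arbitrary. Applied to the group of continuous maps from a space `T` to
`SU(2)`, the same theorems extend families of representations continuously in a parameter `t` in
`T`.

In this way the fundamental group of the holed sphere is found to be generated by the boundary
loops, with one relation, that their ordered product is one (`HoledSphere.revProd_meridian`,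
`HoledSphere.exists_hom`, `HoledSphere.hom_ext`). In the Seifert manifold the fibre becomes
central, and each solid torus adds the relation given by its meridian
(`SeifertManifold.commute_fiber`, `SeifertManifold.pow_meridian`, `SeifertManifold.exists_hom`,
`SeifertManifold.hom_ext`).

By Schur's lemma an irreducible representation maps the fibre to `± 1`. For a normalized section
the `p_j`-th power of the `j`-th boundary holonomy of the pull-back is one for `j ≥ 2`, and it is
the image of the fibre for `j = 1`, as the second entry of the first Seifert invariant is odd. So
the boundary holonomies have angles `π ℓ_j / p_j` with `ℓ_j` even for `j ≥ 2`, and irreducibility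
leaves at least three of them noncentral. Conversely such a representation of the holed sphere
extends uniquely to the Seifert manifold.

Representations of the holed sphere with boundary holonomies of the angles `θ_j` are closed
polygons in the three-sphere with sides `θ_j`. These exist if and only if the polygon inequalities
hold (`SU2.polygon_one_nonempty_iff`), and the space of polygons is path connected
(`SU2.joinedIn_polygon`); both follow by induction on the number of sides from a continuous family
of polygons parametrized by the angle of the end point (`SU2.exists_section`). As the `p_j` are
pairwise coprime, a sum of terms `± ℓ_j / p_j` with a nonintegral term is not an integer. Hence the
polygon inequalities are strict, which gives the set `ℜ` (`HoledSphere.mem_setR_iff`), and no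
representation with these holonomies is reducible (`HoledSphere.isIrreducible_of_half_eq`).

The pull-back is a continuous injection. Only finitely many boundary holonomies occur up to
conjugation, so these are locally constant, and the summands of the disjoint union have open
preimages. The inverse is continuous since the universal family of representations of the holed
sphere extends to the Seifert manifold as a family
(`IsNormalizedWinding.exists_continuous_section`). The summands are nonempty and path connected,
and so they are the path components.
-/

section

/-! ### Parallel transport with values in a group -/

open unitInterval in
/-- A parallel transport on `Y` with values in the group `G`: a functor from the fundamental
groupoid of `Y` to `G`, written on paths. The order of the factors in `map_trans` is the one for
which transport around loops is a homomorphism on Mathlib's `FundamentalGroup`, where `p * q` is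
first `q`, then `p`. -/
structure Transport (Y : Type*) [TopologicalSpace Y] (G : Type*) [Group G] where
  toFun : ∀ {x y : Y}, Path x y → G
  map_homotopic : ∀ {x y : Y} {p q : Path x y}, p.Homotopic q → toFun p = toFun q
  map_trans : ∀ {x y z : Y} (p : Path x y) (q : Path y z), toFun (p.trans q) = toFun q * toFun p

namespace Transport

open unitInterval

variable {Y Z : Type*} [TopologicalSpace Y] [TopologicalSpace Z] {G : Type*} [Group G]

theorem congr (F : Transport Y G) {x y x' y' : Y} (p : Path x y) (q : Path x' y')
    (h : ∀ t, p t = q t) : F.toFun p = F.toFun q := by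
  have hx : x = x' := by rw [← p.source, ← q.source, h]
  have hy : y = y' := by rw [← p.target, ← q.target, h]
  subst hx hy
  congr 1
  ext t
  exact h t

theorem map_refl (F : Transport Y G) (x : Y) : F.toFun (Path.refl x) = 1 := by
  have h := F.map_trans (Path.refl x) (Path.refl x)
  rw [Path.refl_trans_refl] at h
  simpa using h

theorem map_const (F : Transport Y G) {x y : Y} (p : Path x y) (h : ∀ t, p t = x) :
    F.toFun p = 1 := by
  rw [F.congr p (Path.refl x) (by simpa using h), F.map_refl]

theorem map_symm (F : Transport Y G) {x y : Y} (p : Path x y) :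
    F.toFun p.symm = (F.toFun p)⁻¹ := by
  have h := F.map_trans p p.symm
  rw [← F.map_homotopic ⟨Path.Homotopy.reflTransSymm p⟩, F.map_refl] at h
  exact eq_inv_of_mul_eq_one_left h.symm

/-- The pullback of a parallel transport along a continuous map. -/
def comap (F : Transport Y G) (f : C(Z, Y)) : Transport Z G where
  toFun p := F.toFun (p.map f.continuous)
  map_homotopic h := F.map_homotopic (h.map f)
  map_trans p q := by rw [Path.map_trans, F.map_trans]

theorem comap_toFun (F : Transport Y G) (f : C(Z, Y)) {x y : Z} (p : Path x y) :
    (F.comap f).toFun p = F.toFun (p.map f.continuous) := rfl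

/-- The change of a parallel transport under a (not necessarily continuous) gauge
transformation. -/
def gauge (F : Transport Y G) (g : Y → G) : Transport Y G where
  toFun {x y} p := g y * F.toFun p * (g x)⁻¹
  map_homotopic h := by rw [F.map_homotopic h]
  map_trans p q := by rw [F.map_trans]; group

/-- The flat parallel transport with global primitive `g`. -/
def ofPrimitive (g : Y → G) : Transport Y G where
  toFun {x y} _ := g y * (g x)⁻¹
  map_homotopic _ := rfl
  map_trans _ _ := by group

theorem exists_primitive (F : Transport Y G) [SimplyConnectedSpace Y] :
    ∃ g : Y → G, ∀ {x y : Y} (p : Path x y), F.toFun p = g y * (g x)⁻¹ := by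
  obtain ⟨y₀⟩ : Nonempty Y := inferInstance
  refine ⟨fun y => F.toFun (PathConnectedSpace.somePath y₀ y), fun {x y} p => ?_⟩
  rw [eq_mul_inv_iff_mul_eq, ← F.map_trans]
  exact F.map_homotopic (SimplyConnectedSpace.paths_homotopic _ _)

theorem _root_.SimplyConnectedSpace.prod (A B : Type*) [TopologicalSpace A] [TopologicalSpace B]
    [SimplyConnectedSpace A] [SimplyConnectedSpace B] : SimplyConnectedSpace (A × B) := by
  rw [simply_connected_iff_paths_homotopic']
  refine ⟨inferInstance, fun {x y} p q => ?_⟩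
  have h := Path.Homotopic.prod_projLeft_projRight (Path.Homotopic.Quotient.mk p)
  rw [← Path.Homotopic.Quotient.eq, ← h,
    ← Path.Homotopic.prod_projLeft_projRight (Path.Homotopic.Quotient.mk q)]
  congr 1 <;> exact Subsingleton.elim _ _

theorem _root_.unitInterval.simplyConnectedSpace : SimplyConnectedSpace I :=
  have : ContractibleSpace I := (convex_Icc (0 : ℝ) 1).contractibleSpace ⟨0, by simp⟩
  inferInstance

/-- The transports along the two ways around a square agree. -/
theorem rect (F : Transport Y G) (K : C(I × I, Y)) {a b c d : Y} (bot : Path a b) (top : Path c d)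
    (l : Path a c) (r : Path b d) (hb : ∀ t, K (0, t) = bot t) (ht : ∀ t, K (1, t) = top t)
    (hl : ∀ s, K (s, 0) = l s) (hr : ∀ s, K (s, 1) = r s) :
    F.toFun r * F.toFun bot = F.toFun top * F.toFun l := by
  let e : Path (0 : I) 1 := { toFun := id, source' := rfl, target' := rfl }
  have := unitInterval.simplyConnectedSpace
  have := SimplyConnectedSpace.prod I I
  obtain ⟨g, hg⟩ := (F.comap K).exists_primitive
  have h1 := hg ((Path.refl (0 : I)).prod e)
  have h2 := hg ((Path.refl (1 : I)).prod e)
  have h3 := hg (e.prod (Path.refl (0 : I)))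
  have h4 := hg (e.prod (Path.refl (1 : I)))
  rw [comap_toFun, F.congr _ bot (fun t => by simpa [e] using hb t)] at h1
  rw [comap_toFun, F.congr _ top (fun t => by simpa [e] using ht t)] at h2
  rw [comap_toFun, F.congr _ l (fun t => by simpa [e] using hl t)] at h3
  rw [comap_toFun, F.congr _ r (fun t => by simpa [e] using hr t)] at h4
  rw [h1, h2, h3, h4]
  group

theorem subpath_mul (F : Transport Y G) {x y : Y} (p : Path x y) (s t u : I) :
    F.toFun (p.subpath t u) * F.toFun (p.subpath s t) = F.toFun (p.subpath s u) := by
  rw [← F.map_trans]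
  exact F.map_homotopic ⟨Path.Homotopy.subpathTransSubpath p s t u⟩

theorem subpath_zero_one (F : Transport Y G) {x y : Y} (p : Path x y) :
    F.toFun (p.subpath 0 1) = F.toFun p := F.congr _ _ (fun t => by simp)

/-- The holonomy homomorphism of a parallel transport. -/
def toHom (F : Transport Y G) (y : Y) : FundamentalGroup Y y →* G where
  toFun γ := Quotient.lift (s := Path.Homotopic.setoid y y) F.toFun
    (fun _ _ h => F.map_homotopic h) γ
  map_one' := F.map_refl y
  map_mul' γ δ := by
    induction γ using Quotient.inductionOn with | _ γ =>
    induction δ using Quotient.inductionOn with | _ δ =>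
    exact F.map_trans δ γ

theorem toHom_fromPath (F : Transport Y G) {y : Y} (p : Path y y) :
    F.toHom y (FundamentalGroup.fromPath (Path.Homotopic.Quotient.mk p)) = F.toFun p := rfl

theorem hom_ext {y : Y} {ρ ρ' : FundamentalGroup Y y →* G}
    (h : ∀ p : Path y y, ρ (FundamentalGroup.fromPath (Path.Homotopic.Quotient.mk p)) =
      ρ' (FundamentalGroup.fromPath (Path.Homotopic.Quotient.mk p))) : ρ = ρ' := by
  ext γ
  induction γ using Quotient.inductionOn with | _ γ =>
  exact h γ

open Classical in
/-- A chosen path from the base point to each point, constant at the base point. -/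
noncomputable def tether [PathConnectedSpace Y] (y x : Y) : Path y x :=
  if h : x = y then (Path.refl y).cast rfl h else PathConnectedSpace.somePath y x

theorem tether_self [PathConnectedSpace Y] (y : Y) : tether y y = Path.refl y := by
  simp [tether]

/-- The parallel transport with prescribed holonomy homomorphism which is trivial along the chosen
paths from the base point. -/
noncomputable def ofHom [PathConnectedSpace Y] {y : Y} (ρ : FundamentalGroup Y y →* G) :
    Transport Y G where
  toFun {a b} p := ρ (FundamentalGroup.fromPath (Path.Homotopic.Quotient.mk
    ((tether y a).trans (p.trans (tether y b).symm))))
  map_homotopic h := by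
    congr 1
    exact Path.Homotopic.Quotient.eq.2
      ((Path.Homotopic.refl _).hcomp (h.hcomp (Path.Homotopic.refl _)))
  map_trans {a b c} p q := by
    rw [← map_mul]
    congr 1
    change _ = Path.Homotopic.Quotient.trans (Path.Homotopic.Quotient.mk _)
      (Path.Homotopic.Quotient.mk _)
    simp only [FundamentalGroup.fromPath, FundamentalGroup.fromArrow,
      Path.Homotopic.Quotient.mk_trans, Path.Homotopic.Quotient.mk_symm,
      Path.Homotopic.Quotient.trans_assoc]
    congr 2
    rw [← Path.Homotopic.Quotient.trans_assoc (Path.Homotopic.Quotient.symm _),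
      Path.Homotopic.Quotient.symm_trans, Path.Homotopic.Quotient.refl_trans]

theorem ofHom_toFun [PathConnectedSpace Y] {y : Y} (ρ : FundamentalGroup Y y →* G)
    (p : Path y y) : (ofHom ρ).toFun p =
      ρ (FundamentalGroup.fromPath (Path.Homotopic.Quotient.mk p)) := by
  change ρ _ = ρ _
  congr 1
  simp only [tether_self, Path.refl_symm, Path.Homotopic.Quotient.mk_trans,
    Path.Homotopic.Quotient.mk_refl, Path.Homotopic.Quotient.trans_refl,
    Path.Homotopic.Quotient.refl_trans]

theorem toHom_ofHom [PathConnectedSpace Y] {y : Y} (ρ : FundamentalGroup Y y →* G) :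
    (ofHom ρ).toHom y = ρ := by
  apply hom_ext
  intro p
  rw [toHom_fromPath, ofHom_toFun]

theorem toHom_mapOfEq (F : Transport Y G) (f : C(Z, Y)) {z : Z} {y : Y} (h : f z = y) :
    (F.toHom y).comp (FundamentalGroup.mapOfEq f h) = (F.comap f).toHom z := by
  subst h
  apply hom_ext
  intro p
  rw [MonoidHom.comp_apply, FundamentalGroup.mapOfEq_apply]
  rfl

/-! ### The van Kampen theorem for parallel transports -/

section VanKampen

variable {ι : Type*} {U : ι → Set Y}

theorem exists_partition (hU : ∀ i, IsOpen (U i)) (hcov : ∀ y, ∃ i, y ∈ U i) {x y : Y}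
    (p : Path x y) : ∃ t : ℕ → I, t 0 = 0 ∧ Monotone t ∧ (∃ n, ∀ m ≥ n, t m = 1) ∧
      ∀ n, ∃ i, ∀ s ∈ Set.Icc (t n) (t (n + 1)), p s ∈ U i := by
  obtain ⟨t, h0, hm, h1, h⟩ := exists_monotone_Icc_subset_open_cover_unitInterval
    (c := fun i => p ⁻¹' U i) (fun i => (hU i).preimage p.continuous)
    (fun s _ => by
      obtain ⟨i, hi⟩ := hcov (p s)
      exact Set.mem_iUnion.2 ⟨i, hi⟩)
  exact ⟨t, h0, hm, h1, h⟩

theorem _root_.Set.Icc.convexComb_mem {s t : I} (h : s ≤ t) (v : I) :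
    Set.Icc.convexComb s t v ∈ Set.Icc s t := by
  have := ((Set.range_eq_iff _ _).1 (Path.range_subpathAux s t)).1 v
  rwa [Set.uIcc_of_le h] at this

theorem subpath_mem {x y : Y} {p : Path x y} {s t : I} (hst : s ≤ t) {V : Set Y}
    (h : ∀ u ∈ Set.Icc s t, p u ∈ V) (u : I) : p.subpath s t u ∈ V := by
  have : p.subpath s t u ∈ Set.range (p.subpath s t) := ⟨u, rfl⟩
  rw [Path.range_subpath_of_le _ _ _ hst] at this
  obtain ⟨v, hv, hv'⟩ := this
  rw [← hv']
  exact h v hv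

theorem mem_of_subpath_mem {x y : Y} {p : Path x y} {s t : I} (hst : s ≤ t) {V : Set Y}
    (h : ∀ u, p.subpath s t u ∈ V) : ∀ u ∈ Set.Icc s t, p u ∈ V := by
  intro u hu
  have : p u ∈ p '' Set.Icc s t := ⟨u, hu, rfl⟩
  rw [← Path.range_subpath_of_le _ _ _ hst] at this
  obtain ⟨v, hv⟩ := this
  rw [← hv]
  exact h v

/-- The uniqueness half of the van Kampen theorem. -/
theorem eq_of_cover (hU : ∀ i, IsOpen (U i)) (hcov : ∀ y, ∃ i, y ∈ U i) (F F' : Transport Y G)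
    (h : ∀ i {x y : Y} (p : Path x y), (∀ t, p t ∈ U i) → F.toFun p = F'.toFun p)
    {x y : Y} (p : Path x y) : F.toFun p = F'.toFun p := by
  obtain ⟨t, h0, hm, ⟨N, hN⟩, ht⟩ := exists_partition hU hcov p
  have key : ∀ n, F.toFun (p.subpath (t 0) (t n)) = F'.toFun (p.subpath (t 0) (t n)) := by
    intro n
    induction n with
    | zero => rw [F.map_const _ (by simp), F'.map_const _ (by simp)]
    | succ n ih =>
      obtain ⟨i, hi⟩ := ht n
      rw [← F.subpath_mul _ _ (t n), ← F'.subpath_mul _ _ (t n), ih,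
        h i _ (subpath_mem (hm n.le_succ) hi)]
  have := key N
  rwa [h0, hN N le_rfl, subpath_zero_one, subpath_zero_one] at this

/-- The value of a transport on a subspace, on a path which stays in this subspace. -/
def on {V : Set Y} (F : Transport V G) {x y : Y} (p : Path x y) (h : ∀ t, p t ∈ V) : G :=
  F.toFun (x := ⟨x, by simpa using h 0⟩) (y := ⟨y, by simpa using h 1⟩)
    { toFun := fun t => ⟨p t, h t⟩
      continuous_toFun := p.continuous.subtype_mk _
      source' := by simp
      target' := by simp }

theorem on_congr {V : Set Y} (F : Transport V G) {x y x' y' : Y} (p : Path x y) (q : Path x' y')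
    (h : ∀ t, p t ∈ V) (h' : ∀ t, q t ∈ V) (hpq : ∀ t, p t = q t) : F.on p h = F.on q h' :=
  F.congr _ _ (fun t => Subtype.ext (hpq t))

theorem on_const {V : Set Y} (F : Transport V G) {x y : Y} (p : Path x y) (h : ∀ t, p t ∈ V)
    (hp : ∀ t, p t = x) : F.on p h = 1 :=
  F.map_const _ (fun t => Subtype.ext (hp t))

theorem on_rect {V : Set Y} (F : Transport V G) (K : C(I × I, Y)) (hK : ∀ z, K z ∈ V)
    {a b c d : Y} (bot : Path a b) (top : Path c d)
    (l : Path a c) (r : Path b d) (hb : ∀ t, K (0, t) = bot t) (ht : ∀ t, K (1, t) = top t)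
    (hl : ∀ s, K (s, 0) = l s) (hr : ∀ s, K (s, 1) = r s) :
    F.on r (fun t => hr t ▸ hK _) * F.on bot (fun t => hb t ▸ hK _) =
      F.on top (fun t => ht t ▸ hK _) * F.on l (fun t => hl t ▸ hK _) := by
  apply F.rect ⟨fun z => (⟨K z, hK z⟩ : V), K.continuous.subtype_mk _⟩
  · exact fun t => Subtype.ext (hb t)
  · exact fun t => Subtype.ext (ht t)
  · exact fun t => Subtype.ext (hl t)
  · exact fun t => Subtype.ext (hr t)

theorem on_subpath_mul {V : Set Y} (F : Transport V G) {x y : Y} (p : Path x y) {s t u : I}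
    (hst : s ≤ t) (htu : t ≤ u) (h : ∀ v ∈ Set.Icc s u, p v ∈ V) :
    F.on (p.subpath t u) (subpath_mem htu fun v hv => h v ⟨hst.trans hv.1, hv.2⟩) *
      F.on (p.subpath s t) (subpath_mem hst fun v hv => h v ⟨hv.1, hv.2.trans htu⟩) =
      F.on (p.subpath s u) (subpath_mem (hst.trans htu) h) := by
  -- the square degenerates along its left edge: it interpolates between `[s, t]` and `[s, u]`
  have := F.on_rect (K := ⟨fun z => p (Set.Icc.convexComb s (Set.Icc.convexComb t u z.1) z.2),
      p.continuous.comp (Set.Icc.continuous_convexComb_prod.comp (continuous_const.prodMk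
        ((Set.Icc.continuous_convexComb_prod.comp (continuous_const.prodMk
          (continuous_const.prodMk continuous_fst))).prodMk continuous_snd)))⟩)
    (fun z => by
      apply subpath_mem (p := p) (s := s) (t := Set.Icc.convexComb t u z.1)
      · exact hst.trans (Set.Icc.convexComb_mem htu _).1
      · exact fun v hv => h v ⟨hv.1, hv.2.trans (Set.Icc.convexComb_mem htu _).2⟩)
    (p.subpath s t) (p.subpath s u) (Path.refl (p s)) (p.subpath t u)
    (fun v => by simp [Path.subpath]) (fun v => by simp [Path.subpath])
    (fun v => by simp) (fun v => by simp [Path.subpath])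
  rw [this, F.on_const (Path.refl (p s)) _ (fun _ => rfl), mul_one]

variable (F : ∀ i, Transport (U i) G)

/-- A primitive of a family of local transports along the path `p`. -/
def IsPrimitive {x y : Y} (p : Path x y) (φ : I → G) (b : I) : Prop :=
  ∀ i s t, s ≤ t → t ≤ b → ∀ h : (∀ u, p.subpath s t u ∈ U i),
    (F i).on (p.subpath s t) h = φ t * (φ s)⁻¹

/-- The local transports agree on common paths. -/
def Compatible : Prop :=
  ∀ i j {x y : Y} (p : Path x y) (hi : ∀ t, p t ∈ U i) (hj : ∀ t, p t ∈ U j),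
    (F i).on p hi = (F j).on p hj

variable {F}

open Classical in
/-- Local transports have a primitive along each path: it is extended over one interval after the
other of a subdivision whose intervals are mapped into members of the cover. -/
theorem Compatible.exists_isPrimitive (hF : Compatible F) (hU : ∀ i, IsOpen (U i))
    (hcov : ∀ y, ∃ i, y ∈ U i) {x y : Y} (p : Path x y) : ∃ φ, IsPrimitive F p φ 1 := by
  obtain ⟨t, h0, hm, ⟨N, hN⟩, ht⟩ := exists_partition hU hcov p
  have key : ∀ n, ∃ φ, IsPrimitive F p φ (t n) := by
    intro n
    induction n with
    | zero =>
      refine ⟨fun _ => 1, fun i s u hsu hu h => ?_⟩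
      have hs : s = 0 := by rw [h0] at hu; exact le_antisymm (hsu.trans hu) bot_le
      have hu' : u = 0 := by rw [h0] at hu; exact le_antisymm hu bot_le
      subst hs hu'
      rw [(F i).on_const _ _ (by simp)]
      simp
    | succ n ih =>
      obtain ⟨φ, hφ⟩ := ih
      obtain ⟨a, ha⟩ := ht n
      let ψ : I → G := fun u => if h : ∀ v, p.subpath (t n) u v ∈ U a then
        (F a).on (p.subpath (t n) u) h * φ (t n) else 1
      have hψ : ∀ u (h1 : t n ≤ u) (h2 : u ≤ t (n + 1)), ψ u =
          (F a).on (p.subpath (t n) u)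
            (subpath_mem h1 fun v hv => ha v ⟨hv.1, hv.2.trans h2⟩) * φ (t n) := by
        intro u h1 h2
        simp only [ψ]
        rw [dif_pos]
      refine ⟨fun u => if u ≤ t n then φ u else ψ u, fun i s u hsu hu h => ?_⟩
      have hmem := mem_of_subpath_mem hsu h
      by_cases h1 : u ≤ t n
      · simp only [h1, hsu.trans h1, if_true]
        exact hφ i s u hsu h1 h
      by_cases h2 : s ≤ t n
      · simp only [h1, h2, if_true, if_false]
        push Not at h1
        rw [hψ u h1.le hu, ← (F i).on_subpath_mul p h2 h1.le hmem, mul_assoc,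
          hφ i s (t n) h2 le_rfl, hF i a]
      · simp only [h1, h2, if_false]
        push Not at h1 h2
        rw [hψ u h1.le hu, hψ s h2.le (hsu.trans hu), ← (F a).on_subpath_mul p h2.le hsu
          (fun v hv => ha v ⟨hv.1, hv.2.trans hu⟩), hF i a _ h (subpath_mem hsu
            fun v hv => ha v ⟨h2.le.trans hv.1, hv.2.trans hu⟩)]
        group
  simpa only [hN N le_rfl] using key N

/-- Two primitives along the same path have the same increments. -/
theorem IsPrimitive.unique (hU : ∀ i, IsOpen (U i))
    (hcov : ∀ y, ∃ i, y ∈ U i) {x y : Y} {p : Path x y} {φ ψ : I → G} (hφ : IsPrimitive F p φ 1)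
    (hψ : IsPrimitive F p ψ 1) : φ 1 * (φ 0)⁻¹ = ψ 1 * (ψ 0)⁻¹ := by
  obtain ⟨t, h0, hm, ⟨N, hN⟩, ht⟩ := exists_partition hU hcov p
  have key : ∀ n, φ (t n) * (φ 0)⁻¹ = ψ (t n) * (ψ 0)⁻¹ := by
    intro n
    induction n with
    | zero => simp [h0]
    | succ n ih =>
      obtain ⟨i, hi⟩ := ht n
      have hi' := subpath_mem (hm n.le_succ) hi
      have e1 := hφ i _ _ (hm n.le_succ) le_top hi'
      have e2 := hψ i _ _ (hm n.le_succ) le_top hi'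
      calc _ = (φ (t (n + 1)) * (φ (t n))⁻¹) * (φ (t n) * (φ 0)⁻¹) := by group
        _ = _ := by rw [ih, ← e1, e2]; group
  have := key N
  rwa [hN N le_rfl] at this

/-- Primitives along homotopic paths have the same total increment. The square of the homotopy is
divided into a grid whose cells are mapped into members of the cover; the transports along the
vertical edges between two rows compare the increments of the primitives along these rows, and they
are trivial at both ends. -/
theorem IsPrimitive.homotopic (hF : Compatible F) (hU : ∀ i, IsOpen (U i))
    (hcov : ∀ y, ∃ i, y ∈ U i) {x y : Y} {p q : Path x y} (hpq : p.Homotopic q) {φ ψ : I → G}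
    (hφ : IsPrimitive F p φ 1) (hψ : IsPrimitive F q ψ 1) :
    φ 1 * (φ 0)⁻¹ = ψ 1 * (ψ 0)⁻¹ := by
  obtain ⟨H⟩ := hpq
  obtain ⟨t, h0, hm, ⟨N, hN⟩, ht⟩ := exists_monotone_Icc_subset_open_cover_unitInterval_prod_self
    (c := fun i => H ⁻¹' U i) (fun i => (hU i).preimage H.continuous)
    (fun s _ => by
      obtain ⟨i, hi⟩ := hcov (H s)
      exact Set.mem_iUnion.2 ⟨i, hi⟩)
  choose Φ hΦ using fun k => hF.exists_isPrimitive hU hcov (H.eval (t k))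
  -- the vertical paths of the grid
  let vert : ∀ k m, Path (H (t k, t m)) (H (t (k + 1), t m)) := fun k m =>
    { toFun := fun s => H (Set.Icc.convexComb (t k) (t (k + 1)) s, t m)
      continuous_toFun := H.continuous.comp ((Set.Icc.continuous_convexComb_prod.comp
        (continuous_const.prodMk (continuous_const.prodMk continuous_id))).prodMk
          continuous_const)
      source' := by simp
      target' := by simp }
  have cc : ∀ k s, Set.Icc.convexComb (t k) (t (k + 1)) s ∈ Set.Icc (t k) (t (k + 1)) :=
    fun k s => Set.Icc.convexComb_mem (hm k.le_succ) s
  have step : ∀ k m a (h : ∀ s, vert k m s ∈ U a),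
      (F a).on (vert k m) h * (Φ k (t m) * (Φ k 0)⁻¹) =
        Φ (k + 1) (t m) * (Φ (k + 1) 0)⁻¹ := by
    intro k m
    induction m with
    | zero =>
      intro a h
      rw [(F a).on_const _ _ (fun s => by simp [vert, h0])]
      simp [h0]
    | succ m ih =>
      intro a h
      obtain ⟨b, hb⟩ := ht k m
      have hv : ∀ s, vert k (m + 1) s ∈ U b := fun s => hb ⟨cc k s, hm m.le_succ, le_rfl⟩
      have hv' : ∀ s, vert k m s ∈ U b := fun s => hb ⟨cc k s, le_rfl, hm m.le_succ⟩
      have hbot : ∀ s, (H.eval (t k)).subpath (t m) (t (m + 1)) s ∈ U b := fun s =>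
        hb ⟨⟨le_rfl, hm k.le_succ⟩, cc m s⟩
      have htop : ∀ s, (H.eval (t (k + 1))).subpath (t m) (t (m + 1)) s ∈ U b := fun s =>
        hb ⟨⟨hm k.le_succ, le_rfl⟩, cc m s⟩
      have hr := (F b).on_rect (K := ⟨fun z => H (Set.Icc.convexComb (t k) (t (k + 1)) z.1,
          Set.Icc.convexComb (t m) (t (m + 1)) z.2),
          H.continuous.comp (((Set.Icc.continuous_convexComb_prod.comp
            (continuous_const.prodMk (continuous_const.prodMk continuous_fst)))).prodMk
            (Set.Icc.continuous_convexComb_prod.comp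
            (continuous_const.prodMk (continuous_const.prodMk continuous_snd))))⟩)
        (fun z => hb ⟨cc k z.1, cc m z.2⟩)
        ((H.eval (t k)).subpath (t m) (t (m + 1))) ((H.eval (t (k + 1))).subpath (t m) (t (m + 1)))
        (vert k m) (vert k (m + 1)) (fun s => by simp [Path.subpath, Path.Homotopy.eval]; rfl)
        (fun s => by simp [Path.subpath, Path.Homotopy.eval]; rfl) (fun s => by simp [vert]; rfl)
        (fun s => by simp [vert]; rfl)
      have e1 := hΦ k b (t m) (t (m + 1)) (hm m.le_succ) le_top hbot
      have e2 := hΦ (k + 1) b (t m) (t (m + 1)) (hm m.le_succ) le_top htop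
      replace hr : (F b).on (vert k (m + 1)) hv *
          (F b).on ((H.eval (t k)).subpath (t m) (t (m + 1))) hbot =
          (F b).on ((H.eval (t (k + 1))).subpath (t m) (t (m + 1))) htop *
          (F b).on (vert k m) hv' := hr
      rw [hF a b _ h hv]
      calc _ = ((F b).on (vert k (m + 1)) hv * (Φ k (t (m + 1)) * (Φ k (t m))⁻¹)) *
            (Φ k (t m) * (Φ k 0)⁻¹) := by group
        _ = _ := by
          rw [← e1, hr, mul_assoc, ih b hv', e2]
          group
  have key : ∀ k, φ 1 * (φ 0)⁻¹ = Φ k 1 * (Φ k 0)⁻¹ := by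
    intro k
    induction k with
    | zero =>
      have h : IsPrimitive F p (Φ 0) 1 := by
        have := hΦ 0
        rwa [h0, Path.Homotopy.eval_zero] at this
      exact hφ.unique hU hcov h
    | succ k ih =>
      obtain ⟨b, hb⟩ := ht k N
      have := step k N b (fun s => hb ⟨cc k s, le_rfl, hm N.le_succ⟩)
      rw [(F b).on_const _ _ (fun s => by simp [vert, hN N le_rfl]), one_mul, hN N le_rfl] at this
      rw [ih, this]
  rw [key N]
  have h : IsPrimitive F q (Φ N) 1 := by
    have := hΦ N
    rwa [hN N le_rfl, Path.Homotopy.eval_one] at this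
  exact h.unique hU hcov hψ

/-- The existence half of the van Kampen theorem: compatible transports on the members of an open
cover glue. -/
theorem Compatible.exists_glue (hF : Compatible F) (hU : ∀ i, IsOpen (U i))
    (hcov : ∀ y, ∃ i, y ∈ U i) : ∃ E : Transport Y G, ∀ i {x y : Y} (p : Path x y)
      (h : ∀ t, p t ∈ U i), E.toFun p = (F i).on p h := by
  choose Φ hΦ using fun (x y : Y) (p : Path x y) => hF.exists_isPrimitive hU hcov p
  refine ⟨⟨fun {x y} p => Φ x y p 1 * (Φ x y p 0)⁻¹,
    fun h => (hΦ _ _ _).homotopic hF hU hcov h (hΦ _ _ _), ?_⟩, ?_⟩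
  · intro x y z p q
    -- the two halves of a primitive along `p.trans q` are primitives along `p` and along `q`
    have hpq := hΦ _ _ (p.trans q)
    have h1 : IsPrimitive F p (fun s => Φ _ _ (p.trans q) ⟨s / 2, by
        constructor <;> linarith [s.2.1, s.2.2]⟩) 1 := by
      intro i s t hst _ h
      have hc : ∀ v, (p.trans q).subpath ⟨s / 2, by constructor <;> linarith [s.2.1, s.2.2]⟩
          ⟨t / 2, by constructor <;> linarith [t.2.1, t.2.2]⟩ v = p.subpath s t v := by
        intro v
        simp only [Path.subpath, Path.coe_mk', ContinuousMap.coe_mk, Function.comp_apply]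
        rw [Path.trans_apply, dif_pos]
        · congr 1
          ext
          simp [Set.Icc.convexComb]
          ring
        · have := (Set.Icc.convexComb s t v).2.2
          simp [Set.Icc.convexComb] at this ⊢
          linarith
      rw [← hpq i _ _ _ le_top (fun v => by rw [hc]; exact h v)]
      · exact (F i).on_congr _ _ _ _ (fun v => (hc v).symm)
      · have : (s : ℝ) ≤ t := hst
        exact Subtype.mk_le_mk.2 (by linarith)
    have h2 : IsPrimitive F q (fun s => Φ _ _ (p.trans q) ⟨(1 + s) / 2, by
        constructor <;> linarith [s.2.1, s.2.2]⟩) 1 := by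
      intro i s t hst _ h
      have hc : ∀ v, (p.trans q).subpath ⟨(1 + s) / 2, by constructor <;> linarith [s.2.1, s.2.2]⟩
          ⟨(1 + t) / 2, by constructor <;> linarith [t.2.1, t.2.2]⟩ v = q.subpath s t v := by
        intro v
        have hv := (Set.Icc.convexComb s t v).2
        simp only [Path.subpath, Path.coe_mk', ContinuousMap.coe_mk, Function.comp_apply]
        have e : ((Set.Icc.convexComb (⟨(1 + s) / 2, by constructor <;> linarith [s.2.1, s.2.2]⟩ : I)
          ⟨(1 + t) / 2, by constructor <;> linarith [t.2.1, t.2.2]⟩ v : I) : ℝ) =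
          (1 + (Set.Icc.convexComb s t v : I)) / 2 := by
          simp [Set.Icc.convexComb]
          ring
        rw [← Path.extend_apply (p.trans q) (Set.Icc.convexComb _ _ v).2, e,
          Path.extend_trans_of_half_le _ _ (by linarith [hv.1]),
          ← Path.extend_apply q (Set.Icc.convexComb s t v).2]
        congr 1
        ring
      rw [← hpq i _ _ _ le_top (fun v => by rw [hc]; exact h v)]
      · exact (F i).on_congr _ _ _ _ (fun v => (hc v).symm)
      · have : (s : ℝ) ≤ t := hst
        exact Subtype.mk_le_mk.2 (by linarith)
    have e1 := (hΦ _ _ p).unique hU hcov h1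
    have e2 := (hΦ _ _ q).unique hU hcov h2
    have a0 : (⟨((0 : I) : ℝ) / 2, by constructor <;> norm_num⟩ : I) = 0 := by ext; simp
    have a1 : (⟨(1 + ((1 : I) : ℝ)) / 2, by constructor <;> norm_num⟩ : I) = 1 := by
      ext; norm_num
    have a2 : (⟨(1 + ((0 : I) : ℝ)) / 2, by constructor <;> norm_num⟩ : I) =
      ⟨((1 : I) : ℝ) / 2, by constructor <;> norm_num⟩ := by ext; norm_num
    simp only [a0, a1, a2] at e1 e2
    rw [e1, e2]
    group
  · intro i x y p h
    have := hΦ _ _ p i 0 1 bot_le le_top (by simpa using h)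
    change _ * _ = _
    rw [← this]
    exact (F i).on_congr _ _ _ _ (by simp)

end VanKampen

end Transport

end

section

/-! ### Parallel transport on the circle -/

theorem Circle.exp_eq_exp_iff {x y : ℝ} :
    Circle.exp x = Circle.exp y ↔ ∃ n : ℤ, x = y + 2 * Real.pi * n := by
  rw [Circle.exp_eq_exp]
  constructor
  · rintro ⟨m, hm⟩
    exact ⟨m, by rw [hm]; ring⟩
  · rintro ⟨m, hm⟩
    exact ⟨m, by rw [hm]; ring⟩

theorem neg_iff_neg_of_ne_zero {f : unitInterval → ℝ} (hf : Continuous f) (h : ∀ t, f t ≠ 0) :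
    f 0 < 0 ↔ f 1 < 0 := by
  have key : ∀ a b, f a < 0 → f b < 0 := by
    intro a b ha
    by_contra hb
    push Not at hb
    obtain ⟨t, ht⟩ := intermediate_value_univ a b hf ⟨ha.le, hb⟩
    exact h t ht
  exact ⟨key 0 1, key 1 0⟩

/-- The loop which runs once around the circle. -/
noncomputable def circleLoop : Path (1 : Circle) 1 where
  toFun t := Circle.exp (2 * Real.pi * t)
  continuous_toFun := by fun_prop
  source' := by simp
  target' := by simp

namespace Transport

open unitInterval

variable {G : Type*} [Group G]

/-- On the universal cover of the circle a parallel transport has a primitive, whose monodromy is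
the transport around the circle. -/
theorem exists_circle_primitive (F : Transport Circle G) : ∃ g : ℝ → G, g 0 = 1 ∧
    (∀ {u v : Circle} (p : Path u v) (a : C(I, ℝ)), (∀ t, p t = Circle.exp (a t)) →
      F.toFun p = g (a 1) * (g (a 0))⁻¹) ∧
    ∀ (x : ℝ) (n : ℤ), g (x + 2 * Real.pi * n) = g x * F.toFun circleLoop ^ n := by
  obtain ⟨g, hg⟩ := (F.comap ⟨Circle.exp, Circle.exp.continuous⟩).exists_primitive
  have hF : ∀ {u v : Circle} (p : Path u v) (a : C(I, ℝ)), (∀ t, p t = Circle.exp (a t)) →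
      F.toFun p = g (a 1) * (g (a 0))⁻¹ := by
    intro u v p a h
    have := hg (x := a 0) (y := a 1) ⟨a, rfl, rfl⟩
    rw [← this, comap_toFun]
    exact F.congr _ _ h
  let seg : ℝ → ℝ → C(I, ℝ) := fun x y => ⟨fun t => x + t * (y - x), by fun_prop⟩
  have s0 : ∀ x y, seg x y 0 = x := fun x y => by simp [seg]
  have s1 : ∀ x y, seg x y 1 = y := fun x y => by simp [seg]
  have hloop : F.toFun circleLoop = g (2 * Real.pi) * (g 0)⁻¹ := by
    rw [hF circleLoop (seg 0 (2 * Real.pi)) (fun t => by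
      simp only [circleLoop, seg, ContinuousMap.coe_mk, sub_zero, zero_add, Path.coe_mk']
      rw [mul_comm]), s0, s1]
  have hper : ∀ x, g (x + 2 * Real.pi) * (g (2 * Real.pi))⁻¹ = g x * (g 0)⁻¹ := by
    intro x
    let p : Path (Circle.exp 0) (Circle.exp x) :=
      ⟨⟨fun t => Circle.exp (seg 0 x t), by fun_prop⟩, by simp [seg], by simp [seg]⟩
    have h1 := hF p (seg 0 x) (fun t => rfl)
    have h2 := hF p (seg (2 * Real.pi) (x + 2 * Real.pi)) (fun t => by
      change Circle.exp (0 + t * (x - 0)) =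
        Circle.exp (2 * Real.pi + t * (x + 2 * Real.pi - 2 * Real.pi))
      rw [Circle.exp_eq_exp_iff]
      exact ⟨-1, by push_cast; ring⟩)
    rw [s0, s1] at h1 h2
    rw [← h1, ← h2]
  have hper' : ∀ x, g (x + 2 * Real.pi) * (g 0)⁻¹ = g x * (g 0)⁻¹ * F.toFun circleLoop := by
    intro x
    rw [← hper x, hloop]
    group
  refine ⟨fun x => g x * (g 0)⁻¹, by simp, fun p a h => by rw [hF p a h]; group, fun x n => ?_⟩
  induction n using Int.induction_on with
  | zero => simp
  | succ n ih =>
    have e : x + 2 * Real.pi * ((n + 1 : ℤ) : ℝ) = x + 2 * Real.pi * (n : ℤ) + 2 * Real.pi := by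
      push_cast
      ring
    rw [zpow_add_one, ← mul_assoc, ← ih, ← hper', e]
  | pred n ih =>
    have e : x + 2 * Real.pi * ((-n : ℤ) : ℝ) =
        x + 2 * Real.pi * ((-n - 1 : ℤ) : ℝ) + 2 * Real.pi := by
      push_cast
      ring
    rw [zpow_sub_one, ← mul_assoc, ← ih, eq_mul_inv_iff_mul_eq, ← hper', e]

/-- A parallel transport on the circle without holonomy depends on the endpoints only. -/
theorem exists_primitive_of_circleLoop (F : Transport Circle G) (h : F.toFun circleLoop = 1) :
    ∃ φ : Circle → G, ∀ {u v : Circle} (p : Path u v), F.toFun p = φ v * (φ u)⁻¹ := by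
  obtain ⟨g, -, hg, hper⟩ := F.exists_circle_primitive
  have hg' : ∀ x y, Circle.exp x = Circle.exp y → g x = g y := by
    intro x y hxy
    obtain ⟨n, rfl⟩ := Circle.exp_eq_exp_iff.1 hxy
    rw [hper, h, one_zpow, mul_one]
  refine ⟨fun u => g (Complex.arg u), fun {u v} p => ?_⟩
  have hu : p.toContinuousMap 0 = Circle.exp (Complex.arg u) := by
    rw [Circle.exp_arg]; exact p.source
  have hl := Circle.isCoveringMap_exp.liftPath_lifts p.toContinuousMap (Complex.arg u) hu
  rw [hg p (Circle.isCoveringMap_exp.liftPath p.toContinuousMap (Complex.arg u) hu)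
    (fun t => (congrFun hl t).symm), Circle.isCoveringMap_exp.liftPath_zero]
  congr 1
  apply hg'
  rw [Circle.exp_arg]
  exact (congrFun hl 1).trans p.target

/-- A transport on the circle with a given holonomy. It is glued from trivial transports on the
complements of `-1` and of `1`; on the second one the primitive jumps from `1` on the upper half
circle to `e` on the lower one. -/
theorem exists_circleLoop_eq (e : G) : ∃ F : Transport Circle G, F.toFun circleLoop = e := by
  let U : Bool → Set Circle := fun b => if b then {1}ᶜ else {-1}ᶜ
  let φ : Circle → G := fun u => if (u : ℂ).im < 0 then e else 1
  let F : ∀ b, Transport (U b) G := fun b => ofPrimitive fun u => if b then φ u else 1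
  have hU : ∀ b, IsOpen (U b) := by
    intro b
    cases b <;> simp [U]
  have hcov : ∀ u, ∃ b, u ∈ U b := by
    intro u
    by_cases h : u = 1
    · refine ⟨false, ?_⟩
      simp only [U, h, Bool.false_eq_true, if_false, Set.mem_compl_iff, Set.mem_singleton_iff]
      intro h'
      have := congrArg (fun u : Circle => (u : ℂ).re) h'
      norm_num at this
    · exact ⟨true, by simpa [U] using h⟩
  -- the two arcs meet in the union of the two open half circles
  have him : ∀ u : Circle, u ∈ U false → u ∈ U true → (u : ℂ).im ≠ 0 := by
    intro u h1 h2 h3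
    have hn : (u : ℂ).re * (u : ℂ).re + (u : ℂ).im * (u : ℂ).im = 1 := by
      have := Circle.normSq_coe u
      rwa [Complex.normSq_apply] at this
    rw [h3, mul_zero, add_zero, mul_self_eq_one_iff] at hn
    rcases hn with hn | hn
    · apply h2
      ext
      apply Complex.ext <;> simp [hn, h3]
    · apply h1
      ext
      apply Complex.ext <;> simp [hn, h3]
  have key : ∀ {x y : Circle} (p : Path x y) (_ : ∀ t, p t ∈ U false) (_ : ∀ t, p t ∈ U true),
      φ x = φ y := by
    intro x y p h1 h2
    have := neg_iff_neg_of_ne_zero (f := fun t => (p t : ℂ).im)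
      (Complex.continuous_im.comp (continuous_subtype_val.comp p.continuous))
      (fun t => him _ (h1 t) (h2 t))
    simp only [p.source, p.target] at this
    simp only [φ, this]
  have hF : Compatible F := by
    intro i j x y p hi hj
    cases i <;> cases j
    · rfl
    · simp [on, F, ofPrimitive, key p hi hj]
    · simp [on, F, ofPrimitive, key p hj hi]
    · rfl
  obtain ⟨E, hE⟩ := hF.exists_glue hU hcov
  refine ⟨E, ?_⟩
  have hπ := Real.pi_pos
  -- the loop is cut at the quarter points, where it passes from one arc to the other
  let q1 : I := ⟨1 / 4, by norm_num, by norm_num⟩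
  let q3 : I := ⟨3 / 4, by norm_num, by norm_num⟩
  have r1 : ((-1 : Circle) : ℂ).re = -1 := by simp
  have hre : ∀ t : I, (circleLoop t : ℂ).re = Real.cos (2 * Real.pi * t) := by
    intro t
    change ((Circle.exp (2 * Real.pi * t) : Circle) : ℂ).re = _
    rw [Circle.coe_exp, Complex.exp_ofReal_mul_I_re]
  have hc1 : ∀ t ∈ Set.Icc 0 q1, circleLoop t ∈ U false := by
    intro t ht h
    have h1 : (t : ℝ) ≤ 1 / 4 := ht.2
    have := hre t
    rw [h, r1] at this
    have := Real.cos_nonneg_of_neg_pi_div_two_le_of_le (x := 2 * Real.pi * t)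
      (by nlinarith [t.2.1]) (by nlinarith)
    linarith
  have hc2 : ∀ t ∈ Set.Icc q1 q3, circleLoop t ∈ U true := by
    intro t ht h
    have h1 : 1 / 4 ≤ (t : ℝ) := ht.1
    have h2 : (t : ℝ) ≤ 3 / 4 := ht.2
    have := hre t
    rw [h] at this
    have := Real.cos_nonpos_of_pi_div_two_le_of_le (x := 2 * Real.pi * t)
      (by nlinarith) (by nlinarith)
    simp at *
    linarith
  have hc3 : ∀ t ∈ Set.Icc q3 1, circleLoop t ∈ U false := by
    intro t ht h
    have h1 : 3 / 4 ≤ (t : ℝ) := ht.1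
    have := hre t
    rw [h, r1, ← Real.cos_sub_two_pi] at this
    have := Real.cos_nonneg_of_neg_pi_div_two_le_of_le (x := 2 * Real.pi * t - 2 * Real.pi)
      (by nlinarith) (by nlinarith [t.2.2])
    linarith
  have o1 : q1 ≤ q3 := Subtype.mk_le_mk.2 (by norm_num)
  rw [← E.subpath_zero_one, ← E.subpath_mul _ 0 q1 1, ← E.subpath_mul _ q1 q3 1,
    hE false _ (subpath_mem (show 0 ≤ q1 from bot_le) hc1), hE true _ (subpath_mem o1 hc2),
    hE false _ (subpath_mem (show q3 ≤ 1 from le_top) hc3)]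
  have e1 : φ (circleLoop q1) = 1 := by
    have : (circleLoop q1 : ℂ).im = 1 := by
      change ((Circle.exp (2 * Real.pi * (1 / 4)) : Circle) : ℂ).im = _
      rw [Circle.coe_exp, Complex.exp_ofReal_mul_I_im,
        show 2 * Real.pi * (1 / 4) = Real.pi / 2 by ring, Real.sin_pi_div_two]
    simp [φ, this]
  have e2 : φ (circleLoop q3) = e := by
    have : (circleLoop q3 : ℂ).im = -1 := by
      change ((Circle.exp (2 * Real.pi * (3 / 4)) : Circle) : ℂ).im = _
      rw [Circle.coe_exp, Complex.exp_ofReal_mul_I_im,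
        show 2 * Real.pi * (3 / 4) = Real.pi / 2 + Real.pi by ring, Real.sin_add_pi,
        Real.sin_pi_div_two]
    simp [φ, this]
  simp [on, F, ofPrimitive, e1, e2]

end Transport

end

section

/-! ### Slit charts of the punctured sphere -/

open unitInterval OnePoint

namespace OnePoint

/-- The finite coordinate of a point of the Riemann sphere, with value `0` at infinity. -/
noncomputable def toComplex (z : OnePoint ℂ) : ℂ := z.elim 0 id

@[simp] theorem toComplex_coe (z : ℂ) : toComplex (z : OnePoint ℂ) = z := rfl

@[simp] theorem toComplex_infty : toComplex ∞ = 0 := rfl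

theorem coe_toComplex {z : OnePoint ℂ} (h : z ≠ ∞) : ((toComplex z : ℂ) : OnePoint ℂ) = z := by
  induction z using OnePoint.rec with
  | infty => exact absurd rfl h
  | coe z => rfl

theorem continuousAt_toComplex {z : OnePoint ℂ} (h : z ≠ ∞) : ContinuousAt toComplex z := by
  induction z using OnePoint.rec with
  | infty => exact absurd rfl h
  | coe z => exact continuousAt_coe.2 continuousAt_id

theorem tendsto_coe_add_inv (c : ℂ) :
    Filter.Tendsto (fun w : ℂ => ((c + w⁻¹ : ℂ) : OnePoint ℂ)) (nhdsWithin 0 {0}ᶜ) (nhds ∞) := by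
  refine tendsto_coe_infty.comp ?_
  rw [Filter.coclosedCompact_eq_cocompact, ← Metric.cobounded_eq_cocompact]
  exact (tendsto_const_add_cobounded c).comp Filter.tendsto_inv₀_nhdsNE_zero

open Classical in
/-- The inverse `w ↦ c + 1 / w` of the chart at infinity `z ↦ 1 / (z - c)`. -/
noncomputable def inftyChart (c w : ℂ) : OnePoint ℂ :=
  if w = 0 then ∞ else ((c + w⁻¹ : ℂ) : OnePoint ℂ)

theorem continuous_inftyChart (c : ℂ) : Continuous (inftyChart c) := by
  rw [continuous_iff_continuousAt]
  intro w
  by_cases hw : w = 0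
  · subst hw
    rw [continuousAt_iff_punctured_nhds]
    have h0 : inftyChart c 0 = ∞ := by simp [inftyChart]
    rw [h0]
    refine (tendsto_coe_add_inv c).congr' ?_
    filter_upwards [self_mem_nhdsWithin] with w hw
    simp only [Set.mem_compl_iff, Set.mem_singleton_iff] at hw
    simp [inftyChart, hw]
  · have : ContinuousAt (fun w : ℂ => ((c + w⁻¹ : ℂ) : OnePoint ℂ)) w :=
      continuous_coe.continuousAt.comp (continuousAt_const.add (continuousAt_inv₀ hw))
    refine this.congr ?_
    filter_upwards [isOpen_ne.mem_nhds hw] with v hv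
    have hv' : v ≠ 0 := hv
    simp [inftyChart, hv']

/-- The coordinate `z ↦ 1 / (z - c)` around infinity. -/
noncomputable def inftyCoord (c : ℂ) (z : OnePoint ℂ) : ℂ := z.elim 0 fun z => (z - c)⁻¹

theorem continuousAt_inftyCoord {c : ℂ} {z : OnePoint ℂ} (h : z ≠ (c : OnePoint ℂ)) :
    ContinuousAt (inftyCoord c) z := by
  induction z using OnePoint.rec with
  | infty =>
    rw [continuousAt_infty', Filter.coclosedCompact_eq_cocompact, ← Metric.cobounded_eq_cocompact]
    exact Filter.tendsto_inv₀_cobounded.comp (tendsto_sub_const_cobounded c)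
  | coe z =>
    have : z - c ≠ 0 := sub_ne_zero.2 fun h' => h (by rw [h'])
    exact continuousAt_coe.2 ((continuousAt_id.sub continuousAt_const).inv₀ this)

theorem inftyChart_inftyCoord {c : ℂ} {z : OnePoint ℂ} (h : z ≠ (c : OnePoint ℂ)) :
    inftyChart c (inftyCoord c z) = z := by
  induction z using OnePoint.rec with
  | infty => simp [inftyChart, inftyCoord]
  | coe z =>
    have : z - c ≠ 0 := sub_ne_zero.2 fun h' => h (by rw [h'])
    simp [inftyChart, inftyCoord, this]

end OnePoint

/-- The Riemann sphere with the points `0, 1, …, r - 1` removed. -/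
def PuncturedSphere (r : ℕ) : Type :=
  {z : OnePoint ℂ // ∀ j : Fin r, z ≠ (((j : ℕ) : ℂ) : OnePoint ℂ)}

noncomputable instance (r : ℕ) : TopologicalSpace (PuncturedSphere r) := instTopologicalSpaceSubtype

namespace PuncturedSphere

variable {r : ℕ}

/-- The complement in the Riemann sphere of all but one of the `r` arcs into which the points
`0, …, r - 1` divide the real circle: the arc through infinity remains for `k = 0`, and the arc from
`k - 1` to `k` for the other `k`. -/
def slit (r : ℕ) (k : Fin r) : Set (OnePoint ℂ) :=
  {z | (toComplex z).im ≠ 0 ∨ if (k : ℕ) = 0 then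
    z = ∞ ∨ (toComplex z).re < 0 ∨ (r : ℝ) - 1 < (toComplex z).re
    else z ≠ ∞ ∧ ((k : ℕ) : ℝ) - 1 < (toComplex z).re ∧ (toComplex z).re < (k : ℕ)}

theorem ne_infty_of_im {z : OnePoint ℂ} (h : (toComplex z).im ≠ 0) : z ≠ ∞ := by
  rintro rfl
  simp at h

theorem isOpen_slit (k : Fin r) : IsOpen (slit r k) := by
  by_cases hk : (k : ℕ) = 0
  · have : slit r k = (((↑) : ℂ → OnePoint ℂ) '' (Complex.ofReal '' Set.Icc 0 ((r : ℝ) - 1)))ᶜ := by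
      ext z
      simp only [slit, hk, if_true, Set.mem_ofPred_eq, Set.mem_compl_iff, Set.mem_image,
        not_exists, not_and]
      induction z using OnePoint.rec with
      | infty => simp
      | coe z =>
        simp only [toComplex_coe, coe_ne_infty, false_or, OnePoint.coe_eq_coe]
        constructor
        · rintro h _ ⟨x, hx, rfl⟩ rfl
          simp only [Complex.ofReal_im, ne_eq, not_true_eq_false, Complex.ofReal_re, false_or] at h
          rcases h with h | h
          · linarith [hx.1]
          · linarith [hx.2]
        · intro h
          by_contra h'
          push Not at h'
          exact h z ⟨z.re, ⟨h'.2.1, h'.2.2⟩, by apply Complex.ext <;> simp [h'.1]⟩ rfl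
    rw [this, isOpen_compl_image_coe]
    have hc : IsCompact (Complex.ofReal '' Set.Icc 0 ((r : ℝ) - 1)) :=
      isCompact_Icc.image Complex.continuous_ofReal
    exact ⟨hc.isClosed, hc⟩
  · have : slit r k = ((↑) : ℂ → OnePoint ℂ) '' {z | z.im ≠ 0 ∨
        (((k : ℕ) : ℝ) - 1 < z.re ∧ z.re < (k : ℕ))} := by
      ext z
      simp only [slit, hk, if_false, Set.mem_ofPred_eq, Set.mem_image]
      induction z using OnePoint.rec with
      | infty => simp
      | coe z => simp
    rw [this, isOpen_image_coe]
    exact (isOpen_ne_fun Complex.continuous_im continuous_const).union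
      ((isOpen_lt continuous_const Complex.continuous_re).inter
        (isOpen_lt Complex.continuous_re continuous_const))

theorem exists_mem_slit (hr : 2 ≤ r) (z : PuncturedSphere r) : ∃ k, z.1 ∈ slit r k := by
  obtain ⟨z, hz⟩ := z
  induction z using OnePoint.rec with
  | infty => exact ⟨⟨0, by omega⟩, by simp [slit]⟩
  | coe z =>
    by_cases him : z.im = 0
    swap
    · exact ⟨⟨0, by omega⟩, Or.inl him⟩
    by_cases h1 : z.re < 0
    · exact ⟨⟨0, by omega⟩, by simp [slit, h1]⟩
    by_cases h2 : (r : ℝ) - 1 < z.re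
    · exact ⟨⟨0, by omega⟩, by simp [slit, h2]⟩
    push Not at h1 h2
    have hne : ∀ j : ℕ, j < r → z.re ≠ j := by
      intro j hj h
      apply hz ⟨j, hj⟩
      rw [OnePoint.coe_eq_coe]
      apply Complex.ext <;> simp [h, him]
    have hc0 : ⌈z.re⌉₊ ≠ 0 := by
      intro h
      rw [Nat.ceil_eq_zero] at h
      exact hne 0 (by omega) (by push_cast; exact le_antisymm h h1)
    have hc1 : ⌈z.re⌉₊ < r := by
      have : ⌈z.re⌉₊ ≤ r - 1 := by
        rw [Nat.ceil_le, Nat.cast_sub (by omega)]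
        exact_mod_cast h2
      omega
    refine ⟨⟨⌈z.re⌉₊, hc1⟩, Or.inr ?_⟩
    simp only [hc0, if_false]
    refine ⟨coe_ne_infty _, ?_, ?_⟩
    · have := Nat.ceil_lt_add_one h1
      simp only [toComplex_coe]
      linarith
    · exact lt_of_le_of_ne (Nat.le_ceil _) (hne _ hc1)

variable {G : Type*} [Group G]

/-- A transport has a primitive on each set `U` with a coordinate `κ` in a star-shaped set, since
its pull-back to this simply connected set has one. -/
theorem exists_primitive_of_chart {Y : Type*} [TopologicalSpace Y] (F : Transport Y G) {S : Set ℂ}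
    {a : ℂ} (hS : StarConvex ℝ a S) (ha : a ∈ S) (c : S → Y) (hc : Continuous c) (κ : Y → ℂ)
    (U : Set Y) (hκ : ContinuousOn κ U) (hU : ∀ x ∈ U, ∃ h : κ x ∈ S, c ⟨κ x, h⟩ = x) :
    ∃ g : Y → G, ∀ {x y : Y} (p : Path x y), (∀ t, p t ∈ U) → F.toFun p = g y * (g x)⁻¹ := by
  have : ContractibleSpace S := hS.contractibleSpace ⟨a, ha⟩
  obtain ⟨g, hg⟩ := (F.comap ⟨c, hc⟩).exists_primitive
  classical
  refine ⟨fun y => if h : κ y ∈ S then g ⟨κ y, h⟩ else 1, fun {x y} p hp => ?_⟩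
  have hx : x ∈ U := by simpa using hp 0
  have hy : y ∈ U := by simpa using hp 1
  obtain ⟨hx', -⟩ := hU x hx
  obtain ⟨hy', -⟩ := hU y hy
  have := hg (x := ⟨κ x, hx'⟩) (y := ⟨κ y, hy'⟩)
    { toFun := fun t => ⟨κ (p t), (hU _ (hp t)).1⟩
      continuous_toFun := (hκ.comp_continuous p.continuous hp).subtype_mk _
      source' := by simp
      target' := by simp }
  simp only [hx', hy', dif_pos]
  rw [← this, Transport.comap_toFun]
  exact F.congr _ _ (fun t => ((hU _ (hp t)).2).symm)

theorem starConvex_slit (a b : ℝ) {m : ℝ} (hm : m ∈ Set.Ioo a b) :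
    StarConvex ℝ (m : ℂ) {z : ℂ | z.im ≠ 0 ∨ z.re ∈ Set.Ioo a b} := by
  intro z hz s t hs ht hst
  simp only [Set.mem_ofPred_eq, Complex.add_im, Complex.add_re, Complex.real_smul,
    Complex.re_ofReal_mul, Complex.im_ofReal_mul, Complex.ofReal_im, mul_zero, zero_add,
    Complex.ofReal_re]
  rcases eq_or_lt_of_le ht with rfl | ht'
  · right
    have : s = 1 := by linarith
    simpa [this] using hm
  rcases hz with hz | hz
  · exact Or.inl (mul_ne_zero ht'.ne' hz)
  · exact Or.inr (convex_Ioo a b hm hz hs ht hst)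

/-- On each slit sphere a parallel transport has a primitive. -/
theorem exists_primitive_slit (hr : 2 ≤ r) (F : Transport (PuncturedSphere r) G) (k : Fin r) :
    ∃ g : PuncturedSphere r → G, ∀ {x y : PuncturedSphere r} (p : Path x y),
      (∀ t, (p t).1 ∈ slit r k) → F.toFun p = g y * (g x)⁻¹ := by
  by_cases hk : (k : ℕ) = 0
  · -- the coordinate at infinity is centred at a point of the slit
    have hr' : (2 : ℝ) ≤ r := by exact_mod_cast hr
    have hc : 0 < ((r : ℝ) - 1) / 2 := by linarith
    set c : ℝ := ((r : ℝ) - 1) / 2 with hc_def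
    have hmem : ∀ w : ℂ, (w.im ≠ 0 ∨ w.re ∈ Set.Ioo (-c⁻¹) c⁻¹) →
        ∀ j : Fin r, inftyChart c w ≠ (((j : ℕ) : ℂ) : OnePoint ℂ) := by
      intro w hw j hj
      by_cases h0 : w = 0
      · simp [inftyChart, h0] at hj
      rw [inftyChart, if_neg h0, OnePoint.coe_eq_coe] at hj
      have hw' : w = (((j : ℕ) - c : ℝ) : ℂ)⁻¹ := by
        push_cast
        rw [← hj]
        simp
      rw [← Complex.ofReal_inv] at hw'
      have hj1 : ((j : ℕ) : ℝ) ≤ r - 1 := by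
        have : ((j : ℕ) : ℝ) + 1 ≤ r := by exact_mod_cast j.2
        linarith
      have hj0 : (0 : ℝ) ≤ (j : ℕ) := Nat.cast_nonneg _
      rw [hw', Complex.ofReal_im, Complex.ofReal_re] at hw
      rcases hw with hw | hw
      · exact hw rfl
      have hd : |((j : ℕ) - c : ℝ)| ≤ c := abs_le.2 ⟨by linarith, by linarith⟩
      have hne : ((j : ℕ) - c : ℝ) ≠ 0 := by
        intro h
        apply h0
        rw [hw', h]
        simp
      have h2 := abs_lt.2 hw
      rw [abs_inv] at h2
      exact absurd ((inv_lt_inv₀ (abs_pos.2 hne) hc).1 h2) (not_lt.2 hd)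
    refine exists_primitive_of_chart F
      (starConvex_slit (-c⁻¹) c⁻¹ (m := 0) ⟨by simpa using hc, by simpa using hc⟩)
      (by simpa using hc)
      (fun w => ⟨inftyChart c w.1, hmem w.1 w.2⟩)
      (((continuous_inftyChart c).comp continuous_subtype_val).subtype_mk _)
      (fun z => inftyCoord c z.1) {z | z.1 ∈ slit r k} ?_ ?_
    · intro z hz
      refine ContinuousAt.continuousWithinAt ?_
      refine ContinuousAt.comp (f := Subtype.val) (continuousAt_inftyCoord ?_)
        continuous_subtype_val.continuousAt
      intro h
      simp only [slit, hk, if_true, Set.mem_ofPred_eq, h] at hz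
      simp only [toComplex_coe, Complex.ofReal_im, ne_eq, not_true_eq_false, coe_ne_infty,
        Complex.ofReal_re, false_or] at hz
      rcases hz with h | h <;> linarith
    · rintro ⟨z, hz'⟩ hz
      replace hz : z ∈ slit r k := hz
      have hne : z ≠ ((c : ℂ) : OnePoint ℂ) := by
        intro h
        simp only [slit, hk, if_true, Set.mem_ofPred_eq, h] at hz
        simp only [toComplex_coe, Complex.ofReal_im, ne_eq, not_true_eq_false, coe_ne_infty,
          Complex.ofReal_re, false_or] at hz
        rcases hz with h | h <;> linarith
      refine ⟨?_, Subtype.ext (inftyChart_inftyCoord hne)⟩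
      simp only [Set.mem_ofPred_eq]
      induction z using OnePoint.rec with
      | infty => right; simpa [inftyCoord] using hc
      | coe z =>
        by_cases him : z.im = 0
        swap
        · left
          have : (z - c).im ≠ 0 := by simpa using him
          simp only [inftyCoord, elim_some, Complex.inv_im]
          refine div_ne_zero (by simpa using him) ?_
          rw [Complex.normSq_eq_zero.ne]
          intro h
          rw [h] at this
          simp at this
        · right
          have hz'' : z = (z.re : ℂ) := by apply Complex.ext <;> simp [him]
          simp only [slit, hk, if_true, Set.mem_ofPred_eq, toComplex_coe, him, ne_eq,
            not_true_eq_false, coe_ne_infty, false_or] at hz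
          rw [inftyCoord, elim_some, hz'', ← Complex.ofReal_sub, ← Complex.ofReal_inv,
            Complex.ofReal_re]
          have : |(z.re - c)⁻¹| < c⁻¹ := by
            rw [abs_inv]
            apply inv_strictAnti₀ hc
            rw [lt_abs]
            rcases hz with h | h
            · right; linarith
            · left; linarith
          exact abs_lt.1 this
  · have hmem : ∀ w : ℂ, (w.im ≠ 0 ∨ w.re ∈ Set.Ioo (((k : ℕ) : ℝ) - 1) (k : ℕ)) →
        ∀ j : Fin r, (w : OnePoint ℂ) ≠ (((j : ℕ) : ℂ) : OnePoint ℂ) := by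
      intro w hw j hj
      rw [OnePoint.coe_eq_coe] at hj
      rw [hj] at hw
      simp only [Complex.natCast_im, ne_eq, not_true_eq_false, Complex.natCast_re, Set.mem_Ioo,
        Nat.cast_lt, false_or] at hw
      have h1 : ((k : ℕ) : ℝ) < (j : ℕ) + 1 := by linarith
      have h2 : (k : ℕ) < (j : ℕ) + 1 := by exact_mod_cast h1
      omega
    refine exists_primitive_of_chart F
      (starConvex_slit (((k : ℕ) : ℝ) - 1) (k : ℕ) (m := (k : ℕ) - 1 / 2)
        ⟨by linarith, by linarith⟩)
      (Or.inr (by simp; norm_num))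
      (fun w => ⟨(w.1 : OnePoint ℂ), hmem w.1 w.2⟩)
      ((continuous_coe.comp continuous_subtype_val).subtype_mk _)
      (fun z => toComplex z.1) {z | z.1 ∈ slit r k} ?_ ?_
    · intro z hz
      refine ContinuousAt.continuousWithinAt ?_
      refine ContinuousAt.comp (f := Subtype.val) (continuousAt_toComplex ?_)
        continuous_subtype_val.continuousAt
      rcases hz with h | h
      · exact ne_infty_of_im h
      · simp only [hk, if_false] at h
        exact h.1
    · rintro ⟨z, hz'⟩ hz
      have hne : z ≠ ∞ := by
        rcases hz with h | h
        · exact ne_infty_of_im h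
        · simp only [hk, if_false] at h
          exact h.1
      refine ⟨?_, Subtype.ext (coe_toComplex hne)⟩
      rcases hz with h | h
      · exact Or.inl h
      · simp only [hk, if_false] at h
        exact Or.inr h.2

end PuncturedSphere

end

section

/-! ### Parallel transport on the punctured sphere -/

open unitInterval OnePoint

namespace PuncturedSphere

variable {r : ℕ} {G : Type*} [Group G]

theorem im_ne_zero_of_mem_slit {i j : Fin r} (hij : i ≠ j) {z : OnePoint ℂ} (hi : z ∈ slit r i)
    (hj : z ∈ slit r j) : (toComplex z).im ≠ 0 := by
  intro h0
  simp only [slit, h0, ne_eq, not_true_eq_false, false_or, Set.mem_ofPred_eq] at hi hj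
  have key : ∀ i : Fin r, (i : ℕ) ≠ 0 → (i : ℕ) - 1 < (toComplex z).re →
      (toComplex z).re < (i : ℕ) → 0 ≤ (toComplex z).re ∧ (toComplex z).re ≤ r - 1 := by
    intro i h0 h1 h2
    have h3 : (1 : ℝ) ≤ (i : ℕ) := by exact_mod_cast Nat.one_le_iff_ne_zero.2 h0
    have h4 : ((i : ℕ) : ℝ) + 1 ≤ r := by exact_mod_cast i.2
    constructor <;> linarith
  by_cases hi0 : (i : ℕ) = 0 <;> by_cases hj0 : (j : ℕ) = 0
  · exact hij (Fin.ext (by omega))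
  · simp only [hi0, hj0, if_true, if_false] at hi hj
    obtain ⟨k1, k2⟩ := key j hj0 hj.2.1 hj.2.2
    rcases hi with h | h | h
    · exact hj.1 h
    · linarith
    · linarith
  · simp only [hi0, hj0, if_true, if_false] at hi hj
    obtain ⟨k1, k2⟩ := key i hi0 hi.2.1 hi.2.2
    rcases hj with h | h | h
    · exact hi.1 h
    · linarith
    · linarith
  · simp only [hi0, hj0, if_false] at hi hj
    have h1 : ((i : ℕ) : ℝ) < (j : ℕ) + 1 := by linarith
    have h2 : ((j : ℕ) : ℝ) < (i : ℕ) + 1 := by linarith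
    have h1' : (i : ℕ) < (j : ℕ) + 1 := by exact_mod_cast h1
    have h2' : (j : ℕ) < (i : ℕ) + 1 := by exact_mod_cast h2
    exact hij (Fin.ext (by omega))

open Classical in
/-- The locally constant function on the `k`-th slit sphere with value `c k` on the lower half plane
and `1` elsewhere. -/
noncomputable def side (c : ℕ → G) (k : ℕ) (z : OnePoint ℂ) : G :=
  if (toComplex z).im < 0 then c k else 1

/-- The parallel transport `F` has, on each slit sphere, the primitive `g * side c k`: the number
`c k` is the change of the primitive when the `k`-th arc is crossed, after the gauge
transformation `g`. -/
def HasCrossing (F : Transport (PuncturedSphere r) G) (c : ℕ → G) (g : PuncturedSphere r → G) :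
    Prop :=
  ∀ (k : Fin r) {x y : PuncturedSphere r} (p : Path x y), (∀ t, (p t).1 ∈ slit r k) →
    F.toFun p = g y * side c k y.1 * (g x * side c k x.1)⁻¹

/-- The changes across the arcs can be prescribed: two different slit spheres meet in the union of
the two half planes, where the functions `side c k` are locally constant, so that the transports
with these primitives glue. -/
theorem exists_hasCrossing (hr : 2 ≤ r) (c : ℕ → G) :
    ∃ F : Transport (PuncturedSphere r) G, HasCrossing F c fun _ => 1 := by
  let U : Fin r → Set (PuncturedSphere r) := fun k => {z | z.1 ∈ slit r k}
  let F : ∀ k, Transport (U k) G := fun k => Transport.ofPrimitive fun z => side c k z.1.1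
  have hF : Transport.Compatible F := by
    intro i j x y p hi hj
    by_cases hij : i = j
    · subst hij; rfl
    have him := fun t => im_ne_zero_of_mem_slit hij (hi t) (hj t)
    have hcont : Continuous fun t => (toComplex (p t).1).im := by
      refine Complex.continuous_im.comp (continuous_iff_continuousAt.2 fun t => ?_)
      exact ContinuousAt.comp (f := fun t => (p t).1) (continuousAt_toComplex (ne_infty_of_im
        (him t))) (continuous_subtype_val.comp p.continuous).continuousAt
    have h := neg_iff_neg_of_ne_zero hcont him
    simp only [p.source, p.target] at h
    simp only [Transport.on, F, Transport.ofPrimitive, side, h]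
    split_ifs <;> simp
  obtain ⟨E, hE⟩ := hF.exists_glue
    (fun k => (isOpen_slit k).preimage continuous_subtype_val) (fun z => exists_mem_slit hr z)
  refine ⟨E, fun k x y p hp => ?_⟩
  rw [hE k p hp]
  simp [Transport.on, F, Transport.ofPrimitive]

theorem exists_path_halfPlane (s : ℝ) {x y : PuncturedSphere r} (hx : 0 < s * (toComplex x.1).im)
    (hy : 0 < s * (toComplex y.1).im) : ∃ p : Path x y, ∀ t, (toComplex (p t).1).im ≠ 0 := by
  have hx' := coe_toComplex (ne_infty_of_im (right_ne_zero_of_mul hx.ne'))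
  have hy' := coe_toComplex (ne_infty_of_im (right_ne_zero_of_mul hy.ne'))
  let f : I → ℂ := fun t => (1 - (t : ℝ) : ℝ) * toComplex x.1 + ((t : ℝ) : ℂ) * toComplex y.1
  have hf : ∀ t, (f t).im ≠ 0 := by
    intro t
    have e : s * (f t).im =
        (1 - (t : ℝ)) * (s * (toComplex x.1).im) + t * (s * (toComplex y.1).im) := by
      simp only [f, Complex.add_im, Complex.im_ofReal_mul]
      ring
    have : 0 < s * (f t).im := by
      rw [e]
      rcases eq_or_lt_of_le t.2.1 with h | h
      · rw [← h]; simpa using hx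
      · have h1 := mul_pos h hy
        have h2 := mul_nonneg (sub_nonneg.2 t.2.2) hx.le
        linarith
    exact right_ne_zero_of_mul this.ne'
  refine ⟨{ toFun := fun t => ⟨((f t : ℂ) : OnePoint ℂ), fun j h => ?_⟩
            continuous_toFun := (continuous_coe.comp (by fun_prop)).subtype_mk _
            source' := Subtype.ext (by simp [f, hx'])
            target' := Subtype.ext (by simp [f, hy']) }, hf⟩
  rw [OnePoint.coe_eq_coe] at h
  exact hf t (by simp [h])

/-- The point at infinity. -/
def base (r : ℕ) : PuncturedSphere r := ⟨∞, fun _ => infty_ne_coe _⟩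

/-- Every parallel transport on the punctured sphere is determined, up to gauge, by its changes
across the arcs. -/
theorem exists_crossing (hr : 2 ≤ r) (F : Transport (PuncturedSphere r) G) :
    ∃ c g, c 0 = 1 ∧ c r = 1 ∧ g (base r) = 1 ∧ HasCrossing F c g := by
  choose g₀ hg₀ using exists_primitive_slit hr F
  let o : Fin r := ⟨0, by omega⟩
  let up : PuncturedSphere r := ⟨((Complex.I : ℂ) : OnePoint ℂ), fun j h => by
    rw [OnePoint.coe_eq_coe] at h
    simpa using congrArg Complex.im h⟩
  let lo : PuncturedSphere r := ⟨((-Complex.I : ℂ) : OnePoint ℂ), fun j h => by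
    rw [OnePoint.coe_eq_coe] at h
    simpa using congrArg Complex.im h⟩
  -- normalize the primitives to agree on the upper half plane and to be `1` at infinity
  let h : Fin r → PuncturedSphere r → G := fun k z =>
    g₀ k z * (g₀ k up)⁻¹ * g₀ o up * (g₀ o (base r))⁻¹
  have hh : ∀ k {x y : PuncturedSphere r} (p : Path x y), (∀ t, (p t).1 ∈ slit r k) →
      F.toFun p = h k y * (h k x)⁻¹ := by
    intro k x y p hp
    rw [hg₀ k p hp]
    simp only [h]
    group
  have hup : ∀ k (z : PuncturedSphere r), 0 < (toComplex z.1).im → h k z = h o z := by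
    intro k z hz
    obtain ⟨p, hp⟩ := exists_path_halfPlane 1 (x := up) (y := z) (by simp [up]) (by simpa using hz)
    have h1 := hg₀ k p (fun t => Or.inl (hp t))
    have h2 := hg₀ o p (fun t => Or.inl (hp t))
    simp only [h]
    rw [← h1, h2]
  let c : ℕ → G := fun k => if hk : k < r then (h o lo)⁻¹ * h ⟨k, hk⟩ lo else 1
  have hlo : ∀ k (z : PuncturedSphere r), (toComplex z.1).im < 0 → h k z = h o z * c k := by
    intro k z hz
    obtain ⟨p, hp⟩ := exists_path_halfPlane (-1) (x := lo) (y := z) (by simp [lo])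
      (by simpa using hz)
    have h1 := hh k p (fun t => Or.inl (hp t))
    have h2 := hh o p (fun t => Or.inl (hp t))
    simp only [c, k.2, dif_pos]
    rw [← mul_assoc, ← h2, h1]
    exact (inv_mul_cancel_right _ _).symm
  choose κ hκ using exists_mem_slit (r := r) hr
  classical
  let g : PuncturedSphere r → G := fun z =>
    if (toComplex z.1).im = 0 then h (κ z) z else h o z
  have key : ∀ k (z : PuncturedSphere r), z.1 ∈ slit r k → h k z = g z * side c k z.1 := by
    intro k z hz
    rcases lt_trichotomy (toComplex z.1).im 0 with hlt | heq | hgt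
    · simp only [side, g, hlt, hlt.ne, if_true, if_false]
      exact hlo k z hlt
    · have : k = κ z := by
        by_contra hne
        exact im_ne_zero_of_mem_slit hne hz (hκ z) heq
      simp [side, g, heq, ← this]
    · simp only [side, g, not_lt.2 hgt.le, hgt.ne', if_false, mul_one]
      exact hup k z hgt
  refine ⟨c, g, ?_, ?_, ?_, ?_⟩
  · have : (0 : ℕ) < r := by omega
    simp [c, this, o]
  · simp [c]
  · have h1 := key o (base r) (by simp [slit, base, o])
    have h2 : side c o (base r).1 = 1 := by simp [side, base]
    rw [h2, mul_one] at h1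
    rw [← h1]
    simp [h]
  · intro k x y p hp
    rw [hh k p hp, key k x (by simpa using hp 0), key k y (by simpa using hp 1)]

theorem HasCrossing.eq (hr : 2 ≤ r) {F F' : Transport (PuncturedSphere r) G} {c : ℕ → G}
    {g g' : PuncturedSphere r → G} (h : HasCrossing F c g) (h' : HasCrossing F' c g')
    (hg : g (base r) = 1) (hg' : g' (base r) = 1) (p : Path (base r) (base r)) :
    F.toFun p = F'.toFun p := by
  have key := Transport.eq_of_cover (U := fun k : Fin r => {z : PuncturedSphere r | z.1 ∈ slit r k})
    (fun k => (isOpen_slit k).preimage continuous_subtype_val) (fun z => exists_mem_slit hr z)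
    (F.gauge fun z => (g z)⁻¹) (F'.gauge fun z => (g' z)⁻¹) (fun k x y p hp => by
      simp only [Transport.gauge]
      rw [h k p hp, h' k p hp]
      group) p
  simpa [Transport.gauge, hg, hg'] using key

end PuncturedSphere

/-! ### The holed sphere as a retract of the punctured sphere -/

namespace HoledSphere

variable {r : ℕ}

/-- The inclusion of the holed sphere into the punctured sphere. -/
def toPunctured (r : ℕ) : C(HoledSphere r, PuncturedSphere r) where
  toFun z := ⟨z.1, fun j h => z.2 (Set.mem_iUnion.2 ⟨j, _, by simp, h.symm⟩)⟩
  continuous_toFun := continuous_subtype_val.subtype_mk _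

/-- The map of the punctured plane which pushes the points of the removed disks to their boundaries
along the radii. -/
noncomputable def pushOut (r : ℕ) (z : ℂ) : ℂ :=
  z + ∑ j : Fin r, ((max 0 (1 / (3 * ‖z - (j : ℕ)‖) - 1) : ℝ) : ℂ) * (z - (j : ℕ))

theorem max_eq_zero_of_le {d : ℝ} (h : 1 / 3 ≤ d) : max 0 (1 / (3 * d) - 1) = 0 := by
  apply max_eq_left
  rw [sub_nonpos, div_le_one (by linarith)]
  linarith

theorem pushOut_of_le {z : ℂ} (h : ∀ j : Fin r, 1 / 3 ≤ ‖z - (j : ℕ)‖) : pushOut r z = z := by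
  rw [pushOut, Finset.sum_eq_zero fun j _ => by rw [max_eq_zero_of_le (h j)]; simp, add_zero]

theorem one_le_norm_sub {j k : Fin r} (hjk : j ≠ k) : (1 : ℝ) ≤ ‖((j : ℕ) : ℂ) - ((k : ℕ) : ℂ)‖ := by
  have hz : ((j : ℕ) : ℤ) - ((k : ℕ) : ℤ) ≠ 0 := fun h => hjk (Fin.ext (by omega))
  have h2 : (((j : ℕ) : ℂ) - ((k : ℕ) : ℂ)) = ((((j : ℕ) : ℤ) - ((k : ℕ) : ℤ) : ℤ) : ℂ) := by
    push_cast; ring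
  rw [h2, Complex.norm_intCast]
  exact_mod_cast Int.one_le_abs hz

theorem pushOut_of_lt {z : ℂ} {j : Fin r} (h : ‖z - (j : ℕ)‖ < 1 / 3) (h0 : z ≠ (j : ℕ)) :
    ∃ u : Circle, pushOut r z = (j : ℕ) + u / 3 := by
  have hpos : 0 < ‖z - (j : ℕ)‖ := norm_pos_iff.2 (sub_ne_zero.2 h0)
  refine ⟨⟨(z - (j : ℕ)) / ‖z - (j : ℕ)‖, ?_⟩, ?_⟩
  · rw [Submonoid.unitSphere, ← SetLike.mem_coe]
    simp [hpos.ne']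
  rw [pushOut, Finset.sum_eq_single j]
  · rw [max_eq_right]
    · push_cast
      have : (‖z - (j : ℕ)‖ : ℂ) ≠ 0 := by exact_mod_cast hpos.ne'
      field_simp
      ring
    · rw [sub_nonneg, le_div_iff₀ (by linarith)]
      linarith
  · intro k _ hk
    have h1 := one_le_norm_sub hk
    have h2 := norm_sub_le_norm_sub_add_norm_sub ((j : ℕ) : ℂ) z ((k : ℕ) : ℂ)
    have h3 := norm_sub_rev ((j : ℕ) : ℂ) z
    have h4 := norm_sub_rev ((j : ℕ) : ℂ) (k : ℕ)
    rw [max_eq_zero_of_le (by linarith)]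
    simp
  · simp

theorem pushOut_mem {z : ℂ} (h : ∀ j : Fin r, z ≠ (j : ℕ)) : ((pushOut r z : ℂ) : OnePoint ℂ) ∈
    ((⋃ j : Fin r, ((↑) : ℂ → OnePoint ℂ) '' Metric.ball ((j : ℕ) : ℂ) (1 / 3))ᶜ :
      Set (OnePoint ℂ)) := by
  by_cases hz : ∀ j : Fin r, 1 / 3 ≤ ‖z - (j : ℕ)‖
  · rw [pushOut_of_le hz]
    simp only [Set.mem_compl_iff, Set.mem_iUnion, Set.mem_image, not_exists, not_and,
      OnePoint.coe_eq_coe]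
    rintro j w hw rfl
    rw [Metric.mem_ball, dist_eq_norm] at hw
    exact absurd hw (not_lt.2 (hz j))
  · push Not at hz
    obtain ⟨j, hj⟩ := hz
    obtain ⟨u, hu⟩ := pushOut_of_lt hj (h j)
    rw [hu]
    exact boundary_mem j u

theorem le_norm_sub {z : ℂ} (hz : (z : OnePoint ℂ) ∈
    ((⋃ j : Fin r, ((↑) : ℂ → OnePoint ℂ) '' Metric.ball ((j : ℕ) : ℂ) (1 / 3))ᶜ :
      Set (OnePoint ℂ))) (j : Fin r) : 1 / 3 ≤ ‖z - (j : ℕ)‖ := by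
  by_contra h
  push Not at h
  exact hz (Set.mem_iUnion.2 ⟨j, z, by rwa [Metric.mem_ball, dist_eq_norm], rfl⟩)

/-- The retraction of the punctured sphere to the holed sphere. -/
noncomputable def retract (r : ℕ) : C(PuncturedSphere r, HoledSphere r) where
  toFun z := ⟨z.1.elim ∞ fun z => ((pushOut r z : ℂ) : OnePoint ℂ), by
    obtain ⟨z, hz⟩ := z
    induction z using OnePoint.rec with
    | infty => exact (base r).2
    | coe z => exact pushOut_mem fun j h => hz j (by rw [h])⟩
  continuous_toFun := by
    refine Continuous.subtype_mk (continuous_iff_continuousAt.2 fun z => ?_) _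
    refine ContinuousAt.comp (f := Subtype.val)
      (g := fun z : OnePoint ℂ => z.elim ∞ fun z => ((pushOut r z : ℂ) : OnePoint ℂ)) ?_
      continuous_subtype_val.continuousAt
    obtain ⟨z, hz⟩ := z
    induction z using OnePoint.rec with
    | infty =>
      rw [continuousAt_infty']
      refine tendsto_coe_infty.congr' ?_
      rw [Filter.coclosedCompact_eq_cocompact, ← Metric.cobounded_eq_cocompact]
      filter_upwards [(tendsto_norm_cobounded_atTop (E := ℂ)).eventually_ge_atTop (r + 1 : ℝ)]
        with z hz
      have : pushOut r z = z := pushOut_of_le fun j => by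
        have h1 := norm_sub_norm_le z (j : ℕ)
        rw [Complex.norm_natCast] at h1
        have : ((j : ℕ) : ℝ) ≤ r := by exact_mod_cast j.2.le
        linarith
      simp [this]
    | coe z =>
      refine continuousAt_coe.2 (continuous_coe.continuousAt.comp
        (continuousAt_id.add (tendsto_finsetSum _ fun j _ => ?_)))
      have hne : ‖z - (j : ℕ)‖ ≠ 0 := norm_ne_zero_iff.2 (sub_ne_zero.2 fun h => hz j (by rw [h]))
      have h3 : 3 * ‖z - (j : ℕ)‖ ≠ 0 := mul_ne_zero (by norm_num) hne
      have h4 : ContinuousAt (fun z : ℂ => 3 * ‖z - (j : ℕ)‖) z := by fun_prop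
      have h5 : ContinuousAt (fun z : ℂ => max 0 (1 / (3 * ‖z - (j : ℕ)‖) - 1)) z :=
        continuousAt_const.max ((continuousAt_const.div h4 h3).sub continuousAt_const)
      have h6 : ContinuousAt (fun z : ℂ => z - (j : ℕ)) z := by fun_prop
      exact (Complex.continuous_ofReal.continuousAt.comp h5).mul h6

theorem retract_toPunctured (z : HoledSphere r) : retract r (toPunctured r z) = z := by
  obtain ⟨z, hz⟩ := z
  apply Subtype.ext
  induction z using OnePoint.rec with
  | infty => rfl
  | coe z =>
    exact congrArg (fun w : ℂ => (w : OnePoint ℂ)) (pushOut_of_le (le_norm_sub hz))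

theorem exists_path_base (z : PuncturedSphere r) :
    Nonempty (Path (PuncturedSphere.base r) z) := by
  obtain ⟨z, hz⟩ := z
  induction z using OnePoint.rec with
  | infty => exact ⟨Path.refl _⟩
  | coe z =>
    -- the vertical ray from `z` away from the real axis
    let s : ℂ := if 0 ≤ z.im then Complex.I else -Complex.I
    have hs : s ≠ 0 := by
      simp only [s]
      split_ifs <;> simp
    have key : ∀ t : I, (t : ℂ) ≠ 0 →
        inftyChart (z - s) (t * s⁻¹) = ((z + (((t : ℝ)⁻¹ - 1 : ℝ) : ℂ) * s : ℂ) : OnePoint ℂ) := by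
      intro t ht
      rw [inftyChart, if_neg (mul_ne_zero ht (inv_ne_zero hs))]
      congr 1
      push_cast
      field_simp
      ring
    refine ⟨{ toFun := fun t => ⟨inftyChart (z - s) (t * s⁻¹), fun j => ?_⟩
              continuous_toFun := ((continuous_inftyChart _).comp (by fun_prop)).subtype_mk _
              source' := Subtype.ext (by simp [inftyChart, PuncturedSphere.base])
              target' := Subtype.ext ((key 1 (by simp)).trans (by simp)) }⟩
    by_cases ht : (t : ℂ) = 0
    · simp [inftyChart, ht]
    rw [key t ht]
    intro h
    rw [OnePoint.coe_eq_coe] at h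
    have him := congrArg Complex.im h
    have ht' : 0 ≤ (t : ℝ)⁻¹ - 1 := by
      have : 0 < (t : ℝ) := lt_of_le_of_ne t.2.1 fun h => ht (by rw [← h]; simp)
      rw [sub_nonneg, one_le_inv₀ this]
      exact t.2.2
    have h0 : (t : ℝ)⁻¹ - 1 = 0 := by
      simp only [s, Complex.add_im, Complex.im_ofReal_mul, Complex.natCast_im] at him
      split_ifs at him with hz0
      · simp only [Complex.I_im, mul_one] at him
        linarith
      · simp only [Complex.neg_im, Complex.I_im, mul_neg, mul_one] at him
        push Not at hz0
        linarith
    rw [h0] at h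
    apply hz j
    rw [← h]
    simp

instance : PathConnectedSpace (HoledSphere r) := by
  have : PathConnectedSpace (PuncturedSphere r) :=
    ⟨⟨PuncturedSphere.base r⟩, fun x y => by
      obtain ⟨p⟩ := exists_path_base x
      obtain ⟨q⟩ := exists_path_base y
      exact ⟨p.symm.trans q⟩⟩
  refine ⟨⟨base r⟩, fun x y => ?_⟩
  obtain ⟨p⟩ := PathConnectedSpace.joined (toPunctured r x) (toPunctured r y)
  exact ⟨(p.map (retract r).continuous).cast (retract_toPunctured x).symm
    (retract_toPunctured y).symm⟩

end HoledSphere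

end

section

/-! ### Products in reverse order -/

section RevProd

variable {G : Type*} [Group G]

/-- The product `b (n - 1) * ⋯ * b 1 * b 0`. -/
def revProd : ∀ {n : ℕ}, (Fin n → G) → G
  | 0, _ => 1
  | n + 1, b => b (Fin.last n) * revProd fun i : Fin n => b i.castSucc

theorem revProd_zero (b : Fin 0 → G) : revProd b = 1 := rfl

theorem revProd_succ {n : ℕ} (b : Fin (n + 1) → G) :
    revProd b = b (Fin.last n) * revProd fun i : Fin n => b i.castSucc := rfl

theorem revProd_telescope {n : ℕ} (a : ℕ → G) :
    revProd (fun j : Fin n => a (j + 1) * (a j)⁻¹) = a n * (a 0)⁻¹ := by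
  induction n with
  | zero => simp [revProd_zero]
  | succ n ih =>
    rw [revProd_succ]
    simp only [Fin.val_last, Fin.val_castSucc, ih]
    group

theorem exists_telescope {n : ℕ} (b : Fin n → G) :
    ∃ a : ℕ → G, a 0 = 1 ∧ (∀ j : Fin n, b j = a (j + 1) * (a j)⁻¹) ∧ a n = revProd b := by
  let a : ℕ → G := fun k => Nat.rec 1 (fun k x => (if h : k < n then b ⟨k, h⟩ else 1) * x) k
  have ha : ∀ j : Fin n, b j = a (j + 1) * (a j)⁻¹ := fun j => by
    simp [a, j.2]
  refine ⟨a, rfl, ha, ?_⟩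
  have := revProd_telescope (n := n) a
  rw [show a 0 = 1 from rfl, inv_one, mul_one] at this
  rw [← this]
  congr 1
  ext j
  exact (ha j).symm

theorem map_revProd {H : Type*} [Group H] (f : G →* H) {n : ℕ} (b : Fin n → G) :
    f (revProd b) = revProd fun i => f (b i) := by
  induction n with
  | zero => simp [revProd_zero]
  | succ n ih => rw [revProd_succ, revProd_succ, map_mul, ih]

end RevProd

/-! ### Boundary holonomies of the holed sphere -/

open unitInterval OnePoint

namespace PuncturedSphere

variable {r : ℕ} {G : Type*} [Group G]

theorem HasCrossing.subpath {F : Transport (PuncturedSphere r) G} {c : ℕ → G}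
    {g : PuncturedSphere r → G} (h : HasCrossing F c g) (k : Fin r) {x y : PuncturedSphere r}
    (p : Path x y) {s t : I} (hst : s ≤ t) (hp : ∀ u ∈ Set.Icc s t, (p u).1 ∈ slit r k) :
    F.toFun (p.subpath s t) = g (p t) * side c k (p t).1 * (g (p s) * side c k (p s).1)⁻¹ :=
  h k _ (Transport.subpath_mem (V := {z : PuncturedSphere r | z.1 ∈ slit r k}) hst hp)

theorem side_of_nonneg (c : ℕ → G) (k : ℕ) {z : OnePoint ℂ} (h : 0 ≤ (toComplex z).im) :
    side c k z = 1 := if_neg (not_lt.2 h)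

theorem side_of_neg (c : ℕ → G) (k : ℕ) {z : OnePoint ℂ} (h : (toComplex z).im < 0) :
    side c k z = c k := if_pos h

/-- The index of the arc which starts at the puncture `j`. -/
def nextArc (j : Fin r) : Fin r := if h : (j : ℕ) + 1 < r then ⟨j + 1, h⟩ else ⟨0, j.pos⟩

theorem apply_nextArc {c : ℕ → G} (h0 : c 0 = 1) (hr : c r = 1) (j : Fin r) :
    c (nextArc j) = c (j + 1) := by
  unfold nextArc
  split_ifs with h
  · rfl
  · have : (j : ℕ) + 1 = r := by omega
    rw [this, hr, h0]

theorem mem_slit_nextArc (j : Fin r) {z : ℂ} (h : z.im ≠ 0 ∨ (((j : ℕ) : ℝ) < z.re ∧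
    z.re < (j : ℕ) + 1)) : (z : OnePoint ℂ) ∈ slit r (nextArc j) := by
  refine h.imp id fun h => ?_
  unfold nextArc
  split_ifs with h1 h2 h3
  · simp at h2
  · simpa using h
  · right; right
    have : ((j : ℕ) : ℝ) + 1 = r := by
      have : (j : ℕ) + 1 = r := by omega
      exact_mod_cast this
    rw [toComplex_coe]
    linarith
  · exact absurd rfl h3

theorem mem_slit_self (j : Fin r) {z : ℂ} (h : z.im ≠ 0 ∨ (((j : ℕ) : ℝ) - 1 < z.re ∧
    z.re < (j : ℕ))) : (z : OnePoint ℂ) ∈ slit r j := by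
  refine h.imp id fun h => ?_
  split_ifs with h1
  · right; left
    rw [h1, Nat.cast_zero] at h
    exact h.2
  · exact ⟨coe_ne_infty _, h⟩

end PuncturedSphere

namespace HoledSphere

open PuncturedSphere (HasCrossing slit side nextArc)

variable {r : ℕ} {G : Type*} [Group G]

theorem inftyChart_ray (z s : ℂ) (hs : s ≠ 0) {t : ℝ} (ht : t ≠ 0) :
    inftyChart (z - s) (t * s⁻¹) = ((z + ((t⁻¹ - 1 : ℝ) : ℂ) * s : ℂ) : OnePoint ℂ) := by
  have : (t : ℂ) ≠ 0 := by exact_mod_cast ht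
  rw [inftyChart, if_neg (mul_ne_zero this (inv_ne_zero hs))]
  congr 1
  push_cast
  field_simp
  ring

theorem boundaryTether_mem (j : Fin r) (t : I) :
    inftyChart ((j : ℕ) + 1 / 3 - Complex.I) ((t : ℝ) * Complex.I⁻¹) ∈
      ((⋃ j : Fin r, ((↑) : ℂ → OnePoint ℂ) '' Metric.ball ((j : ℕ) : ℂ) (1 / 3))ᶜ :
        Set (OnePoint ℂ)) := by
  by_cases ht : (t : ℝ) = 0
  · simp only [ht, Complex.ofReal_zero, zero_mul, inftyChart, if_true]
    exact (base r).2
  · rw [inftyChart_ray _ _ Complex.I_ne_zero ht]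
    simp only [Set.mem_compl_iff, Set.mem_iUnion, Set.mem_image, not_exists, not_and,
      OnePoint.coe_eq_coe]
    rintro k w hw rfl
    rw [Metric.mem_ball, dist_eq_norm] at hw
    have h1 := (Complex.abs_re_le_norm _).trans_lt hw
    have e : (((j : ℕ) : ℂ) + 1 / 3 + (((t : ℝ)⁻¹ - 1 : ℝ) : ℂ) * Complex.I - (k : ℕ)).re =
        (j : ℕ) + 1 / 3 - (k : ℕ) := by
      have : ((1 / 3 : ℂ)).re = 1 / 3 := by norm_num
      simp only [Complex.add_re, Complex.sub_re, Complex.re_ofReal_mul, Complex.I_re, mul_zero,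
        add_zero, Complex.natCast_re, this]
    rw [e, abs_lt] at h1
    have h2 : ((j : ℕ) : ℝ) < (k : ℕ) := by linarith
    have h3 : ((k : ℕ) : ℝ) < (j : ℕ) + 1 := by linarith
    have h2' : (j : ℕ) < (k : ℕ) := by exact_mod_cast h2
    have h3' : (k : ℕ) < (j : ℕ) + 1 := by exact_mod_cast h3
    omega

/-- The vertical ray from the point at infinity down to the point of the `j`-th boundary circle on
the real axis. -/
noncomputable def boundaryTether (j : Fin r) : Path (base r) (boundary j 1) where
  toFun t := ⟨inftyChart ((j : ℕ) + 1 / 3 - Complex.I) ((t : ℝ) * Complex.I⁻¹),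
    boundaryTether_mem j t⟩
  continuous_toFun := ((continuous_inftyChart _).comp (by fun_prop)).subtype_mk _
  source' := Subtype.ext (by simp [inftyChart]; rfl)
  target' := Subtype.ext ((inftyChart_ray _ _ Complex.I_ne_zero one_ne_zero).trans (by
    simp [boundary]))

/-- The loop at infinity around the `j`-th boundary circle. -/
noncomputable def basedLoop (j : Fin r) : Path (base r) (base r) :=
  (boundaryTether j).trans ((boundaryLoop j).trans (boundaryTether j).symm)

/-- The holonomy of a parallel transport around the `j`-th boundary circle. -/
noncomputable def hol (F : Transport (HoledSphere r) G) (j : Fin r) : G :=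
  F.toFun (basedLoop j)

theorem hol_eq (F : Transport (HoledSphere r) G) (j : Fin r) :
    hol F j = (F.toFun (boundaryTether j))⁻¹ * F.toFun (boundaryLoop j) *
      F.toFun (boundaryTether j) := by
  rw [hol, basedLoop, F.map_trans, F.map_trans, F.map_symm]

/-- The transport along a tether. The tether descends on a vertical ray in the upper half plane; its
first half lies in the `0`-th slit sphere, its second half in that of the arc to the right of the
puncture, and all functions `side c k` are `1` along it. -/
theorem crossing_boundaryTether {F : Transport (PuncturedSphere r) G} {c : ℕ → G}
    {g : PuncturedSphere r → G} (h : HasCrossing F c g) (hg : g (PuncturedSphere.base r) = 1)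
    (j : Fin r) : F.toFun ((boundaryTether j).map (toPunctured r).continuous) =
      g (toPunctured r (boundary j 1)) := by
  set p := (boundaryTether j).map (toPunctured r).continuous with hp
  have hval : ∀ t : I, (t : ℝ) ≠ 0 → (p t).1 =
      (((j : ℕ) + 1 / 3 + (((t : ℝ)⁻¹ - 1 : ℝ) : ℂ) * Complex.I : ℂ) : OnePoint ℂ) := fun t ht =>
    inftyChart_ray _ _ Complex.I_ne_zero ht
  have hre : ∀ x : ℝ, (((j : ℕ) : ℂ) + 1 / 3 + (x : ℂ) * Complex.I).re = (j : ℕ) + 1 / 3 := by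
    intro x
    have : ((1 / 3 : ℂ)).re = 1 / 3 := by norm_num
    simp only [Complex.add_re, Complex.re_ofReal_mul, Complex.I_re, mul_zero,
      add_zero, Complex.natCast_re, this]
  have him : ∀ x : ℝ, (((j : ℕ) : ℂ) + 1 / 3 + (x : ℂ) * Complex.I).im = x := by
    intro x
    have : ((1 / 3 : ℂ)).im = 0 := by norm_num
    simp only [Complex.add_im, Complex.im_ofReal_mul, Complex.I_im, mul_one,
      zero_add, Complex.natCast_im, this]
  let m : I := ⟨1 / 2, by norm_num, by norm_num⟩
  have e1 := h.subpath ⟨0, j.pos⟩ p (s := 0) (t := m) bot_le (fun u hu => by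
    by_cases h0 : (u : ℝ) = 0
    · have : u = 0 := Subtype.ext h0
      rw [this, p.source]
      right
      simp only [if_true]
      exact Or.inl rfl
    · left
      have hu2 : (u : ℝ) ≤ 1 / 2 := hu.2
      have hpos : 0 < (u : ℝ) := lt_of_le_of_ne u.2.1 (Ne.symm h0)
      rw [hval u h0, toComplex_coe, him]
      have : (2 : ℝ) ≤ (u : ℝ)⁻¹ := by
        rw [le_inv_comm₀ (by norm_num) hpos]
        linarith
      linarith)
  have e2 := h.subpath (nextArc j) p (s := m) (t := 1) le_top (fun u hu => by
    have hu2 : 1 / 2 ≤ (u : ℝ) := hu.1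
    rw [hval u (by linarith)]
    apply PuncturedSphere.mem_slit_nextArc
    right
    rw [hre]
    constructor <;> linarith)
  rw [← F.subpath_zero_one, ← F.subpath_mul _ 0 m 1, e1, e2]
  have s0 : side c 0 (p 0).1 = 1 := PuncturedSphere.side_of_nonneg _ _ (by rw [p.source]; rfl)
  have sm : ∀ k, side c k (p m).1 = 1 := fun k => PuncturedSphere.side_of_nonneg _ _ (by
    rw [hval m (by norm_num [m]), toComplex_coe, him]
    norm_num [m])
  have s1 : ∀ k, side c k (p 1).1 = 1 := fun k => PuncturedSphere.side_of_nonneg _ _ (by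
    rw [hval 1 (by norm_num), toComplex_coe, him]
    norm_num)
  rw [s0, sm, sm, s1, p.source, p.target]
  have : g (toPunctured r (base r)) = 1 := hg
  rw [this]
  group

/-- The transport around a puncture. The right half of the circle lies in the slit sphere of the arc
to the right of the puncture, the left half in that of the arc to its left. -/
theorem crossing_boundaryLoop {F : Transport (PuncturedSphere r) G} {c : ℕ → G}
    {g : PuncturedSphere r → G} (h : HasCrossing F c g) (h0 : c 0 = 1) (hr : c r = 1)
    (j : Fin r) : F.toFun ((boundaryLoop j).map (toPunctured r).continuous) =
      g (toPunctured r (boundary j 1)) * ((c (j + 1))⁻¹ * c j) *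
        (g (toPunctured r (boundary j 1)))⁻¹ := by
  set p := (boundaryLoop j).map (toPunctured r).continuous with hp
  have hval : ∀ t : I, (p t).1 =
      (((j : ℕ) + (Circle.exp (2 * Real.pi * t) : ℂ) / 3 : ℂ) : OnePoint ℂ) := fun t => rfl
  have hre : ∀ x : ℝ, (((j : ℕ) : ℂ) + (Circle.exp x : ℂ) / 3).re = (j : ℕ) + Real.cos x / 3 := by
    intro x
    have : ((Circle.exp x : ℂ) / 3).re = Real.cos x / 3 := by
      rw [Circle.coe_exp, ← Complex.exp_ofReal_mul_I_re x]
      exact Complex.div_ofNat_re _ 3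
    rw [Complex.add_re, this, Complex.natCast_re]
  have him : ∀ x : ℝ, (((j : ℕ) : ℂ) + (Circle.exp x : ℂ) / 3).im = Real.sin x / 3 := by
    intro x
    have : ((Circle.exp x : ℂ) / 3).im = Real.sin x / 3 := by
      rw [Circle.coe_exp, ← Complex.exp_ofReal_mul_I_im x]
      exact Complex.div_ofNat_im _ 3
    rw [Complex.add_im, this, Complex.natCast_im, zero_add]
  have hright : ∀ u : I, 0 ≤ Real.cos (2 * Real.pi * u) → (p u).1 ∈ slit r (nextArc j) := by
    intro u hu
    rw [hval]
    apply PuncturedSphere.mem_slit_nextArc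
    rw [him, hre]
    by_cases hs : Real.sin (2 * Real.pi * u) = 0
    · right
      have h2 := Real.sin_sq_add_cos_sq (2 * Real.pi * u)
      rw [hs] at h2
      constructor <;> nlinarith
    · left
      simpa using hs
  have hleft : ∀ u : I, Real.cos (2 * Real.pi * u) ≤ 0 → (p u).1 ∈ slit r j := by
    intro u hu
    rw [hval]
    apply PuncturedSphere.mem_slit_self
    rw [him, hre]
    by_cases hs : Real.sin (2 * Real.pi * u) = 0
    · right
      have h2 := Real.sin_sq_add_cos_sq (2 * Real.pi * u)
      rw [hs] at h2
      constructor <;> nlinarith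
    · left
      simpa using hs
  let q1 : I := ⟨1 / 4, by norm_num, by norm_num⟩
  let q3 : I := ⟨3 / 4, by norm_num, by norm_num⟩
  have hπ := Real.pi_pos
  have e1 := h.subpath (nextArc j) p (s := 0) (t := q1) bot_le (fun t ht => by
    have h1 : (t : ℝ) ≤ 1 / 4 := ht.2
    apply hright
    exact Real.cos_nonneg_of_neg_pi_div_two_le_of_le (by nlinarith [t.2.1]) (by nlinarith))
  have e2 := h.subpath j p (s := q1) (t := q3) (Subtype.mk_le_mk.2 (by norm_num)) (fun t ht => by
    have h1 : 1 / 4 ≤ (t : ℝ) := ht.1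
    have h2 : (t : ℝ) ≤ 3 / 4 := ht.2
    apply hleft
    exact Real.cos_nonpos_of_pi_div_two_le_of_le (by nlinarith) (by nlinarith))
  have e3 := h.subpath (nextArc j) p (s := q3) (t := 1) le_top (fun t ht => by
    have h1 : 3 / 4 ≤ (t : ℝ) := ht.1
    apply hright
    rw [← Real.cos_sub_two_pi]
    exact Real.cos_nonneg_of_neg_pi_div_two_le_of_le (by nlinarith) (by nlinarith [t.2.2]))
  rw [← F.subpath_zero_one, ← F.subpath_mul _ 0 q1 1, ← F.subpath_mul _ q1 q3 1, e1, e2, e3]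
  have s0 : ∀ k, side c k (p 0).1 = 1 := fun k => PuncturedSphere.side_of_nonneg _ _ (by
    rw [hval, toComplex_coe, him]
    simp)
  have s1 : ∀ k, side c k (p 1).1 = 1 := fun k => PuncturedSphere.side_of_nonneg _ _ (by
    rw [hval, toComplex_coe, him]
    simp)
  have sq1 : ∀ k, side c k (p q1).1 = 1 := fun k => PuncturedSphere.side_of_nonneg _ _ (by
    rw [hval, toComplex_coe, him, show 2 * Real.pi * (q1 : ℝ) = Real.pi / 2 by
      simp only [q1]; ring, Real.sin_pi_div_two]
    norm_num)
  have sq3 : ∀ k, side c k (p q3).1 = c k := fun k => PuncturedSphere.side_of_neg _ _ (by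
    rw [hval, toComplex_coe, him, show 2 * Real.pi * (q3 : ℝ) = Real.pi / 2 + Real.pi by
      simp only [q3]; ring, Real.sin_add_pi, Real.sin_pi_div_two]
    norm_num)
  rw [s0, s1, sq1, sq1, sq3, sq3, p.source, p.target, PuncturedSphere.apply_nextArc h0 hr]
  group

theorem hol_of_hasCrossing {F : Transport (HoledSphere r) G} {F' : Transport (PuncturedSphere r) G}
    {c : ℕ → G} {g : PuncturedSphere r → G} (h : HasCrossing F' c g)
    (hg : g (PuncturedSphere.base r) = 1) (h0 : c 0 = 1) (hr : c r = 1)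
    (hF : ∀ {x y : HoledSphere r} (p : Path x y),
      F.toFun p = F'.toFun (p.map (toPunctured r).continuous)) (j : Fin r) :
    hol F j = (c (j + 1))⁻¹ * c j := by
  rw [hol_eq, hF, hF, crossing_boundaryTether h hg, crossing_boundaryLoop h h0 hr]
  group

/-- A transport on the holed sphere extends to the punctured sphere along the retraction, and its
boundary holonomies are the quotients of the changes across neighbouring arcs. -/
theorem exists_crossing (hr : 2 ≤ r) (F : Transport (HoledSphere r) G) :
    ∃ (F' : Transport (PuncturedSphere r) G) (c : ℕ → G) (g : PuncturedSphere r → G),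
      c 0 = 1 ∧ c r = 1 ∧ g (PuncturedSphere.base r) = 1 ∧ HasCrossing F' c g ∧
      (∀ {x y : HoledSphere r} (p : Path x y),
        F.toFun p = F'.toFun (p.map (toPunctured r).continuous)) ∧
      ∀ j : Fin r, hol F j = (c (j + 1))⁻¹ * c j := by
  obtain ⟨c, g, h0, h1, hg, h⟩ := PuncturedSphere.exists_crossing hr (F.comap (retract r))
  have hF : ∀ {x y : HoledSphere r} (p : Path x y),
      F.toFun p = (F.comap (retract r)).toFun (p.map (toPunctured r).continuous) := fun p =>
    F.congr _ _ fun t => (retract_toPunctured _).symm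
  exact ⟨_, c, g, h0, h1, hg, h, hF, hol_of_hasCrossing h hg h0 h1 hF⟩

/-- The fundamental group of the holed sphere has the presentation with the boundary loops as
generators and one relation; the three parts of this statement are `revProd_hol`,
`exists_transport` and `eq_of_hol_eq`. -/
theorem revProd_hol (hr : 2 ≤ r) (F : Transport (HoledSphere r) G) : revProd (hol F) = 1 := by
  obtain ⟨F', c, g, h0, h1, -, -, -, h⟩ := exists_crossing hr F
  have := revProd_telescope (n := r) fun k => (c k)⁻¹
  simp only [inv_inv, h0, h1, inv_one, mul_one] at this
  rw [← this]
  congr 1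
  ext j
  exact h j

theorem exists_transport (hr : 2 ≤ r) (b : Fin r → G) (hb : revProd b = 1) :
    ∃ F : Transport (HoledSphere r) G, ∀ j, hol F j = b j := by
  obtain ⟨a, h0, ha, h1⟩ := exists_telescope b
  obtain ⟨F, hF⟩ := PuncturedSphere.exists_hasCrossing hr fun k => (a k)⁻¹
  refine ⟨F.comap (toPunctured r), fun j => ?_⟩
  rw [hol_of_hasCrossing hF rfl (by simp [h0]) (by simp [h1, hb]) (fun p => rfl), ha, inv_inv]

theorem eq_of_hol_eq (hr : 2 ≤ r) {F F' : Transport (HoledSphere r) G}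
    (h : ∀ j, hol F j = hol F' j) (p : Path (base r) (base r)) : F.toFun p = F'.toFun p := by
  obtain ⟨E, c, g, h0, -, hg, hE, hF, hc⟩ := exists_crossing hr F
  obtain ⟨E', c', g', h0', -, hg', hE', hF', hc'⟩ := exists_crossing hr F'
  have hcc : ∀ k, k < r → c k = c' k := by
    intro k
    induction k with
    | zero => intro _; rw [h0, h0']
    | succ k ih =>
      intro hk
      have := h ⟨k, by omega⟩
      rw [hc, hc'] at this
      simp only [ih (by omega)] at this
      exact inv_injective (mul_right_cancel this)
  rw [hF, hF']
  refine HasCrossing.eq hr hE (fun k x y p hp => ?_) hg hg' _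
  rw [hE' k p hp]
  simp only [side, hcc k k.2]

end HoledSphere

end

section

/-! ### Parallel transport on products -/

open unitInterval

theorem Circle.pathConnectedSpace : PathConnectedSpace Circle :=
  Function.Surjective.pathConnectedSpace (f := Circle.exp)
    (fun u => ⟨Complex.arg u, Circle.exp_arg u⟩) Circle.exp.continuous

namespace Transport

variable {A B : Type*} [TopologicalSpace A] [TopologicalSpace B] {G : Type*} [Group G]

theorem prod_eq (F : Transport (A × B) G) {a a' : A} {b b' : B} (p : Path a a') (q : Path b b') :
    F.toFun (p.prod q) = F.toFun ((Path.refl a').prod q) * F.toFun (p.prod (Path.refl b)) := by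
  rw [← F.map_trans, Path.trans_prod_eq_prod_trans]
  refine F.map_homotopic ?_
  exact ⟨Path.Homotopic.prodHomotopy (Path.Homotopy.transRefl p).symm
    (Path.Homotopy.reflTrans q).symm⟩

theorem prod_comm (F : Transport (A × B) G) {a a' : A} {b b' : B} (p : Path a a')
    (q : Path b b') :
    F.toFun ((Path.refl a').prod q) * F.toFun (p.prod (Path.refl b)) =
      F.toFun (p.prod (Path.refl b')) * F.toFun ((Path.refl a).prod q) :=
  F.rect ⟨fun z => (p z.2, q z.1), by fun_prop⟩ _ _ _ _ (fun t => by simp) (fun t => by simp)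
    (fun t => by simp) (fun t => by simp)

/-- A path in a product is the product of its components. -/
theorem eq_prod (F : Transport (A × B) G) {x y : A × B} (p : Path x y) :
    F.toFun p = F.toFun ((p.map continuous_fst).prod (p.map continuous_snd)) :=
  F.congr _ _ fun t => by simp

/-- A parallel transport on `A × B` without holonomy along `A` comes, up to gauge, from `B`. -/
theorem exists_prod_gauge [PathConnectedSpace A] (F : Transport (A × B) G) (a₀ : A)
    (h : ∀ b : B, ∃ φ : A → G, ∀ {u u' : A} (p : Path u u'),
      F.toFun (p.prod (Path.refl b)) = φ u' * (φ u)⁻¹) :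
    ∃ φ : A × B → G, ∀ {x y : A × B} (p : Path x y),
      F.toFun p = φ y * F.toFun ((Path.refl a₀).prod (p.map continuous_snd)) * (φ x)⁻¹ := by
  choose φ hφ using h
  refine ⟨fun x => φ x.2 x.1 * (φ x.2 a₀)⁻¹, fun {x y} p => ?_⟩
  have h1 := F.prod_comm (PathConnectedSpace.somePath a₀ y.1) (p.map continuous_snd)
  rw [hφ, hφ] at h1
  rw [F.eq_prod, F.prod_eq, hφ, ← h1]
  group

theorem prod_refl_eq (F : Transport (A × B) G) {a a' : A} (p : Path a a') (b : B) :
    (F.comap ⟨fun u => (u, b), by fun_prop⟩).toFun p = F.toFun (p.prod (Path.refl b)) :=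
  F.congr _ _ fun t => by simp

/-- A transport on the torus without holonomy along the first circle comes, up to gauge, from the
second circle. -/
theorem exists_torus_gauge (F : Transport (Circle × Circle) G)
    (h : F.toFun (circleLoop.prod (Path.refl 1)) = 1) : ∃ φ : Circle × Circle → G,
      ∀ {x y : Circle × Circle} (p : Path x y),
        F.toFun p = φ y * F.toFun ((Path.refl 1).prod (p.map continuous_snd)) * (φ x)⁻¹ := by
  have := Circle.pathConnectedSpace
  refine F.exists_prod_gauge 1 fun v => ?_
  have hv : F.toFun (circleLoop.prod (Path.refl v)) = 1 := by
    have := F.prod_comm circleLoop (PathConnectedSpace.somePath 1 v)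
    rw [h, mul_one] at this
    exact mul_eq_right.1 this.symm
  obtain ⟨φ, hφ⟩ := exists_primitive_of_circleLoop
    (F.comap ⟨fun u => (u, v), by fun_prop⟩) ((F.prod_refl_eq _ _).trans hv)
  exact ⟨φ, fun p => (F.prod_refl_eq _ _).symm.trans (hφ p)⟩

theorem exists_simplyConnected_gauge [SimplyConnectedSpace A] (F : Transport (A × B) G) (a₀ : A) :
    ∃ φ : A × B → G, ∀ {x y : A × B} (p : Path x y),
      F.toFun p = φ y * F.toFun ((Path.refl a₀).prod (p.map continuous_snd)) * (φ x)⁻¹ := by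
  refine F.exists_prod_gauge a₀ fun v => ?_
  obtain ⟨φ, hφ⟩ := (F.comap ⟨fun u => (u, v), by fun_prop⟩).exists_primitive
  exact ⟨φ, fun p => (F.prod_refl_eq _ _).symm.trans (hφ p)⟩

/-- Parallel transports that agree on the loops at a point are gauge equivalent. -/
theorem exists_gauge_of_loops [PathConnectedSpace A] (F F' : Transport A G) (a : A)
    (h : ∀ p : Path a a, F.toFun p = F'.toFun p) :
    ∃ g : A → G, g a = 1 ∧ ∀ {x y : A} (p : Path x y),
      F.toFun p = g y * F'.toFun p * (g x)⁻¹ := by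
  refine ⟨fun x => F.toFun (tether a x) * (F'.toFun (tether a x))⁻¹, ?_, fun {x y} p => ?_⟩
  · simp only [tether_self, map_refl, one_mul, inv_one]
  · have := h (((tether a x).trans p).trans (tether a y).symm)
    simp only [map_trans, map_symm] at this
    rw [mul_inv_rev, inv_inv]
    have h2 : F.toFun p = F.toFun (tether a y) *
        ((F.toFun (tether a y))⁻¹ * (F.toFun p * F.toFun (tether a x))) *
        (F.toFun (tether a x))⁻¹ := by group
    rw [h2, this]
    group

end Transport

/-! ### Parallel transport on the Seifert manifold -/

namespace SeifertManifold

variable {r : ℕ} (p : Fin r → ℕ) (q : Fin r → ℤ) {G : Type*} [Group G]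

/-- The direction of a complex number, equal to `1` at zero. -/
noncomputable def direction (z : ℂ) : Circle := Circle.exp (Complex.arg z)

theorem norm_mul_direction (z : ℂ) : (‖z‖ : ℂ) * direction z = z := by
  rw [direction, Circle.coe_exp, Complex.norm_mul_exp_arg_mul_I]

theorem direction_circle (u : Circle) : direction u = u := Circle.exp_arg u

theorem continuousAt_direction {z : ℂ} (h : z ≠ 0) : ContinuousAt direction z := by
  refine (Topology.IsInducing.continuousAt_iff (g := ((↑) : Circle → ℂ)) ⟨rfl⟩).2 ?_
  have h1 : ContinuousAt (fun z : ℂ => z / (‖z‖ : ℂ)) z := by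
    refine ContinuousAt.div continuousAt_id ?_ (by simpa using h)
    fun_prop
  refine h1.congr ?_
  filter_upwards [isOpen_ne.mem_nhds h] with w hw
  have hw' : (‖w‖ : ℂ) ≠ 0 := by simpa using hw
  change w / (‖w‖ : ℂ) = (direction w : ℂ)
  rw [div_eq_iff hw', mul_comm]
  exact (norm_mul_direction w).symm

/-- The inclusion of `Σ_{0,r} × S¹`. -/
noncomputable def inlMap : C(HoledSphere r × Circle, SeifertManifold p q) where
  toFun x := Quot.mk _ (Sum.inl x)
  continuous_toFun := continuous_quot_mk.comp continuous_inl

/-- The map of the `j`-th solid torus. -/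
noncomputable def inrMap (j : Fin r) :
    C(Metric.closedBall (0 : ℂ) 1 × Circle, SeifertManifold p q) where
  toFun x := Quot.mk _ (Sum.inr (j, x))
  continuous_toFun := continuous_quot_mk.comp (continuous_inr.comp (by fun_prop))

/-- The gluing map of the `j`-th boundary torus. -/
noncomputable def glueMap (j : Fin r) : C(Circle × Circle, HoledSphere r × Circle) where
  toFun x := (HoledSphere.boundary j (x.1 ^ p j * x.2 ^ Int.gcdA (q j) (p j)),
    x.1 ^ (-q j) * x.2 ^ Int.gcdB (q j) (p j))
  continuous_toFun := by
    refine Continuous.prodMk ((HoledSphere.continuous_boundary j).comp ?_) ?_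
    · exact (continuous_fst.pow _).mul (continuous_snd.zpow _)
    · exact (continuous_fst.zpow _).mul (continuous_snd.zpow _)

theorem inrMap_diskBoundary (j : Fin r) (u v : Circle) :
    inrMap p q j (diskBoundary u, v) = inlMap p q (glueMap p q j (u, v)) :=
  Quot.sound (SeifertGlue.glue j u v)

theorem continuous_diskBoundary : Continuous diskBoundary :=
  continuous_subtype_val.subtype_mk _

/-- The distance from the cores of the solid tori; it is `1` on `Σ_{0,r} × S¹`. -/
noncomputable def radius : C(SeifertManifold p q, ℝ) where
  toFun := Quot.lift (Sum.elim (fun _ => 1) fun x => ‖(x.2.1 : ℂ)‖) (by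
    rintro _ _ ⟨j, u, v⟩
    simp [diskBoundary, Circle.norm_coe])
  continuous_toFun := continuous_quot_lift _ (by
    refine Continuous.sumElim continuous_const ?_
    fun_prop)

open Classical in
/-- The distance from the boundary of the `j`-th solid torus; it is `0` outside. -/
noncomputable def depth (j : Fin r) : C(SeifertManifold p q, ℝ) where
  toFun := Quot.lift (Sum.elim (fun _ => 0) fun x => if x.1 = j then 1 - ‖(x.2.1 : ℂ)‖ else 0) (by
    rintro _ _ ⟨j, u, v⟩
    simp [diskBoundary, Circle.norm_coe])
  continuous_toFun := continuous_quot_lift _ (by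
    refine Continuous.sumElim continuous_const (continuous_prod_of_discrete_left.2 fun i => ?_)
    by_cases h : i = j
    · simp only [h, if_true]
      fun_prop
    · simp only [h, if_false]
      fun_prop)

/-- The radial projection to `Σ_{0,r} × S¹`. It is discontinuous at the cores of the solid tori. -/
noncomputable def project : SeifertManifold p q → HoledSphere r × Circle :=
  Quot.lift (Sum.elim id fun x => glueMap p q x.1 (direction x.2.1, x.2.2)) (by
    rintro _ _ ⟨j, u, v⟩
    simp only [Sum.elim_inl, Sum.elim_inr, id, diskBoundary, direction_circle]
    rfl)

open Classical in
/-- The coordinates of the points in the interior of the `j`-th solid torus, with a junk value at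
the other points. -/
noncomputable def coord (j : Fin r) : SeifertManifold p q → Metric.closedBall (0 : ℂ) 1 × Circle :=
  Quot.lift (Sum.elim (fun _ => (diskBoundary 1, 1)) fun x =>
    if x.1 = j ∧ ‖(x.2.1 : ℂ)‖ < 1 then x.2 else (diskBoundary 1, 1)) (by
    rintro _ _ ⟨j, u, v⟩
    simp [diskBoundary, Circle.norm_coe])

theorem isQuotientMap_mk : Topology.IsQuotientMap
    (Quot.mk (SeifertGlue p q) : SeifertPieces r → SeifertManifold p q) := isQuotientMap_quot_mk

theorem isOpen_radius : IsOpen {x | 0 < radius p q x} :=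
  isOpen_lt continuous_const (radius p q).continuous

theorem isOpen_depth (j : Fin r) : IsOpen {x | 0 < depth p q j x} :=
  isOpen_lt continuous_const (depth p q j).continuous

theorem continuousOn_project : ContinuousOn (project p q) {x | 0 < radius p q x} := by
  refine ((isQuotientMap_mk p q).continuousOn_isOpen_iff (isOpen_radius p q)).2 ?_
  rintro (a | ⟨j, z, v⟩) hx
  · refine ContinuousAt.continuousWithinAt ?_
    rw [Topology.IsOpenEmbedding.inl.continuousAt_iff.symm]
    exact continuousAt_id
  · refine ContinuousAt.continuousWithinAt ?_
    rw [Topology.IsOpenEmbedding.inr.continuousAt_iff.symm]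
    have hz : (z : ℂ) ≠ 0 := norm_pos_iff.1 hx
    have h1 : Topology.IsOpenEmbedding
        (fun x : Metric.closedBall (0 : ℂ) 1 × Circle => (j, x)) := by
      exact Topology.IsOpenEmbedding.of_continuous_injective_isOpenMap (by fun_prop)
        (fun x y h => (Prod.ext_iff.1 h).2) fun s hs => by
          rw [← Set.singleton_prod]
          exact (isOpen_discrete _).prod hs
    rw [h1.continuousAt_iff.symm]
    change ContinuousAt (fun x : Metric.closedBall (0 : ℂ) 1 × Circle =>
      glueMap p q j (direction x.1, x.2)) (z, v)
    refine (glueMap p q j).continuous.continuousAt.comp (ContinuousAt.prodMk ?_ continuousAt_snd)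
    exact ContinuousAt.comp (f := fun x : Metric.closedBall (0 : ℂ) 1 × Circle => (x.1 : ℂ))
      (continuousAt_direction hz) (by fun_prop)

theorem exists_eq_of_depth {j : Fin r} {x : SeifertManifold p q} (hx : 0 < depth p q j x) :
    ∃ z : Metric.closedBall (0 : ℂ) 1, ∃ v, x = inrMap p q j (z, v) ∧ ‖(z : ℂ)‖ < 1 := by
  obtain ⟨x⟩ := x
  rcases x with a | ⟨i, z, v⟩
  · exact absurd hx (lt_irrefl _)
  · change 0 < (if i = j then 1 - ‖(z : ℂ)‖ else 0) at hx
    split_ifs at hx with h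
    · subst h
      exact ⟨z, v, rfl, by linarith⟩
    · exact absurd hx (lt_irrefl _)

theorem continuousOn_coord (j : Fin r) : ContinuousOn (coord p q j) {x | 0 < depth p q j x} := by
  refine ((isQuotientMap_mk p q).continuousOn_isOpen_iff (isOpen_depth p q j)).2 ?_
  have : Set.EqOn (coord p q j ∘ Quot.mk _) (Sum.elim (fun _ => (diskBoundary 1, 1)) fun x => x.2)
      (Quot.mk (SeifertGlue p q) ⁻¹' {x | 0 < depth p q j x}) := by
    rintro (a | ⟨i, z, v⟩) hx
    · exact absurd hx (lt_irrefl (0 : ℝ))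
    · change 0 < (if i = j then 1 - ‖(z : ℂ)‖ else 0) at hx
      split_ifs at hx with h
      · exact if_pos ⟨h, by linarith⟩
      · exact absurd hx (lt_irrefl _)
  refine ContinuousOn.congr (Continuous.continuousOn ?_) this
  exact continuous_const.sumElim continuous_snd

theorem coord_inrMap {j : Fin r} {z : Metric.closedBall (0 : ℂ) 1} (hz : ‖(z : ℂ)‖ < 1)
    (v : Circle) : coord p q j (inrMap p q j (z, v)) = (z, v) := if_pos ⟨rfl, hz⟩

theorem inrMap_coord {j : Fin r} {x : SeifertManifold p q} (hx : 0 < depth p q j x) :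
    inrMap p q j (coord p q j x) = x := by
  obtain ⟨z, v, rfl, hz⟩ := exists_eq_of_depth p q hx
  rw [coord_inrMap p q hz]

theorem exists_mem (x : SeifertManifold p q) :
    ∃ i : Option (Fin r), x ∈ (i.elim {x | 0 < radius p q x} fun j => {x | 0 < depth p q j x}) := by
  obtain ⟨x⟩ := x
  rcases x with a | ⟨j, z, v⟩
  · exact ⟨none, (one_pos : (0 : ℝ) < 1)⟩
  · by_cases h : (z : ℂ) = 0
    · refine ⟨some j, ?_⟩
      change 0 < (if j = j then 1 - ‖(z : ℂ)‖ else 0)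
      simp [h]
    · exact ⟨none, norm_pos_iff.2 h⟩

/-- A parallel transport on `Σ_{0,r} × S¹` without holonomy along the meridians of the solid tori
extends to the Seifert manifold. -/
theorem exists_extend (E : Transport (HoledSphere r × Circle) G)
    (hE : ∀ j, (E.comap (glueMap p q j)).toFun (circleLoop.prod (Path.refl 1)) = 1) :
    ∃ F : Transport (SeifertManifold p q) G,
      ∀ {x y} (γ : Path x y), (F.comap (inlMap p q)).toFun γ = E.toFun γ := by
  choose φ hφ using fun j => (E.comap (glueMap p q j)).exists_torus_gauge (hE j)
  let T : ∀ _ : Fin r, Transport (Metric.closedBall (0 : ℂ) 1 × Circle) G := fun j =>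
    ((E.comap (glueMap p q j)).comap ⟨fun x => (1, x.2), by fun_prop⟩).gauge
      fun x => φ j (direction x.1, x.2)
  let U : Option (Fin r) → Set (SeifertManifold p q) := fun i =>
    i.elim {x | 0 < radius p q x} fun j => {x | 0 < depth p q j x}
  let F : ∀ i, Transport (U i) G := fun i => match i with
    | none => E.comap ⟨fun x => project p q x.1, (continuousOn_project p q).domRestrict⟩
    | some j => (T j).comap ⟨fun x => coord p q j x.1, (continuousOn_coord p q j).domRestrict⟩
  have hU : ∀ i, IsOpen (U i) := by
    rintro (_ | j)
    · exact isOpen_radius p q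
    · exact isOpen_depth p q j
  have key : ∀ j {x y : SeifertManifold p q} (γ : Path x y) (h1 : ∀ t, γ t ∈ U none)
      (h2 : ∀ t, γ t ∈ U (some j)), (F none).on γ h1 = (F (some j)).on γ h2 := by
    intro j x y γ h1 h2
    let δ : Path (direction (coord p q j x).1, (coord p q j x).2)
        (direction (coord p q j y).1, (coord p q j y).2) :=
      { toFun := fun t => (direction (coord p q j (γ t)).1, (coord p q j (γ t)).2)
        continuous_toFun := by
          have hc := (continuousOn_coord p q j).comp_continuous γ.continuous h2
          refine Continuous.prodMk (continuous_iff_continuousAt.2 fun t => ?_) hc.snd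
          refine ContinuousAt.comp (f := fun t => ((coord p q j (γ t)).1 : ℂ))
            (continuousAt_direction ?_) ?_
          · obtain ⟨z, v, hz, hz'⟩ := exists_eq_of_depth p q (h2 t)
            have h3 := h1 t
            rw [hz] at h3 ⊢
            rw [coord_inrMap p q hz']
            exact norm_pos_iff.1 h3
          · exact (continuous_subtype_val.comp hc.fst).continuousAt
        source' := by simp
        target' := by simp }
    have hδ : (F none).on γ h1 = (E.comap (glueMap p q j)).toFun δ := by
      refine E.congr _ _ fun t => ?_
      change project p q (γ t) = glueMap p q j (direction (coord p q j (γ t)).1, _)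
      obtain ⟨z, v, hz, hz'⟩ := exists_eq_of_depth p q (h2 t)
      rw [hz]
      rw [coord_inrMap p q hz']
      rfl
    rw [hδ, hφ]
    simp only [F, T, Transport.on, Transport.comap, Transport.gauge]
    congr 2
  have hF : Transport.Compatible F := by
    rintro (_ | i) (_ | j) x y γ hi hj
    · rfl
    · exact key j γ hi hj
    · exact (key i γ hj hi).symm
    · by_cases hij : i = j
      · subst hij; rfl
      · obtain ⟨z, v, hz, hz'⟩ := exists_eq_of_depth p q (hi 0)
        have := hj 0
        rw [hz] at this
        change 0 < (if i = j then 1 - ‖(z : ℂ)‖ else 0) at this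
        rw [if_neg hij] at this
        exact absurd this (lt_irrefl _)
  obtain ⟨E', hE'⟩ := hF.exists_glue hU (exists_mem p q)
  refine ⟨E', fun γ => ?_⟩
  rw [Transport.comap_toFun, hE' none _ (fun t => (one_pos : (0 : ℝ) < 1))]
  exact E.congr _ _ fun t => rfl

end SeifertManifold

end

section

open unitInterval

/-! ### Extension from the circle bundle over the holed sphere -/

namespace SeifertManifold

variable {r : ℕ} (p : Fin r → ℕ) (q : Fin r → ℤ) {G : Type*} [Group G]

theorem segment_mem (z : Metric.closedBall (0 : ℂ) 1) (t : I) :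
    (1 - t : ℝ) * (direction z : ℂ) + (t : ℝ) * (z : ℂ) ∈ Metric.closedBall (0 : ℂ) 1 := by
  have h := (convex_closedBall (0 : ℂ) 1) (diskBoundary (direction z)).2 z.2
    (sub_nonneg.2 t.2.2) t.2.1 (sub_add_cancel 1 (t : ℝ))
  simpa [diskBoundary] using h

/-- The radial segment in the disk from the boundary to the point `z`. -/
noncomputable def segment (z : Metric.closedBall (0 : ℂ) 1) (t : I) : Metric.closedBall (0 : ℂ) 1 :=
  ⟨_, segment_mem z t⟩

theorem segment_diskBoundary (u : Circle) (t : I) : segment (diskBoundary u) t = diskBoundary u := by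
  refine Subtype.ext ?_
  change (1 - t : ℝ) * (direction u : ℂ) + (t : ℝ) * (u : ℂ) = u
  rw [direction_circle]
  push_cast
  ring

/-- The radial path from the projection of a point to the point. -/
noncomputable def slide : SeifertManifold p q → C(I, SeifertManifold p q) :=
  Quot.lift (Sum.elim (fun x => ContinuousMap.const I (inlMap p q x)) fun x =>
    ⟨fun t => inrMap p q x.1 (segment x.2.1 t, x.2.2), (inrMap p q x.1).continuous.comp
      (Continuous.prodMk (Continuous.subtype_mk (by fun_prop) _) continuous_const)⟩) (by
    rintro _ _ ⟨j, u, v⟩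
    ext t
    change inrMap p q j (segment (diskBoundary u) t, v) = inlMap p q (glueMap p q j (u, v))
    rw [segment_diskBoundary, inrMap_diskBoundary])

theorem slide_zero (x : SeifertManifold p q) : slide p q x 0 = inlMap p q (project p q x) := by
  obtain ⟨x⟩ := x
  rcases x with a | ⟨j, z, v⟩
  · rfl
  · change inrMap p q j (segment z 0, v) = inlMap p q (glueMap p q j (direction z, v))
    rw [← inrMap_diskBoundary]
    congr 2
    exact Subtype.ext (by simp [segment, diskBoundary])

theorem slide_one (x : SeifertManifold p q) : slide p q x 1 = x := by
  obtain ⟨x⟩ := x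
  rcases x with a | ⟨j, z, v⟩
  · rfl
  · change inrMap p q j (segment z 1, v) = inrMap p q j (z, v)
    congr 2
    exact Subtype.ext (by simp [segment])

theorem continuousOn_slide : ContinuousOn (slide p q) {x | 0 < radius p q x} := by
  refine ((isQuotientMap_mk p q).continuousOn_isOpen_iff (isOpen_radius p q)).2 ?_
  rintro (a | ⟨j, z, v⟩) hx
  · refine ContinuousAt.continuousWithinAt ?_
    rw [Topology.IsOpenEmbedding.inl.continuousAt_iff.symm]
    have : Continuous fun x => ContinuousMap.const I (inlMap p q x) :=
      ContinuousMap.continuous_const'.comp (inlMap p q).continuous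
    exact this.continuousAt
  · refine ContinuousAt.continuousWithinAt ?_
    rw [Topology.IsOpenEmbedding.inr.continuousAt_iff.symm]
    have hz : (z : ℂ) ≠ 0 := norm_pos_iff.1 hx
    have h1 : Topology.IsOpenEmbedding
        (fun x : Metric.closedBall (0 : ℂ) 1 × Circle => (j, x)) := by
      exact Topology.IsOpenEmbedding.of_continuous_injective_isOpenMap (by fun_prop)
        (fun x y h => (Prod.ext_iff.1 h).2) fun s hs => by
          rw [← Set.singleton_prod]
          exact (isOpen_discrete _).prod hs
    rw [h1.continuousAt_iff.symm]
    let W : Set (Metric.closedBall (0 : ℂ) 1 × Circle) := {x | (x.1 : ℂ) ≠ 0}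
    have hW : IsOpen W := isOpen_ne.preimage (by fun_prop)
    have h2 : Continuous fun x : W × I => inrMap p q j (segment x.1.1.1 x.2, x.1.1.2) := by
      refine (inrMap p q j).continuous.comp (Continuous.prodMk (Continuous.subtype_mk ?_ _)
        (by fun_prop))
      have h3 : Continuous fun x : W × I => direction x.1.1.1 := by
        refine continuous_iff_continuousAt.2 fun x => ?_
        exact ContinuousAt.comp (f := fun x : W × I => (x.1.1.1 : ℂ))
          (continuousAt_direction x.1.2) (by fun_prop)
      have h4 : Continuous fun x : W × I => (direction x.1.1.1 : ℂ) :=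
        continuous_induced_dom.comp h3
      fun_prop
    have h5 : ContinuousOn (fun x : Metric.closedBall (0 : ℂ) 1 × Circle =>
        slide p q (inrMap p q j x)) W :=
      continuousOn_iff_continuous_domRestrict.2 (ContinuousMap.curry ⟨_, h2⟩).continuous
    exact h5.continuousAt (hW.mem_nhds hz)

/-- The radial path as a path. -/
noncomputable def slidePath (x : SeifertManifold p q) : Path (inlMap p q (project p q x)) x where
  toContinuousMap := slide p q x
  source' := slide_zero p q x
  target' := slide_one p q x

theorem pathConnectedSpace : PathConnectedSpace (SeifertManifold p q) := by
  have := Circle.pathConnectedSpace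
  have h : ∀ x, Joined (base p q) x := fun x =>
    ⟨(((PathConnectedSpace.somePath (HoledSphere.base r, 1) (project p q x)).map
      (inlMap p q).continuous).trans (slidePath p q x) :)⟩
  exact ⟨⟨base p q⟩, fun x y => (h x).symm.trans (h y)⟩

/-- A gauge equivalence `k` over `Σ_{0,r} × S¹` extends to the Seifert manifold: at a point of a
solid torus it is carried along the radial path from the boundary. On the complement of the core
circles the radial paths depend continuously on the point; a solid torus retracts to its core, so
that there the transport along a path depends, up to gauge, only on its coordinate along the core.
-/
theorem eq_of_inlMap_eq (F F' : Transport (SeifertManifold p q) G) (k : HoledSphere r × Circle → G)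
    (h : ∀ {a b} (γ : Path a b), (F.comap (inlMap p q)).toFun γ =
      k b * (F'.comap (inlMap p q)).toFun γ * (k a)⁻¹)
    {x y : SeifertManifold p q} (γ : Path x y) :
    F.toFun γ = (F.toFun (slidePath p q y) * k (project p q y) * (F'.toFun (slidePath p q y))⁻¹) *
      F'.toFun γ *
      (F.toFun (slidePath p q x) * k (project p q x) * (F'.toFun (slidePath p q x))⁻¹)⁻¹ := by
  have := Circle.pathConnectedSpace
  have hU : ∀ i : Option (Fin r), IsOpen
      (i.elim {x | 0 < radius p q x} fun j => {x | 0 < depth p q j x}) := by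
    rintro (_ | j)
    · exact isOpen_radius p q
    · exact isOpen_depth p q j
  refine Transport.eq_of_cover hU (exists_mem p q) F (F'.gauge fun x =>
    F.toFun (slidePath p q x) * k (project p q x) * (F'.toFun (slidePath p q x))⁻¹) ?_ γ
  -- it suffices to express the transport along a path by the transport along some path in
  -- `Σ_{0,r} × S¹` between the projections of its end points.
  have key : ∀ {x y : SeifertManifold p q} (γ : Path x y) (δ : Path (project p q x) (project p q y)),
      (∀ E : Transport (SeifertManifold p q) G, E.toFun γ * E.toFun (slidePath p q x) =
        E.toFun (slidePath p q y) * (E.comap (inlMap p q)).toFun δ) →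
      F.toFun γ = (F'.gauge fun x =>
        F.toFun (slidePath p q x) * k (project p q x) * (F'.toFun (slidePath p q x))⁻¹).toFun γ := by
    intro x y γ δ hδ
    have h1 := hδ F
    rw [h, ← eq_mul_inv_iff_mul_eq] at h1
    have h2 := hδ F'
    rw [← eq_mul_inv_iff_mul_eq] at h2
    rw [h1]
    change _ = _ * F'.toFun γ * _
    rw [h2]
    group
  rintro (_ | j) x y γ hγ
  · have hc := (continuousOn_project p q).comp_continuous γ.continuous hγ
    refine key γ ⟨⟨fun t => project p q (γ t), hc⟩, by simp, by simp⟩ fun E => ?_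
    have hs := (continuousOn_slide p q).comp_continuous γ.continuous hγ
    have hK : Continuous fun z : I × I => slide p q (γ z.1) z.2 :=
      (hs.comp continuous_fst).eval continuous_snd
    refine E.rect ⟨fun z => slide p q (γ z.1) z.2, hK⟩ _ _ _ _ (fun t => ?_) (fun t => ?_)
      (fun t => ?_) (fun t => ?_)
    · change slide p q (γ 0) t = slide p q x t
      rw [γ.source]
    · change slide p q (γ 1) t = slide p q y t
      rw [γ.target]
    · exact slide_zero p q _
    · exact slide_one p q _
  · have hx := hγ 0
    have hy := hγ 1
    rw [γ.source] at hx
    rw [γ.target] at hy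
    obtain ⟨z, v, rfl, hz⟩ := exists_eq_of_depth p q hx
    obtain ⟨w, u, rfl, hw⟩ := exists_eq_of_depth p q hy
    have hc := (continuousOn_coord p q j).comp_continuous γ.continuous hγ
    let β : Path (z, v) (w, u) := ⟨⟨fun t => coord p q j (γ t), hc⟩, by
      change coord p q j (γ 0) = _
      rw [γ.source]
      exact coord_inrMap p q hz v, by
      change coord p q j (γ 1) = _
      rw [γ.target]
      exact coord_inrMap p q hw u⟩
    let d := PathConnectedSpace.somePath (direction z) (direction w)
    refine key γ ((d.prod (β.map continuous_snd)).map (glueMap p q j).continuous) fun E => ?_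
    have := (convex_closedBall (0 : ℂ) 1).contractibleSpace ⟨0, by simp⟩
    obtain ⟨φ, hφ⟩ := (E.comap (inrMap p q j)).exists_simplyConnected_gauge
      (A := Metric.closedBall (0 : ℂ) 1) (diskBoundary 1)
    have h1 : E.toFun γ = (E.comap (inrMap p q j)).toFun β :=
      E.congr _ _ fun t => (inrMap_coord p q (hγ t)).symm
    have h2 : ∀ z : Metric.closedBall (0 : ℂ) 1, ∀ v,
        E.toFun (slidePath p q (inrMap p q j (z, v))) =
        φ (z, v) * (φ (diskBoundary (direction z), v))⁻¹ := by
      intro z v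
      let τ : Path (diskBoundary (direction z), v) (z, v) :=
        ⟨⟨fun t => (segment z t, v), Continuous.prodMk
          (Continuous.subtype_mk (by fun_prop) _) continuous_const⟩,
          Prod.ext (Subtype.ext (by simp [segment, diskBoundary])) rfl,
          Prod.ext (Subtype.ext (by simp [segment])) rfl⟩
      have h3 : E.toFun (slidePath p q (inrMap p q j (z, v))) =
        (E.comap (inrMap p q j)).toFun τ := E.congr _ _ fun t => rfl
      rw [h3, hφ, Transport.map_const _ ((Path.refl (diskBoundary 1)).prod _) fun t => rfl,
        mul_one]
    have h4 : (E.comap (inlMap p q)).toFun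
        ((d.prod (β.map continuous_snd)).map (glueMap p q j).continuous) =
        (E.comap (inrMap p q j)).toFun ((d.map continuous_diskBoundary).prod
          (β.map continuous_snd)) :=
      E.congr _ _ fun t => (inrMap_diskBoundary p q j (d t) (β t).2).symm
    refine (congrArg₂ (· * ·) h1 (h2 z v)).trans
      (Eq.trans ?_ (congrArg₂ (· * ·) (h2 w u) h4).symm)
    simp only
    rw [hφ β, hφ ((d.map continuous_diskBoundary).prod _)]
    have h5 : (E.comap (inrMap p q j)).toFun ((Path.refl (diskBoundary 1)).prod
        (β.map continuous_snd)) = (E.comap (inrMap p q j)).toFun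
        ((Path.refl (diskBoundary 1)).prod (((d.map continuous_diskBoundary).prod
          (β.map continuous_snd)).map continuous_snd)) :=
      Transport.congr _ _ _ fun t => rfl
    rw [← h5]
    group

theorem inlMap_base : inlMap p q (HoledSphere.base r, 1) = base p q := rfl

/-- A representation of the fundamental group is determined by its restriction to
`Σ_{0,r} × S¹`. -/
theorem eq_of_comp_inlMap_eq {ρ ρ' : FundamentalGroup (SeifertManifold p q) (base p q) →* G}
    (h : ρ.comp (FundamentalGroup.mapOfEq (inlMap p q) (inlMap_base p q)) =
      ρ'.comp (FundamentalGroup.mapOfEq (inlMap p q) (inlMap_base p q))) :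
    ρ = ρ' := by
  have := Circle.pathConnectedSpace
  have := pathConnectedSpace p q
  have hr : ∀ γ : Path (HoledSphere.base r, (1 : Circle)) (HoledSphere.base r, 1),
      ((Transport.ofHom ρ).comap (inlMap p q)).toFun γ =
        ((Transport.ofHom ρ').comap (inlMap p q)).toFun γ := by
    intro γ
    rw [← Transport.toHom_fromPath, ← Transport.toHom_fromPath,
      ← Transport.toHom_mapOfEq _ _ (inlMap_base p q),
      ← Transport.toHom_mapOfEq _ _ (inlMap_base p q), Transport.toHom_ofHom, Transport.toHom_ofHom]
    exact DFunLike.congr_fun h _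
  obtain ⟨k, hk1, hk⟩ := Transport.exists_gauge_of_loops _ _ _ hr
  apply Transport.hom_ext
  intro γ
  rw [← Transport.ofHom_toFun, ← Transport.ofHom_toFun, eq_of_inlMap_eq p q _ _ k hk]
  have h1 : ∀ E : Transport (SeifertManifold p q) G, E.toFun (slidePath p q (base p q)) = 1 :=
    fun E => E.map_const _ fun t => rfl
  have h2 : k (project p q (base p q)) = 1 := hk1
  rw [h1, h1, h2]
  group

end SeifertManifold

end

section

/-! ### The fundamental group of the holed sphere -/

open unitInterval

theorem eq_of_revProd_eq {G : Type*} [Group G] {n : ℕ} {b b' : Fin n → G} {k : Fin n}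
    (h : ∀ j, j ≠ k → b j = b' j) (hb : revProd b = revProd b') : b = b' := by
  induction n with
  | zero => exact Subsingleton.elim _ _
  | succ n ih =>
    rw [revProd_succ, revProd_succ] at hb
    induction k using Fin.lastCases with
    | last =>
      have h1 : (fun j : Fin n => b j.castSucc) = fun j : Fin n => b' j.castSucc :=
        funext fun j => h _ (Fin.castSucc_lt_last j).ne
      rw [h1] at hb
      ext j
      exact Fin.lastCases (mul_right_cancel hb) (fun i => congrFun h1 i) j
    | cast k =>
      have h0 := h (Fin.last n) (Fin.castSucc_lt_last k).ne'
      rw [h0] at hb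
      have h1 := ih (fun j hj => h j.castSucc fun h2 => hj (Fin.castSucc_injective n h2))
        (mul_left_cancel hb)
      ext j
      exact Fin.lastCases h0 (fun i => congrFun h1 i) j

theorem revProd_zpow {G : Type*} [Group G] (e : G) {n : ℕ} (k : Fin n → ℤ) :
    revProd (fun j => e ^ k j) = e ^ ∑ j, k j := by
  induction n with
  | zero => simp [revProd_zero]
  | succ n ih => rw [revProd_succ, ih, Fin.sum_univ_castSucc, ← zpow_add, add_comm]

theorem commute_revProd {G : Type*} [Group G] {e : G} {n : ℕ} {b : Fin n → G}
    (h : ∀ j, Commute e (b j)) : Commute e (revProd b) := by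
  induction n with
  | zero => exact Commute.one_right e
  | succ n ih => exact (h _).mul_right (ih fun j => h _)

theorem revProd_mul_zpow {G : Type*} [Group G] {e : G} {n : ℕ} {b : Fin n → G} (k : Fin n → ℤ)
    (h : ∀ j, Commute e (b j)) :
    revProd (fun j => b j * e ^ k j) = revProd b * e ^ ∑ j, k j := by
  induction n with
  | zero => simp [revProd_zero]
  | succ n ih =>
    have := (commute_revProd fun j : Fin n => h j.castSucc).zpow_left (k (Fin.last n))
    rw [revProd_succ, ih _ fun j => h _, Fin.sum_univ_castSucc, revProd_succ, mul_assoc,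
      ← mul_assoc (e ^ k _), this.eq, mul_assoc, ← zpow_add, mul_assoc, add_comm]

namespace HoledSphere

variable {r : ℕ} {G : Type*} [Group G]

/-- The class of the `j`-th boundary circle in the fundamental group. -/
noncomputable def meridian (j : Fin r) : FundamentalGroup (HoledSphere r) (base r) :=
  FundamentalGroup.fromPath (Path.Homotopic.Quotient.mk (basedLoop j))

theorem hol_ofHom (ρ : FundamentalGroup (HoledSphere r) (base r) →* G) (j : Fin r) :
    hol (Transport.ofHom ρ) j = ρ (meridian j) := Transport.ofHom_toFun ρ _

theorem revProd_meridian (hr : 2 ≤ r) (ρ : FundamentalGroup (HoledSphere r) (base r) →* G) :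
    revProd (fun j => ρ (meridian j)) = 1 := by
  rw [← revProd_hol hr (Transport.ofHom ρ)]
  exact congrArg revProd (funext fun j => (hol_ofHom ρ j).symm)

theorem exists_hom (hr : 2 ≤ r) (b : Fin r → G) (hb : revProd b = 1) :
    ∃ ρ : FundamentalGroup (HoledSphere r) (base r) →* G, ∀ j, ρ (meridian j) = b j := by
  obtain ⟨F, hF⟩ := exists_transport hr b hb
  exact ⟨F.toHom _, hF⟩

theorem hom_ext (hr : 2 ≤ r) {ρ ρ' : FundamentalGroup (HoledSphere r) (base r) →* G}
    (h : ∀ j, ρ (meridian j) = ρ' (meridian j)) : ρ = ρ' := by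
  refine Transport.hom_ext fun γ => ?_
  rw [← Transport.ofHom_toFun, ← Transport.ofHom_toFun]
  exact eq_of_hol_eq hr (fun j => by rw [hol_ofHom, hol_ofHom, h]) γ

end HoledSphere

/-! ### Winding numbers -/

theorem Transport.toFun_eq_zpow {G : Type*} [Group G] (F : Transport Circle G) {u v : Circle}
    (p : Path u v) (n : ℤ) (h : ∀ t : I, p t = Circle.exp (2 * Real.pi * n * t)) :
    F.toFun p = F.toFun circleLoop ^ n := by
  obtain ⟨g, h0, hg, hper⟩ := F.exists_circle_primitive
  rw [hg p ⟨fun t => 2 * Real.pi * n * t, by fun_prop⟩ h]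
  have := hper 0 n
  rw [h0, one_mul, zero_add] at this
  simp [this, h0]

theorem exists_zpow_circleLoop (γ : Path (1 : Circle) 1) : ∃ n : ℤ, ∀ {G : Type*} [Group G]
    (F : Transport Circle G), F.toFun γ = F.toFun circleLoop ^ n := by
  have hl : γ.toContinuousMap 0 = Circle.exp 0 := by
    rw [Circle.exp_zero]; exact γ.source
  let b := Circle.isCoveringMap_exp.liftPath γ.toContinuousMap 0 hl
  have hb : ∀ t, γ t = Circle.exp (b t) := fun t =>
    (congrFun (Circle.isCoveringMap_exp.liftPath_lifts γ.toContinuousMap 0 hl) t).symm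
  have hb1 : Circle.exp (b 1) = Circle.exp 0 := by
    rw [← hb, γ.target, Circle.exp_zero]
  obtain ⟨n, hn⟩ := Circle.exp_eq_exp_iff.1 hb1
  refine ⟨n, fun {G} _ F => ?_⟩
  obtain ⟨g, h0, hg, hper⟩ := F.exists_circle_primitive
  rw [hg γ b hb, (Circle.isCoveringMap_exp.liftPath_zero _ _ hl : b 0 = 0), h0, hn, hper, h0]
  simp

/-- The pull-back along `s` of a transport on the circle has the holonomy of the circle, raised to
the winding number of `s`, around the boundary circle. -/
theorem HasWinding.hol_comap {r : ℕ} {G : Type*} [Group G] {s : C(HoledSphere r, Circle)}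
    (hs : s (HoledSphere.base r) = 1) {j : Fin r} {n : ℤ} (h : HasWinding s j n)
    (F : Transport Circle G) : HoledSphere.hol (F.comap s) j = F.toFun circleLoop ^ n := by
  obtain ⟨a, ha⟩ := h
  obtain ⟨g, h0, hg, hper⟩ := F.exists_circle_primitive
  have h1 : (F.comap s).toFun (HoledSphere.boundaryLoop j) =
      g (a 1) * F.toFun circleLoop ^ n * (g (a 1))⁻¹ := by
    rw [Transport.comap_toFun, hg _ ⟨fun t : I => a (Circle.exp (2 * Real.pi * t)) +
      2 * Real.pi * t * n, by fun_prop⟩ fun t => ?_]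
    · simp only [ContinuousMap.coe_mk, Set.Icc.coe_one, Set.Icc.coe_zero, mul_zero, mul_one,
        zero_mul, add_zero, Circle.exp_zero, Circle.exp_two_pi]
      rw [hper]
    · change s (HoledSphere.boundary j (Circle.exp (2 * Real.pi * t))) =
        Circle.exp (a (Circle.exp (2 * Real.pi * t)) + 2 * Real.pi * t * n)
      rw [ha, Circle.exp_add, mul_comm, mul_comm _ (n : ℝ), ← zsmul_eq_mul, Circle.exp_zsmul]
  have h2 : ∃ m : ℤ, (F.comap s).toFun (HoledSphere.boundaryTether j) =
      g (a 1) * F.toFun circleLoop ^ m := by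
    let P := (HoledSphere.boundaryTether j).map s.continuous
    have hl : P.toContinuousMap 0 = Circle.exp 0 := by
      rw [Circle.exp_zero]; exact P.source.trans hs
    let b := Circle.isCoveringMap_exp.liftPath P.toContinuousMap 0 hl
    have hb : ∀ t, P t = Circle.exp (b t) := fun t =>
      (congrFun (Circle.isCoveringMap_exp.liftPath_lifts P.toContinuousMap 0 hl) t).symm
    have hb1 : Circle.exp (b 1) = Circle.exp (a 1) := by
      rw [← hb, P.target, ha, one_zpow, one_mul]
    obtain ⟨m, hm⟩ := Circle.exp_eq_exp_iff.1 hb1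
    refine ⟨m, ?_⟩
    rw [Transport.comap_toFun, hg _ b hb, (Circle.isCoveringMap_exp.liftPath_zero _ _ hl : b 0 = 0),
      h0, inv_one, mul_one, hm, hper]
  obtain ⟨m, h2⟩ := h2
  rw [HoledSphere.hol_eq, h1, h2]
  group

/-- The winding numbers around all boundary circles sum to zero, so that the one around the first
boundary circle is determined by the others. -/
theorem hol_comap_of_sum_eq_zero {r : ℕ} (hr : 2 ≤ r) (s : C(HoledSphere r, Circle))
    (hs : s (HoledSphere.base r) = 1) (n : Fin r → ℤ) (hn : ∑ j, n j = 0)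
    (h : ∀ j : Fin r, (j : ℕ) ≠ 0 → HasWinding s j (n j)) {G : Type*} [Group G]
    (F : Transport Circle G) (j : Fin r) :
    HoledSphere.hol (F.comap s) j = F.toFun circleLoop ^ n j := by
  refine congrFun (eq_of_revProd_eq (b' := fun j => F.toFun circleLoop ^ n j) (k := ⟨0, j.pos⟩)
    (fun i hi => (h i fun h0 => hi (Fin.ext h0)).hol_comap hs F) ?_) j
  rw [HoledSphere.revProd_hol hr, revProd_zpow, hn, zpow_zero]

end

section

open unitInterval

/-! ### Representations of the fundamental group of the Seifert manifold -/

namespace SeifertManifold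

variable {r : ℕ} (p : Fin r → ℕ) (q : Fin r → ℤ) {G : Type*} [Group G]

/-- The class of the fibre through the base point. -/
noncomputable def fiber : FundamentalGroup (SeifertManifold p q) (base p q) :=
  FundamentalGroup.fromPath (Path.Homotopic.Quotient.mk
    (((Path.refl (HoledSphere.base r)).prod circleLoop).map (inlMap p q).continuous))

/-- Every representation of the fundamental group is the holonomy of a parallel transport. -/
theorem exists_prod_transport (ρ : FundamentalGroup (SeifertManifold p q) (base p q) →* G) :
    ∃ F : Transport (SeifertManifold p q) G, F.toHom (base p q) = ρ := by
  have := pathConnectedSpace p q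
  exact ⟨Transport.ofHom ρ, Transport.toHom_ofHom ρ⟩

variable {p q}

/-- The transport along the fibre through the base point. -/
noncomputable def fiberTransport (F : Transport (SeifertManifold p q) G) : Transport Circle G :=
  (F.comap (inlMap p q)).comap ⟨fun v => (HoledSphere.base r, v), by fun_prop⟩

/-- The transport along the horizontal section of `Σ_{0,r} × S¹` through the base point. -/
noncomputable def baseTransport (F : Transport (SeifertManifold p q) G) : Transport (HoledSphere r) G :=
  (F.comap (inlMap p q)).comap ⟨fun x => (x, 1), by fun_prop⟩

theorem toHom_fiber (F : Transport (SeifertManifold p q) G) :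
    F.toHom (base p q) (fiber p q) = (fiberTransport F).toFun circleLoop :=
  F.congr _ _ fun _ => rfl

theorem comap_inlMap_eq (F : Transport (SeifertManifold p q) G)
    (γ : Path (HoledSphere.base r, (1 : Circle)) (HoledSphere.base r, 1)) :
    (F.comap (inlMap p q)).toFun γ = (fiberTransport F).toFun (γ.map continuous_snd) *
      (baseTransport F).toFun (γ.map continuous_fst) := by
  rw [Transport.eq_prod, Transport.prod_eq]
  congr 1

theorem comm_baseTransport (F : Transport (SeifertManifold p q) G) {x : HoledSphere r}
    (τ : Path (HoledSphere.base r) x) :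
    (F.comap (inlMap p q)).toFun ((Path.refl x).prod circleLoop) * (baseTransport F).toFun τ =
      (baseTransport F).toFun τ * (fiberTransport F).toFun circleLoop := by
  have := (F.comap (inlMap p q)).prod_comm τ circleLoop
  have h1 : (baseTransport F).toFun τ = (F.comap (inlMap p q)).toFun (τ.prod (Path.refl 1)) :=
    Transport.congr _ _ _ fun _ => rfl
  have h2 : (fiberTransport F).toFun circleLoop = (F.comap (inlMap p q)).toFun
      ((Path.refl (HoledSphere.base r)).prod circleLoop) := Transport.congr _ _ _ fun _ => rfl
  rw [h1, h2, this]

/-- The fibre is central in the fundamental group. -/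
theorem commute_fiber (ρ : FundamentalGroup (SeifertManifold p q) (base p q) →* G)
    (γ : FundamentalGroup (SeifertManifold p q) (base p q)) :
    Commute (ρ (fiber p q)) (ρ γ) := by
  obtain ⟨F, rfl⟩ := exists_prod_transport p q ρ
  set e := F.toHom (base p q) (fiber p q) with he
  have h : (MulAut.conj e).toMonoidHom.comp (F.toHom (base p q)) = F.toHom (base p q) := by
    apply eq_of_comp_inlMap_eq
    rw [MonoidHom.comp_assoc, Transport.toHom_mapOfEq]
    apply Transport.hom_ext
    intro γ
    change e * (F.comap (inlMap p q)).toFun γ * e⁻¹ = (F.comap (inlMap p q)).toFun γ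
    have hb : e * (baseTransport F).toFun (γ.map continuous_fst) =
        (baseTransport F).toFun (γ.map continuous_fst) * e := by
      rw [he, toHom_fiber]
      exact (congrArg (· * _) (Transport.congr _ _ _ fun _ => rfl)).trans
        (comm_baseTransport F (γ.map continuous_fst))
    have hf : Commute e ((fiberTransport F).toFun (γ.map continuous_snd)) := by
      obtain ⟨n, hn⟩ := exists_zpow_circleLoop (γ.map continuous_snd)
      rw [hn, he, toHom_fiber]
      exact (Commute.refl _).zpow_right n
    rw [comap_inlMap_eq, mul_inv_eq_iff_eq_mul]
    exact hf.mul_right hb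
  have := DFunLike.congr_fun h γ
  exact mul_inv_eq_iff_eq_mul.1 this

/-- Transport along the image in `Σ_{0,r} × S¹` of the meridian of a solid torus. -/
theorem comap_glueMap_circleLoop {E : Transport (HoledSphere r × Circle) G} {j : Fin r}
    {F₁ : Transport (HoledSphere r) G} {F₂ : Transport Circle G}
    (h₁ : ∀ {x y : HoledSphere r} (γ : Path x y),
      E.toFun (γ.prod (Path.refl (1 : Circle))) = F₁.toFun γ)
    (h₂ : ∀ {u v : Circle} (γ : Path u v),
      E.toFun ((Path.refl (HoledSphere.base r)).prod γ) = F₂.toFun γ) :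
    (E.comap (glueMap p q j)).toFun (circleLoop.prod (Path.refl 1)) =
      F₁.toFun (HoledSphere.boundaryTether j) *
      (F₂.toFun circleLoop ^ (- q j) * HoledSphere.hol F₁ j ^ p j) *
      (F₁.toFun (HoledSphere.boundaryTether j))⁻¹ := by
  let α : Path (HoledSphere.boundary j 1) (HoledSphere.boundary j 1) :=
    ⟨⟨fun t => HoledSphere.boundary j (Circle.exp (2 * Real.pi * t) ^ p j),
      (HoledSphere.continuous_boundary j).comp (by fun_prop)⟩, by simp, by simp⟩
  let β : Path (1 : Circle) 1 := ⟨⟨fun t => Circle.exp (2 * Real.pi * t) ^ (- q j),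
      (Circle.exp.continuous.comp (by fun_prop)).zpow _⟩, by simp, by simp⟩
  have hE : (E.comap (glueMap p q j)).toFun (circleLoop.prod (Path.refl 1)) =
      E.toFun (α.prod β) := by
    refine E.congr _ _ fun t => ?_
    change (HoledSphere.boundary j (Circle.exp (2 * Real.pi * t) ^ p j * 1 ^ Int.gcdA _ _),
      Circle.exp (2 * Real.pi * t) ^ (- q j) * 1 ^ Int.gcdB _ _) =
      (HoledSphere.boundary j (Circle.exp (2 * Real.pi * t) ^ p j),
        Circle.exp (2 * Real.pi * t) ^ (- q j))
    rw [one_zpow, one_zpow, mul_one, mul_one]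
  have hα : F₁.toFun α = F₁.toFun (HoledSphere.boundaryLoop j) ^ p j := by
    let γ : Path (1 : Circle) 1 := ⟨⟨fun t => Circle.exp (2 * Real.pi * t) ^ p j,
      (Circle.exp.continuous.comp (by fun_prop)).pow _⟩, by simp, by simp⟩
    have h := (F₁.comap ⟨HoledSphere.boundary j, HoledSphere.continuous_boundary j⟩).toFun_eq_zpow
      γ (p j) fun t => ?_
    · rw [zpow_natCast] at h
      exact h
    · change Circle.exp (2 * Real.pi * t) ^ p j = _
      rw [← Circle.exp_nsmul, nsmul_eq_mul]
      congr 1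
      push_cast
      ring
  have hβ : F₂.toFun β = F₂.toFun circleLoop ^ (- q j) := by
    refine F₂.toFun_eq_zpow β _ fun t => ?_
    change Circle.exp (2 * Real.pi * t) ^ (- q j) = _
    rw [← Circle.exp_zsmul, zsmul_eq_mul]
    congr 1
    ring
  have hc := E.prod_comm (HoledSphere.boundaryTether j) β
  rw [h₁, h₂, hβ] at hc
  rw [hE, E.prod_eq, h₁, hα, eq_mul_inv_of_mul_eq hc, HoledSphere.hol_eq]
  have : ∀ a b : G, (a⁻¹ * b * a) ^ p j = a⁻¹ * b ^ p j * a := fun a b => by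
    have := conj_pow (i := p j) (a := a⁻¹) (b := b)
    rwa [inv_inv] at this
  rw [this]
  group

/-- Each meridian disk gives a relation between the boundary circle and the fibre. -/
theorem hol_pow (F : Transport (SeifertManifold p q) G) (j : Fin r) :
    HoledSphere.hol (baseTransport F) j ^ p j = F.toHom (base p q) (fiber p q) ^ q j := by
  have h1 : ((F.comap (inlMap p q)).comap (glueMap p q j)).toFun (circleLoop.prod (Path.refl 1)) =
      1 := by
    have := (convex_closedBall (0 : ℂ) 1).contractibleSpace ⟨0, by simp⟩
    obtain ⟨φ, hφ⟩ := ((F.comap (inrMap p q j)).comap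
      ⟨fun z => (z, 1), by fun_prop⟩).exists_primitive
    have h2 := hφ (circleLoop.map continuous_diskBoundary)
    rw [mul_inv_cancel] at h2
    rw [← h2]
    exact F.congr _ _ fun t => (inrMap_diskBoundary p q j (circleLoop t) 1).symm
  rw [comap_glueMap_circleLoop (F₁ := baseTransport F) (F₂ := fiberTransport F)
    (fun γ => F.congr _ _ fun _ => rfl) (fun γ => F.congr _ _ fun _ => rfl), conj_eq_one_iff,
    zpow_neg, inv_mul_eq_one] at h1
  rw [toHom_fiber, h1]

end SeifertManifold

end

section

open unitInterval

namespace SeifertManifold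

variable {r : ℕ} {p : Fin r → ℕ} {q : Fin r → ℤ} {G : Type*} [Group G]
  {s : C(HoledSphere r, Circle)}

variable (p q) in
/-- The homomorphism of fundamental groups induced by a section. -/
noncomputable abbrev embedHom (hs : s (HoledSphere.base r) = 1) :
    FundamentalGroup (HoledSphere r) (HoledSphere.base r) →*
      FundamentalGroup (SeifertManifold p q) (base p q) :=
  FundamentalGroup.mapOfEq (embed p q s) (embed_base p q s hs)

theorem toHom_comp_embedHom (hs : s (HoledSphere.base r) = 1)
    (F : Transport (SeifertManifold p q) G)
    (γ : Path (HoledSphere.base r) (HoledSphere.base r)) :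
    F.toHom (base p q) (embedHom p q hs (FundamentalGroup.fromPath
      (Path.Homotopic.Quotient.mk γ))) =
      ((fiberTransport F).comap s).toFun γ * (baseTransport F).toFun γ := by
  rw [← MonoidHom.comp_apply, Transport.toHom_mapOfEq, Transport.toHom_fromPath]
  let γ' : Path (HoledSphere.base r, (1 : Circle)) (HoledSphere.base r, 1) :=
    ⟨⟨fun t => (γ t, s (γ t)), by fun_prop⟩, by simp [hs], by simp [hs]⟩
  have h1 : (F.comap (embed p q s)).toFun γ = (F.comap (inlMap p q)).toFun γ' :=
    F.congr _ _ fun _ => rfl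
  rw [h1, comap_inlMap_eq]
  exact congrArg₂ (· * ·) (Transport.congr _ _ _ fun _ => rfl) (Transport.congr _ _ _ fun _ => rfl)

/-- A representation is determined by its pull-back along a section and its value on the fibre. -/
theorem hom_ext (hs : s (HoledSphere.base r) = 1)
    {ρ ρ' : FundamentalGroup (SeifertManifold p q) (base p q) →* G}
    (h : ρ.comp (embedHom p q hs) = ρ'.comp (embedHom p q hs))
    (hf : ρ (fiber p q) = ρ' (fiber p q)) : ρ = ρ' := by
  obtain ⟨F, rfl⟩ := exists_prod_transport p q ρ
  obtain ⟨F', rfl⟩ := exists_prod_transport p q ρ'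
  rw [toHom_fiber, toHom_fiber] at hf
  have hl : ∀ γ : Path (1 : Circle) 1, (fiberTransport F).toFun γ = (fiberTransport F').toFun γ := by
    intro γ
    obtain ⟨n, hn⟩ := exists_zpow_circleLoop γ
    rw [hn, hn, hf]
  apply eq_of_comp_inlMap_eq
  rw [Transport.toHom_mapOfEq, Transport.toHom_mapOfEq]
  apply Transport.hom_ext
  intro γ
  rw [Transport.toHom_fromPath, Transport.toHom_fromPath, comap_inlMap_eq, comap_inlMap_eq]
  refine congrArg₂ (· * ·) (hl _) ?_
  have h1 := DFunLike.congr_fun h (FundamentalGroup.fromPath (Path.Homotopic.Quotient.mk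
    (γ.map continuous_fst)))
  rw [MonoidHom.comp_apply, MonoidHom.comp_apply] at h1
  have h2 := (toHom_comp_embedHom hs F (γ.map continuous_fst)).symm.trans
    (h1.trans (toHom_comp_embedHom hs F' (γ.map continuous_fst)))
  let δ : Path (1 : Circle) 1 := ⟨⟨fun t => s (γ t).1, by fun_prop⟩, by simp [hs], by simp [hs]⟩
  have h3 : ((fiberTransport F).comap s).toFun (γ.map continuous_fst) =
      ((fiberTransport F').comap s).toFun (γ.map continuous_fst) :=
    ((fiberTransport F).congr ((γ.map continuous_fst).map s.continuous) δ fun _ => rfl).trans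
      ((hl δ).trans ((fiberTransport F').congr δ ((γ.map continuous_fst).map s.continuous)
        fun _ => rfl))
  rw [h3] at h2
  exact mul_left_cancel h2

variable {n : Fin r → ℤ}

theorem hol_baseTransport (hr : 2 ≤ r) (hs : s (HoledSphere.base r) = 1) (hn : ∑ j, n j = 0)
    (hw : ∀ j : Fin r, (j : ℕ) ≠ 0 → HasWinding s j (n j))
    (F : Transport (SeifertManifold p q) G) (j : Fin r) :
    F.toHom (base p q) (embedHom p q hs (HoledSphere.meridian j)) =
      F.toHom (base p q) (fiber p q) ^ n j * HoledSphere.hol (baseTransport F) j := by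
  rw [HoledSphere.meridian, toHom_comp_embedHom, toHom_fiber,
    ← hol_comap_of_sum_eq_zero hr s hs n hn hw (fiberTransport F) j]
  rfl

/-- The relation between the boundary circles and the fibre. -/
theorem pow_meridian (hr : 2 ≤ r) (hs : s (HoledSphere.base r) = 1) (hn : ∑ j, n j = 0)
    (hw : ∀ j : Fin r, (j : ℕ) ≠ 0 → HasWinding s j (n j))
    (ρ : FundamentalGroup (SeifertManifold p q) (base p q) →* G) (j : Fin r) :
    (ρ (fiber p q) ^ (- n j) * ρ (embedHom p q hs (HoledSphere.meridian j))) ^ p j =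
      ρ (fiber p q) ^ q j := by
  obtain ⟨F, rfl⟩ := exists_prod_transport p q ρ
  rw [← hol_pow, hol_baseTransport hr hs hn hw, zpow_neg, inv_mul_cancel_left]

/-- Given a representation of the fundamental group of the holed sphere and a central element
subject to the relations of the meridian disks, there is a representation with this pull-back along
the section and this value on the fibre. -/
theorem exists_hom (hr : 2 ≤ r) (hs : s (HoledSphere.base r) = 1) (hn : ∑ j, n j = 0)
    (hw : ∀ j : Fin r, (j : ℕ) ≠ 0 → HasWinding s j (n j))
    (ρ : FundamentalGroup (HoledSphere r) (HoledSphere.base r) →* G) (e : G)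
    (he : ∀ g, Commute e g)
    (h : ∀ j, (e ^ (- n j) * ρ (HoledSphere.meridian j)) ^ p j = e ^ q j) :
    ∃ ρ' : FundamentalGroup (SeifertManifold p q) (base p q) →* G,
      ρ'.comp (embedHom p q hs) = ρ ∧ ρ' (fiber p q) = e := by
  obtain ⟨χ, hχ⟩ := Transport.exists_circleLoop_eq
    (⟨e, Subgroup.mem_center_iff.2 fun g => (he g).eq.symm⟩ : Subgroup.center G)
  have hcomm : ∀ {u v : Circle} (γ : Path u v) (g : G), g * χ.toFun γ = χ.toFun γ * g :=
    fun γ g => Subgroup.mem_center_iff.1 (χ.toFun γ).2 g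
  have hb : revProd (fun j => ρ (HoledSphere.meridian j) * e ^ (- n j)) = 1 := by
    rw [revProd_mul_zpow _ fun j => he _, HoledSphere.revProd_meridian hr, Finset.sum_neg_distrib,
      hn, neg_zero, zpow_zero, mul_one]
  obtain ⟨F, hF⟩ := HoledSphere.exists_transport hr _ hb
  -- `X` has central values, so that its product `E` with the transport `F` of the holed sphere is a
  -- transport again; `F` is twisted by the winding numbers of the section, which `X` restores
  let X : Transport Circle G :=
    { toFun := fun γ => χ.toFun γ
      map_homotopic := fun h => congrArg _ (χ.map_homotopic h)
      map_trans := fun γ δ => congrArg Subtype.val (χ.map_trans γ δ) }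
  have hX : X.toFun circleLoop = e := congrArg Subtype.val hχ
  let E : Transport (HoledSphere r × Circle) G :=
    { toFun := fun γ => F.toFun (γ.map continuous_fst) * X.toFun (γ.map continuous_snd)
      map_homotopic := fun h => congrArg₂ (· * ·)
        (F.map_homotopic (h.map ⟨Prod.fst, continuous_fst⟩))
        (X.map_homotopic (h.map ⟨Prod.snd, continuous_snd⟩))
      map_trans := fun γ δ => by
        rw [Path.map_trans, Path.map_trans, F.map_trans, X.map_trans, mul_assoc, mul_assoc]
        congr 1
        rw [← mul_assoc, ← mul_assoc]
        exact congrArg (· * X.toFun (γ.map continuous_snd)) (hcomm _ _) }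
  have hE1 : ∀ {x y : HoledSphere r} (γ : Path x y),
      E.toFun (γ.prod (Path.refl (1 : Circle))) = F.toFun γ := fun γ =>
    (congrArg₂ (· * ·) (F.congr _ γ fun _ => rfl) (X.map_const _ fun _ => rfl)).trans (mul_one _)
  have hE2 : ∀ {u v : Circle} (γ : Path u v),
      E.toFun ((Path.refl (HoledSphere.base r)).prod γ) = X.toFun γ := fun γ =>
    (congrArg₂ (· * ·) (F.map_const _ fun _ => rfl) (X.congr _ γ fun _ => rfl)).trans (one_mul _)
  obtain ⟨F', hF'⟩ := exists_extend p q E fun j => by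
    rw [comap_glueMap_circleLoop hE1 hE2, hX, hF, ← ((he _).zpow_left _).eq, h, zpow_neg,
      inv_mul_cancel, mul_one, mul_inv_cancel]
  have hb' : ∀ {x y} (γ : Path x y), (baseTransport F').toFun γ = F.toFun γ := fun γ => by
    rw [← hE1, ← hF']
    exact F'.congr _ _ fun _ => rfl
  have hf' : F'.toHom (base p q) (fiber p q) = e := by
    rw [toHom_fiber, ← hX, ← hE2, ← hF']
    exact F'.congr _ _ fun _ => rfl
  refine ⟨F'.toHom (base p q), HoledSphere.hom_ext hr fun j => ?_, hf'⟩
  rw [MonoidHom.comp_apply, hol_baseTransport hr hs hn hw, hf', HoledSphere.hol, hb',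
    ← HoledSphere.hol, hF, ((he _).zpow_left _).eq, zpow_neg, inv_mul_cancel_right]

/-- If the pull-back of a representation along a section takes its values in a subgroup, and the
subgroup contains the value on the fibre, then the representation takes its values in the
subgroup. -/
theorem range_le (hr : 2 ≤ r) (hs : s (HoledSphere.base r) = 1) (hn : ∑ j, n j = 0)
    (hw : ∀ j : Fin r, (j : ℕ) ≠ 0 → HasWinding s j (n j))
    (ρ : FundamentalGroup (SeifertManifold p q) (base p q) →* G) (S : Subgroup G)
    (h : ∀ γ, ρ (embedHom p q hs γ) ∈ S) (he : ∀ g, Commute (ρ (fiber p q)) g)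
    (hf : ρ (fiber p q) ∈ S) (γ : FundamentalGroup (SeifertManifold p q) (base p q)) : ρ γ ∈ S := by
  obtain ⟨ρ', h1, h2⟩ := exists_hom (p := p) (q := q) hr hs hn hw
    ((ρ.comp (embedHom p q hs)).codRestrict S h) (⟨_, hf⟩ : S) (fun g => Subtype.ext (he g))
    fun j => Subtype.ext (pow_meridian hr hs hn hw ρ j)
  have h3 : S.subtype.comp ρ' = ρ := by
    refine hom_ext hs ?_ ?_
    · rw [MonoidHom.comp_assoc, h1]
      rfl
    · rw [MonoidHom.comp_apply, h2]
      rfl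
  rw [← h3]
  exact (ρ' γ).2

end SeifertManifold

end

section

/-! ### The group `SU(2)` -/

namespace SU2

instance : IsTopologicalGroup SU2 where
  continuous_inv := (continuous_star.comp continuous_subtype_val).subtype_mk _

/-- The upper left entry. -/
def a (g : SU2) : ℂ := (g : Matrix (Fin 2) (Fin 2) ℂ) 0 0

/-- The upper right entry. -/
def b (g : SU2) : ℂ := (g : Matrix (Fin 2) (Fin 2) ℂ) 0 1

theorem continuous_a : Continuous a := (continuous_subtype_val).matrix_elem 0 0

open ComplexConjugate

theorem star_eq_adjugate (g : SU2) :
    star (g : Matrix (Fin 2) (Fin 2) ℂ) = (g : Matrix (Fin 2) (Fin 2) ℂ).adjugate := by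
  obtain ⟨M, hM⟩ := g
  obtain ⟨h1, h2⟩ := Matrix.mem_specialUnitaryGroup_iff.1 hM
  have h3 := Matrix.mem_unitaryGroup_iff'.1 h1
  calc star M = star M * (M * M.adjugate) := by rw [Matrix.mul_adjugate, h2, one_smul, mul_one]
    _ = M.adjugate := by rw [← mul_assoc, h3, one_mul]

theorem coe_eq (g : SU2) : (g : Matrix (Fin 2) (Fin 2) ℂ) = !![a g, b g; -conj (b g), conj (a g)] := by
  have h := star_eq_adjugate g
  rw [Matrix.adjugate_fin_two] at h
  have h1 := congrFun (congrFun h 0) 0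
  have h2 := congrFun (congrFun h 1) 0
  simp only [Matrix.star_apply, Matrix.of_apply, Matrix.cons_val', Matrix.cons_val_zero,
    Matrix.cons_val_one, Matrix.cons_val_fin_one] at h1 h2
  ext i j
  fin_cases i <;> fin_cases j
  · rfl
  · rfl
  · simp [a, b]
    simpa using congrArg Neg.neg h2.symm
  · simpa [a, b] using h1.symm

theorem norm_sq (g : SU2) : Complex.normSq (a g) + Complex.normSq (b g) = 1 := by
  have h := (Matrix.mem_specialUnitaryGroup_iff.1 g.2).2
  rw [coe_eq, Matrix.det_fin_two_of] at h
  have h2 := congrArg Complex.re h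
  simp only [Complex.normSq_apply]
  simp at h2
  linarith

theorem ext_ab {g h : SU2} (ha : a g = a h) (hb : b g = b h) : g = h :=
  Subtype.ext (by rw [coe_eq, coe_eq h, ha, hb])

/-- The element of `SU(2)` with the given first row. -/
def mk (x y : ℂ) (h : Complex.normSq x + Complex.normSq y = 1) : SU2 :=
  ⟨!![x, y; -conj y, conj x], by
    have h' : x * conj x + y * conj y = 1 := by
      rw [Complex.mul_conj, Complex.mul_conj]; exact_mod_cast h
    rw [Matrix.mem_specialUnitaryGroup_iff, Matrix.mem_unitaryGroup_iff]
    constructor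
    · ext i j
      fin_cases i <;> fin_cases j <;>
        simp [Matrix.mul_apply, Fin.sum_univ_two, Matrix.star_apply, h']
      · ring
      · ring
      · rw [← h']; ring
    · rw [Matrix.det_fin_two_of, ← h']; ring⟩

@[simp] theorem a_mk (x y : ℂ) (h) : a (mk x y h) = x := rfl
@[simp] theorem b_mk (x y : ℂ) (h) : b (mk x y h) = y := rfl

theorem continuous_mk {T : Type*} [TopologicalSpace T] {x y : T → ℂ} {S : Set T}
    (h : ∀ t, Complex.normSq (x t) + Complex.normSq (y t) = 1)
    (hx : ContinuousOn x S) (hy : ContinuousOn y S) :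
    ContinuousOn (fun t => mk (x t) (y t) (h t)) S := by
  rw [Topology.IsInducing.subtypeVal.continuousOn_iff]
  refine continuousOn_pi.2 fun i => continuousOn_pi.2 fun j => ?_
  have h1 := Complex.continuous_conj.comp_continuousOn hx
  have h2 := (Complex.continuous_conj.comp_continuousOn hy).neg
  fin_cases i <;> fin_cases j
  · exact hx
  · exact hy
  · exact h2
  · exact h1

@[simp] theorem a_mul (g h : SU2) : a (g * h) = a g * a h - b g * conj (b h) := by
  change ((g : Matrix (Fin 2) (Fin 2) ℂ) * (h : Matrix (Fin 2) (Fin 2) ℂ)) 0 0 = _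
  rw [coe_eq g, coe_eq h]
  simp [Matrix.mul_apply, Fin.sum_univ_two]
  ring

@[simp] theorem b_mul (g h : SU2) : b (g * h) = a g * b h + b g * conj (a h) := by
  change ((g : Matrix (Fin 2) (Fin 2) ℂ) * (h : Matrix (Fin 2) (Fin 2) ℂ)) 0 1 = _
  rw [coe_eq g, coe_eq h]
  simp [Matrix.mul_apply, Fin.sum_univ_two]

@[simp] theorem a_one : a 1 = 1 := rfl
@[simp] theorem b_one : b 1 = 0 := rfl

@[simp] theorem a_inv (g : SU2) : a g⁻¹ = conj (a g) := rfl

@[simp] theorem b_inv (g : SU2) : b g⁻¹ = - b g := by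
  change (star (g : Matrix (Fin 2) (Fin 2) ℂ)) 0 1 = _
  rw [coe_eq]
  simp

theorem coe_exp_eq (θ : ℝ) : (Circle.exp θ : ℂ) = ⟨Real.cos θ, Real.sin θ⟩ := by
  rw [Circle.coe_exp]
  exact Complex.ext (Complex.exp_ofReal_mul_I_re θ) (Complex.exp_ofReal_mul_I_im θ)

@[simp] theorem a_diag (θ : ℝ) : a (diag θ) = Circle.exp θ := rfl
@[simp] theorem b_diag (θ : ℝ) : b (diag θ) = 0 := rfl

theorem diag_add (θ τ : ℝ) : diag (θ + τ) = diag θ * diag τ :=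
  ext_ab (by simp) (by simp)

theorem diag_neg (θ : ℝ) : diag (-θ) = (diag θ)⁻¹ :=
  ext_ab (by
    rw [a_diag, a_inv, a_diag, coe_exp_eq, coe_exp_eq, Real.cos_neg, Real.sin_neg]; rfl) (by simp)

theorem diag_zero : diag 0 = 1 := ext_ab (by simp) (by simp)

theorem continuous_diag : Continuous diag := by
  have h : ∀ θ : ℝ, Complex.normSq (Circle.exp θ : ℂ) + Complex.normSq 0 = 1 := fun θ => by
    rw [Complex.normSq_eq_norm_sq, Circle.norm_coe, map_zero]
    norm_num
  refine continuousOn_univ.1 ((continuous_mk (x := fun θ => (Circle.exp θ : ℂ)) (y := fun _ => 0) h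
    (by fun_prop) (by fun_prop)).congr fun θ _ => ext_ab rfl rfl)

/-- Half the trace. -/
def half (g : SU2) : ℝ := (a g).re

theorem continuous_half : Continuous half := Complex.continuous_re.comp continuous_a

@[simp] theorem half_one : half 1 = 1 := rfl

@[simp] theorem half_diag (θ : ℝ) : half (diag θ) = Real.cos θ := by
  simp [half, Complex.exp_ofReal_mul_I_re]

theorem half_mul_comm (g h : SU2) : half (g * h) = half (h * g) := by
  simp [half]
  ring

@[simp] theorem half_conj (k g : SU2) : half (k * g * k⁻¹) = half g := by
  rw [half_mul_comm, ← mul_assoc, inv_mul_cancel, one_mul]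

theorem half_sq_le (g : SU2) : half g ^ 2 ≤ 1 := by
  have h := norm_sq g
  rw [Complex.normSq_apply, Complex.normSq_apply] at h
  rw [half]
  nlinarith [mul_self_nonneg (a g).im, mul_self_nonneg (b g).re, mul_self_nonneg (b g).im]

theorem half_mem (g : SU2) : half g ∈ Set.Icc (-1 : ℝ) 1 :=
  abs_le.1 (abs_le_one_iff_mul_self_le_one.2 (by nlinarith [half_sq_le g]))

/-- The rotation of the sphere of imaginary unit quaternions that moves the axis of the diagonal
matrices by the angle `φ`. -/
noncomputable def rot (φ : ℝ) : SU2 := mk (Real.cos (φ / 2) : ℂ) (-Real.sin (φ / 2) : ℂ) (by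
  rw [← Complex.ofReal_neg, Complex.normSq_ofReal, Complex.normSq_ofReal]
  nlinarith [Real.sin_sq_add_cos_sq (φ / 2)])

theorem continuous_rot : Continuous rot := by
  exact continuousOn_univ.1 (continuous_mk _ (by fun_prop) (by fun_prop))

theorem rot_conj_diag_a (φ α : ℝ) : a (rot φ * diag α * (rot φ)⁻¹) =
    ⟨Real.cos α, Real.sin α * Real.cos φ⟩ := by
  have h1 : Real.cos φ = Real.cos (φ / 2) ^ 2 - Real.sin (φ / 2) ^ 2 := by
    rw [← Real.cos_two_mul']; ring_nf
  have h2 := Real.sin_sq_add_cos_sq (φ / 2)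
  simp only [a_mul, b_mul, a_inv, b_inv, a_diag, b_diag, rot, a_mk, b_mk, coe_exp_eq, h1]
  refine Complex.ext ?_ ?_
  · simp [-Complex.ofReal_cos, -Complex.ofReal_sin]
    linear_combination Real.cos α * h2
  · simp [-Complex.ofReal_cos, -Complex.ofReal_sin]
    ring

theorem rot_conj_diag_b (φ α : ℝ) : b (rot φ * diag α * (rot φ)⁻¹) =
    ⟨0, Real.sin α * Real.sin φ⟩ := by
  have h1 : Real.sin φ = 2 * Real.sin (φ / 2) * Real.cos (φ / 2) := by
    rw [← Real.sin_two_mul]; ring_nf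
  simp only [a_mul, b_mul, a_inv, b_inv, a_diag, b_diag, rot, a_mk, b_mk, coe_exp_eq, h1]
  refine Complex.ext ?_ ?_
  · simp [-Complex.ofReal_cos, -Complex.ofReal_sin]
    ring
  · simp [-Complex.ofReal_cos, -Complex.ofReal_sin]
    ring

/-- Two elements with the same half trace and the same imaginary part of the diagonal entry are
conjugate by a diagonal matrix. -/
theorem exists_diag_conj {g h : SU2} (ha : a g = a h) : ∃ δ : ℝ, diag δ * g * (diag δ)⁻¹ = h := by
  have hn : ‖b g‖ = ‖b h‖ := by
    have h1 := norm_sq g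
    have h2 := norm_sq h
    rw [ha] at h1
    rw [← sq_eq_sq₀ (norm_nonneg _) (norm_nonneg _), ← Complex.normSq_eq_norm_sq,
      ← Complex.normSq_eq_norm_sq]
    linarith
  refine ⟨(Complex.arg (b h) - Complex.arg (b g)) / 2, ext_ab ?_ ?_⟩
  · rw [← ha, ← diag_neg]
    have h3 : a (diag ((Complex.arg (b h) - Complex.arg (b g)) / 2)) *
        a (diag (-((Complex.arg (b h) - Complex.arg (b g)) / 2))) = 1 := by
      rw [a_diag, a_diag, ← Circle.coe_mul, ← Circle.exp_add, add_neg_cancel, Circle.exp_zero,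
        Circle.coe_one]
    simp only [a_mul, b_mul, b_diag, zero_mul, map_zero, mul_zero, sub_zero]
    rw [mul_right_comm, h3, one_mul]
  · simp only [a_mul, b_mul, b_diag, zero_mul, b_inv, neg_zero, mul_zero, zero_add, a_inv,
      a_diag, Complex.conj_conj, add_zero]
    rw [mul_right_comm, ← Circle.coe_mul, ← Circle.exp_add, add_halves]
    have h4 := Complex.norm_mul_exp_arg_mul_I (b g)
    have h5 := Complex.norm_mul_exp_arg_mul_I (b h)
    rw [← Circle.coe_exp] at h4 h5
    rw [hn] at h4
    calc _ = (Circle.exp (Complex.arg (b h) - Complex.arg (b g)) : ℂ) *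
        (‖b h‖ * Circle.exp (Complex.arg (b g))) := by rw [h4]
      _ = ‖b h‖ * Circle.exp (Complex.arg (b h)) := by
        rw [mul_left_comm, ← Circle.coe_mul, ← Circle.exp_add, sub_add_cancel]
      _ = b h := h5

/-- Every element of `SU(2)` is conjugate to a diagonal one. -/
theorem exists_conj_diag (g : SU2) {α : ℝ} (h : half g = Real.cos α) :
    ∃ k : SU2, g = k * diag α * k⁻¹ := by
  have h1 := norm_sq g
  rw [Complex.normSq_apply, ← half, h] at h1
  have h2 := Real.sin_sq_add_cos_sq α
  have h3 := Complex.normSq_nonneg (b g)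
  have him : (a g).im ^ 2 ≤ Real.sin α ^ 2 := by nlinarith
  have hφ : ∃ φ, Real.sin α * Real.cos φ = (a g).im := by
    by_cases h0 : Real.sin α = 0
    · refine ⟨0, ?_⟩
      rw [h0] at him ⊢
      nlinarith
    · have := sq_le_sq.1 him
      have h4 : |(a g).im / Real.sin α| ≤ 1 := by
        rw [abs_div, div_le_one (abs_pos.2 h0)]; exact this
      refine ⟨Real.arccos ((a g).im / Real.sin α), ?_⟩
      rw [Real.cos_arccos (abs_le.1 h4).1 (abs_le.1 h4).2, mul_div_cancel₀ _ h0]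
  obtain ⟨φ, hφ⟩ := hφ
  obtain ⟨δ, hδ⟩ := exists_diag_conj (g := rot φ * diag α * (rot φ)⁻¹) (h := g) (by
    rw [rot_conj_diag_a, hφ, ← h]; rfl)
  exact ⟨diag δ * rot φ, by rw [← hδ]; group⟩

theorem mk_eq_mk_diag_iff (g : SU2) (α : ℝ) :
    ConjClasses.mk g = ConjClasses.mk (diag α) ↔ half g = Real.cos α := by
  rw [ConjClasses.mk_eq_mk_iff_isConj, isConj_comm, isConj_iff]
  constructor
  · rintro ⟨k, rfl⟩
    rw [half_conj, half_diag]
  · intro h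
    obtain ⟨k, hk⟩ := exists_conj_diag g h
    exact ⟨k, hk.symm⟩

end SU2

end

/-! ### Spherical polygons -/

namespace SU2

/-- The tuples of elements of `SU(2)` with half traces `cos (θ j)` and product `t`: polygons in the
three-sphere with prescribed side lengths and end points. -/
def polygon {n : ℕ} (θ : Fin n → ℝ) (t : SU2) : Set (Fin n → SU2) :=
  {g | (∀ j, half (g j) = Real.cos (θ j)) ∧ revProd g = t}

theorem conj_mem_polygon {n : ℕ} {θ : Fin n → ℝ} {t : SU2} {g : Fin n → SU2} (k : SU2)
    (h : g ∈ polygon θ t) : (fun j => k * g j * k⁻¹) ∈ polygon θ (k * t * k⁻¹) := by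
  refine ⟨fun j => by rw [half_conj, h.1], ?_⟩
  have := map_revProd (MulAut.conj k).toMonoidHom g
  rw [h.2] at this
  exact this.symm

theorem snoc_mem_polygon {n : ℕ} {θ : Fin (n + 1) → ℝ} {t u g : SU2} {h : Fin n → SU2}
    (hh : h ∈ polygon (fun j => θ j.castSucc) u) (hg : half g = Real.cos (θ (Fin.last n)))
    (hgu : g * u = t) : (Fin.snoc h g : Fin (n + 1) → SU2) ∈ polygon θ t := by
  refine ⟨fun j => ?_, ?_⟩
  · refine Fin.lastCases ?_ (fun i => ?_) j
    · rw [Fin.snoc_last, hg]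
    · rw [Fin.snoc_castSucc, hh.1]
  · rw [revProd_succ, Fin.snoc_last]
    simp only [Fin.snoc_castSucc]
    rw [hh.2, hgu]

theorem init_mem_polygon {n : ℕ} {θ : Fin (n + 1) → ℝ} {t : SU2} {g : Fin (n + 1) → SU2}
    (h : g ∈ polygon θ t) : (fun j : Fin n => g j.castSucc) ∈ polygon (fun j => θ j.castSucc)
      ((g (Fin.last n))⁻¹ * t) :=
  ⟨fun j => h.1 _, by rw [← h.2, revProd_succ, inv_mul_cancel_left]⟩

/-- Adds a side to a family of polygons along the triangles with sides `α`, `θ` and `τ`. The cosine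
of the angle between the sides `α` and `τ` is `c`. -/
theorem exists_section_step {n : ℕ} {θ : Fin (n + 1) → ℝ} {I S : Set ℝ}
    {σ : ℝ → Fin n → SU2} (hσ : ContinuousOn σ I)
    (hσI : ∀ x ∈ I, σ x ∈ polygon (fun j => θ j.castSucc) (diag x))
    {α c τ : ℝ → ℝ} (hα : ContinuousOn α S) (hc : ContinuousOn c S) (hτ : ContinuousOn τ S)
    (hαI : ∀ s ∈ S, α s ∈ I) (hc1 : ∀ s ∈ S, -1 ≤ c s ∧ c s ≤ 1)
    (h : ∀ s ∈ S, Real.cos (τ s) * Real.cos (α s) + Real.sin (τ s) * Real.sin (α s) * c s =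
      Real.cos (θ (Fin.last n))) :
    ∃ σ' : ℝ → Fin (n + 1) → SU2, ContinuousOn σ' S ∧
      ∀ s ∈ S, σ' s ∈ polygon θ (diag (τ s)) ∧
        half (revProd fun j : Fin n => σ' s j.castSucc) = Real.cos (α s) := by
  let k : ℝ → SU2 := fun s => rot (Real.arccos (c s))
  have hk : ContinuousOn k S := continuous_rot.comp_continuousOn
    (Real.continuous_arccos.comp_continuousOn hc)
  let u : ℝ → SU2 := fun s => k s * diag (α s) * (k s)⁻¹
  have hu : ContinuousOn u S :=
    (hk.mul (continuous_diag.comp_continuousOn hα)).mul hk.inv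
  refine ⟨fun s => Fin.snoc (fun j => k s * σ (α s) j * (k s)⁻¹) (diag (τ s) * (u s)⁻¹), ?_, ?_⟩
  · refine continuousOn_pi.2 fun j => ?_
    refine Fin.lastCases ?_ (fun i => ?_) j
    · simp only [Fin.snoc_last]
      exact (continuous_diag.comp_continuousOn hτ).mul hu.inv
    · simp only [Fin.snoc_castSucc]
      exact (hk.mul ((continuousOn_pi.1 (hσ.comp hα hαI)) i)).mul hk.inv
  · intro s hs
    have h1 := conj_mem_polygon (k s) (hσI _ (hαI s hs))
    refine ⟨snoc_mem_polygon h1 ?_ (inv_mul_cancel_right _ _), ?_⟩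
    · rw [← h s hs]
      have ha : a (u s) = _ := rot_conj_diag_a _ _
      have hb : b (u s) = _ := rot_conj_diag_b _ _
      rw [half, a_mul, a_inv, ha, b_diag, a_diag, coe_exp_eq,
        Real.cos_arccos (hc1 s hs).1 (hc1 s hs).2]
      simp
      ring
    · simp only [Fin.snoc_castSucc]
      rw [h1.2, half_conj, half_diag]

/-- The first component bounds the angle of a product of elements with the angles `θ j`, the second
one bounds the angle of the negative of such a product. Both bounds are attained where they do not
exceed `π`. For the empty product, these are the angles of `1` and of `-1`; multiplication by an
element of angle `θ` increases an angle by `θ` at most, and multiplication by its negative by `π -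
θ` at most. -/
noncomputable def reachPair : ∀ {n : ℕ}, (Fin n → ℝ) → ℝ × ℝ
  | 0, _ => (0, Real.pi)
  | n + 1, θ =>
    let x := reachPair fun j : Fin n => θ j.castSucc
    (min (θ (Fin.last n) + x.1) (Real.pi - θ (Fin.last n) + x.2),
      min (θ (Fin.last n) + x.2) (Real.pi - θ (Fin.last n) + x.1))

/-- The angles of the products. -/
def reachSet {n : ℕ} (θ : Fin n → ℝ) : Set ℝ :=
  {α | 0 ≤ α ∧ α ≤ Real.pi ∧ α ≤ (reachPair θ).1 ∧ Real.pi - α ≤ (reachPair θ).2}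

/-- The triangle inequalities for the last side, the side `τ`, and the product of the other sides.
-/
theorem mem_reachSet_succ {n : ℕ} {θ : Fin (n + 1) → ℝ} {τ : ℝ} :
    τ ∈ reachSet θ ↔ (0 ≤ τ ∧ τ ≤ Real.pi) ∧
      |θ (Fin.last n) - τ| ≤ (reachPair fun j : Fin n => θ j.castSucc).1 ∧
      |Real.pi - θ (Fin.last n) - τ| ≤ (reachPair fun j : Fin n => θ j.castSucc).2 := by
  simp only [reachSet, reachPair, Set.mem_ofPred_eq, le_min_iff, abs_le]
  constructor
  · rintro ⟨h1, h2, ⟨h3, h4⟩, h5, h6⟩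
    refine ⟨⟨h1, h2⟩, ⟨?_, ?_⟩, ?_, ?_⟩ <;> linarith
  · rintro ⟨⟨h1, h2⟩, ⟨h3, h4⟩, h5, h6⟩
    refine ⟨?_, ?_, ⟨?_, ?_⟩, ?_, ?_⟩ <;> linarith

theorem reachSet_eq_Icc {n : ℕ} (θ : Fin n → ℝ) : reachSet θ =
    Set.Icc (max 0 (Real.pi - (reachPair θ).2)) (min Real.pi (reachPair θ).1) := by
  ext α
  simp only [reachSet, Set.mem_ofPred_eq, Set.mem_Icc, max_le_iff, le_min_iff]
  constructor
  · rintro ⟨h1, h2, h3, h4⟩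
    refine ⟨⟨?_, ?_⟩, ?_, ?_⟩ <;> linarith
  · rintro ⟨⟨h1, h2⟩, h3, h4⟩
    refine ⟨?_, ?_, ?_, ?_⟩ <;> linarith

end SU2

section

/-! ### Spherical triangles -/

namespace SU2

open Real in
/-- In a family of spherical triangles with a fixed side `θ` and a side `τ`, the angle between these
two sides can be chosen continuously, with cosine `c τ`, in such a way that the third side stays in
a given interval and, if possible, does not degenerate. The cosine is chosen as close to zero as
possible; this also makes it continuous at the degenerate values of `τ`. -/
theorem exists_triangle {θ lo hi : ℝ} (hθ : 0 < θ) (hθ' : θ < π) (hlo : 0 ≤ lo) (hlohi : lo ≤ hi)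
    (hhi : hi ≤ π) (hne : lo < hi ∨ 0 < sin lo) {S : Set ℝ} (hS : ∀ τ ∈ S, (0 ≤ τ ∧ τ ≤ π) ∧
      |θ - τ| ≤ hi ∧ lo ≤ π - |π - θ - τ|) :
    ∃ c : ℝ → ℝ, ContinuousOn c S ∧ ∀ τ ∈ S, (-1 ≤ c τ ∧ c τ ≤ 1) ∧
      cos hi ≤ cos θ * cos τ + sin θ * sin τ * c τ ∧
      cos θ * cos τ + sin θ * sin τ * c τ ≤ cos lo ∧
      (cos θ * cos τ + sin θ * sin τ * c τ) ^ 2 < 1 := by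
  have hs := sin_pos_of_pos_of_lt_pi hθ hθ'
  -- the conditions on the third side confine `c τ` to `[A τ, B τ]`; where the triangle degenerates,
  -- these quotients are zero by the convention on division by zero
  let A : ℝ → ℝ := fun τ => (cos hi - cos θ * cos τ) / (sin θ * sin τ)
  let B : ℝ → ℝ := fun τ => (cos lo - cos θ * cos τ) / (sin θ * sin τ)
  have hcos : cos hi ≤ cos lo := cos_le_cos_of_nonneg_of_le_pi hlo hhi hlohi
  have hzero : ∀ τ, sin τ = 0 → max (A τ) (min (B τ) 0) = 0 := by
    intro τ h
    simp [A, B, h]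
  have hle : ∀ {x y z : ℝ}, x ≤ z → z ≤ y → |max x (min y 0)| ≤ |z| := by
    intro x y z h1 h2
    rw [abs_le]
    constructor
    · refine le_trans ?_ (le_max_right _ _)
      exact le_min ((neg_abs_le z).trans h2) (neg_nonpos.2 (abs_nonneg z))
    · exact max_le (h1.trans (le_abs_self z)) ((min_le_right _ _).trans (abs_nonneg z))
  have hS0 : (0 : ℝ) ∈ S → cos hi ≤ cos θ ∧ cos θ ≤ cos lo := by
    intro h
    obtain ⟨-, h1, h2⟩ := hS 0 h
    rw [sub_zero, abs_of_pos hθ] at h1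
    rw [sub_zero, abs_of_pos (sub_pos.2 hθ')] at h2
    exact ⟨cos_le_cos_of_nonneg_of_le_pi hθ.le hhi h1,
      cos_le_cos_of_nonneg_of_le_pi hlo hθ'.le (by linarith)⟩
  have hSpi : π ∈ S → cos hi ≤ - cos θ ∧ - cos θ ≤ cos lo := by
    intro h
    obtain ⟨-, h1, h2⟩ := hS π h
    rw [abs_sub_comm, abs_of_pos (sub_pos.2 hθ')] at h1
    rw [show π - θ - π = -θ by ring, abs_neg, abs_of_pos hθ] at h2
    rw [← cos_pi_sub]
    exact ⟨cos_le_cos_of_nonneg_of_le_pi (by linarith) hhi h1,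
      cos_le_cos_of_nonneg_of_le_pi hlo (by linarith) h2⟩
  -- near the degenerate values of `τ`, a continuous function lies between the two bounds.
  have hsq : ∀ (E : ℝ → ℝ) (τ : ℝ), sin τ = 0 → ContinuousAt E τ → E τ = 0 →
      (∀ x ∈ S, A x ≤ E x ∧ E x ≤ B x) →
      ContinuousWithinAt (fun τ => max (A τ) (min (B τ) 0)) S τ := by
    intro E τ h0 hE hE0 hAB
    change Filter.Tendsto _ _ (nhds (max (A τ) (min (B τ) 0)))
    rw [hzero τ h0]
    refine squeeze_zero_norm' (a := fun x => |E x|) ?_ ?_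
    · filter_upwards [self_mem_nhdsWithin] with x hx
      exact hle (hAB x hx).1 (hAB x hx).2
    · have := hE.abs.continuousWithinAt (s := S)
      change Filter.Tendsto _ _ (nhds |E τ|) at this
      rwa [hE0, abs_zero] at this
  have hdiv : ∀ x ∈ S, 0 ≤ sin θ * sin x := fun x hx =>
    mul_nonneg hs.le (sin_nonneg_of_nonneg_of_le_pi (hS x hx).1.1 (hS x hx).1.2)
  refine ⟨fun τ => max (A τ) (min (B τ) 0), fun τ hτ => ?_, fun τ hτ => ?_⟩
  · rcases (sin_nonneg_of_nonneg_of_le_pi (hS τ hτ).1.1 (hS τ hτ).1.2).eq_or_lt with h0 | h0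
    · rcases (hS τ hτ).1.1.eq_or_lt with h1 | h1
      · subst h1
        refine hsq (fun x => cos θ * sin x / (sin θ * (1 + cos x))) 0 h0.symm ?_ (by simp)
          fun x hx => ?_
        · refine ContinuousAt.div (by fun_prop) (by fun_prop) ?_
          rw [cos_zero]
          positivity
        · have hx' : cos θ * sin x / (sin θ * (1 + cos x)) =
              (cos θ - cos θ * cos x) / (sin θ * sin x) := by
            by_cases hsx : sin x = 0
            · simp [hsx]
            · have h3 : 1 + cos x ≠ 0 := by
                intro h; apply hsx
                have := sin_sq_add_cos_sq x
                have h4 : cos x = -1 := by linarith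
                rw [h4] at this
                nlinarith
              rw [div_eq_div_iff (mul_ne_zero hs.ne' h3) (mul_ne_zero hs.ne' hsx)]
              linear_combination cos θ * sin θ * sin_sq_add_cos_sq x
          simp only [hx']
          exact ⟨div_le_div_of_nonneg_right (by linarith [(hS0 hτ).1]) (hdiv x hx),
            div_le_div_of_nonneg_right (by linarith [(hS0 hτ).2]) (hdiv x hx)⟩
      · obtain rfl : τ = π := by
          by_contra hne
          exact h0.not_lt (sin_pos_of_pos_of_lt_pi h1 (lt_of_le_of_ne (hS τ hτ).1.2 hne))
        refine hsq (fun x => - cos θ * sin x / (sin θ * (1 - cos x))) π h0.symm ?_ (by simp)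
          fun x hx => ?_
        · refine ContinuousAt.div (by fun_prop) (by fun_prop) ?_
          rw [cos_pi]
          exact mul_ne_zero hs.ne' (by norm_num)
        · have hx' : - cos θ * sin x / (sin θ * (1 - cos x)) =
              (- cos θ - cos θ * cos x) / (sin θ * sin x) := by
            by_cases hsx : sin x = 0
            · simp [hsx]
            · have h3 : 1 - cos x ≠ 0 := by
                intro h; apply hsx
                have := sin_sq_add_cos_sq x
                have h4 : cos x = 1 := by linarith
                rw [h4] at this
                nlinarith
              rw [div_eq_div_iff (mul_ne_zero hs.ne' h3) (mul_ne_zero hs.ne' hsx)]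
              linear_combination - cos θ * sin θ * sin_sq_add_cos_sq x
          simp only [hx']
          exact ⟨div_le_div_of_nonneg_right (by linarith [(hSpi hτ).1]) (hdiv x hx),
            div_le_div_of_nonneg_right (by linarith [(hSpi hτ).2]) (hdiv x hx)⟩
    · have h1 : sin θ * sin τ ≠ 0 := mul_ne_zero hs.ne' h0.ne'
      refine ContinuousAt.continuousWithinAt ?_
      refine Filter.Tendsto.max ?_ (Filter.Tendsto.min ?_ tendsto_const_nhds)
      · exact ContinuousAt.div (f := fun τ => cos hi - cos θ * cos τ) (by fun_prop) (by fun_prop) h1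
      · exact ContinuousAt.div (f := fun τ => cos lo - cos θ * cos τ) (by fun_prop) (by fun_prop) h1
  · obtain ⟨⟨h1, h2⟩, h3, h4⟩ := hS τ hτ
    have hsτ := sin_nonneg_of_nonneg_of_le_pi h1 h2
    -- the intervals `[A τ, B τ]` and `[-1, 1]` intersect.
    have hAB : A τ ≤ B τ := div_le_div_of_nonneg_right (by linarith) (hdiv τ hτ)
    have hA : A τ ≤ 1 := by
      refine div_le_one_of_le₀ ?_ (hdiv τ hτ)
      have := cos_le_cos_of_nonneg_of_le_pi (abs_nonneg (θ - τ)) hhi h3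
      rw [cos_abs, cos_sub] at this
      linarith
    have hB : -1 ≤ B τ := by
      rcases (hdiv τ hτ).eq_or_lt with h | h
      · simp [B, ← h]
      · rw [le_div_iff₀ h]
        have := cos_le_cos_of_nonneg_of_le_pi hlo (by linarith [abs_nonneg (π - θ - τ)]) h4
        rw [cos_pi_sub, cos_abs, show π - θ - τ = π - (θ + τ) by ring, cos_pi_sub, neg_neg,
          cos_add] at this
        linarith
    set c := max (A τ) (min (B τ) 0) with hc
    have hcA : A τ ≤ c := le_max_left _ _
    have hcB : c ≤ B τ := max_le hAB (min_le_left _ _)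
    have hc1 : c ≤ 1 := max_le hA ((min_le_right _ _).trans zero_le_one)
    have hc2 : -1 ≤ c := le_max_of_le_right (le_min hB (by norm_num))
    have hX1 : cos hi ≤ cos θ * cos τ + sin θ * sin τ * c := by
      rcases (hdiv τ hτ).eq_or_lt with h | h
      · rcases h1.eq_or_lt with h5 | h5
        · subst h5
          simpa using (hS0 hτ).1
        · obtain rfl : τ = π := by
            by_contra hne
            exact h.not_lt (mul_pos hs (sin_pos_of_pos_of_lt_pi h5 (lt_of_le_of_ne h2 hne)))
          simpa using (hSpi hτ).1
      · rw [div_le_iff₀ h] at hcA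
        linarith
    have hX2 : cos θ * cos τ + sin θ * sin τ * c ≤ cos lo := by
      rcases (hdiv τ hτ).eq_or_lt with h | h
      · rcases h1.eq_or_lt with h5 | h5
        · subst h5
          simpa using (hS0 hτ).2
        · obtain rfl : τ = π := by
            by_contra hne
            exact h.not_lt (mul_pos hs (sin_pos_of_pos_of_lt_pi h5 (lt_of_le_of_ne h2 hne)))
          simpa using (hSpi hτ).2
      · rw [le_div_iff₀ h] at hcB
        linarith
    refine ⟨⟨hc2, hc1⟩, hX1, hX2, ?_⟩
    -- if the third side degenerates, then `c τ = ± 1` is an end point of `[A τ, B τ]`, and the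
    -- third side is `hi` or `lo`; this forces `lo = hi` to be `0` or `π`
    by_contra hX
    rw [not_lt] at hX
    have hsum : (cos θ * cos τ + sin θ * sin τ * c) ^ 2 + (cos θ * sin τ - sin θ * cos τ * c) ^ 2 =
        1 - sin θ ^ 2 * (1 - c ^ 2) := by
      have e1 := sin_sq_add_cos_sq θ
      have e2 := sin_sq_add_cos_sq τ
      linear_combination (cos θ ^ 2 + sin θ ^ 2 * c ^ 2) * e2 + e1
    have hcc : c ^ 2 = 1 := by
      have h5 : c ^ 2 ≤ 1 := by nlinarith
      have h6 : sin θ ^ 2 * (1 - c ^ 2) ≤ 0 := by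
        nlinarith [sq_nonneg (cos θ * sin τ - sin θ * cos τ * c)]
      have h7 : 0 < sin θ ^ 2 := by positivity
      nlinarith
    have hX' : (cos θ * cos τ + sin θ * sin τ * c) ^ 2 = 1 := by
      refine le_antisymm ?_ hX
      rw [hcc] at hsum
      nlinarith [sq_nonneg (cos θ * sin τ - sin θ * cos τ * c)]
    have hτ0 : 0 < sin θ * sin τ := by
      refine lt_of_le_of_ne (hdiv τ hτ) fun h => ?_
      have h5 : sin τ = 0 := by
        rcases mul_eq_zero.1 h.symm with h5 | h5
        · exact absurd h5 hs.ne'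
        · exact h5
      rw [hc, hzero τ h5] at hcc
      norm_num at hcc
    have hinj : ∀ {x y : ℝ}, 0 ≤ x → x ≤ π → 0 ≤ y → y ≤ π → cos x = cos y → x = y :=
      fun h1 h2 h3 h4 h => injOn_cos ⟨h1, h2⟩ ⟨h3, h4⟩ h
    rcases sq_eq_one_iff.1 hcc with h5 | h5
    · have h6 : A τ = 1 := by
        refine le_antisymm hA ?_
        rw [← h5, hc]
        refine max_le le_rfl ?_
        by_contra h
        rw [not_le] at h
        have : max (A τ) (min (B τ) 0) ≤ 0 := max_le (h.le.trans (min_le_right _ _)) (min_le_right _ _)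
        rw [← hc, h5] at this
        linarith
      rw [div_eq_one_iff_eq hτ0.ne'] at h6
      have h7 : cos θ * cos τ + sin θ * sin τ * c = cos hi := by rw [h5]; linarith
      have h8 : cos θ * cos τ + sin θ * sin τ = cos (θ - τ) := (cos_sub _ _).symm
      rw [h7] at hX'
      rcases sq_eq_one_iff.1 hX' with h9 | h9
      · have h10 := hinj (hlo.trans hlohi) hhi le_rfl pi_pos.le (h9.trans cos_zero.symm)
        have h11 : lo = 0 := by linarith
        rw [h10, h11, sin_zero] at hne
        simp at hne
      · have h10 : cos |θ - τ| = cos π := by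
          rw [cos_abs, ← h8, cos_pi, ← h9, ← h7, h5, mul_one]
        have h11 : |θ - τ| < π := abs_lt.2 ⟨by linarith, by linarith⟩
        exact h11.ne (hinj (abs_nonneg _) h11.le pi_pos.le le_rfl h10)
    · have h6 : B τ = -1 := by
        refine le_antisymm ?_ hB
        have h7 : min (B τ) 0 ≤ -1 := by rw [← h5, hc]; exact le_max_right _ _
        rcases min_le_iff.1 h7 with h8 | h8
        · exact h8
        · norm_num at h8
      rw [div_eq_iff hτ0.ne'] at h6
      have h7 : cos θ * cos τ + sin θ * sin τ * c = cos lo := by rw [h5]; linarith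
      have h8 : cos θ * cos τ - sin θ * sin τ = cos (θ + τ) := (cos_add _ _).symm
      rw [h7] at hX'
      rcases sq_eq_one_iff.1 hX' with h9 | h9
      · have h10 : cos (θ + τ) = 1 := by rw [← h8, ← h9, ← h7, h5]; ring
        rw [cos_eq_one_iff_of_lt_of_lt (by linarith) (by linarith)] at h10
        linarith
      · have h10 := hinj hlo (hlohi.trans hhi) pi_pos.le le_rfl (h9.trans cos_pi.symm)
        rw [h10, sin_pi] at hne
        rcases hne with h | h <;> linarith

end SU2

end

section

/-! ### Families of spherical polygons -/

namespace SU2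

open Real

theorem reachPair_nonneg {n : ℕ} {θ : Fin n → ℝ} (hθ : ∀ j, 0 ≤ θ j ∧ θ j ≤ π) :
    0 ≤ (reachPair θ).1 ∧ 0 ≤ (reachPair θ).2 ∧ π ≤ (reachPair θ).1 + (reachPair θ).2 := by
  induction n with
  | zero => simp [reachPair, pi_pos.le]
  | succ n ih =>
    obtain ⟨h1, h2, h3⟩ := ih fun j : Fin n => hθ j.castSucc
    obtain ⟨h4, h5⟩ := hθ (Fin.last n)
    simp only [reachPair]
    refine ⟨le_min ?_ ?_, le_min ?_ ?_, ?_⟩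
    · linarith
    · linarith
    · linarith
    · linarith
    · rw [min_def, min_def]
      split_ifs <;> linarith

/-- For each possible angle there is a polygon whose end point is the diagonal matrix with this
angle, and it can be chosen to depend continuously on the angle. -/
theorem exists_section {n : ℕ} {θ : Fin n → ℝ} (hθ : ∀ j, 0 ≤ θ j ∧ θ j ≤ π) :
    ∃ σ : ℝ → Fin n → SU2, ContinuousOn σ (reachSet θ) ∧
      ∀ x ∈ reachSet θ, σ x ∈ polygon θ (diag x) := by
  induction n with
  | zero =>
    refine ⟨fun _ j => j.elim0, continuousOn_const, fun x hx => ⟨fun j => j.elim0, ?_⟩⟩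
    obtain rfl : x = 0 := le_antisymm hx.2.2.1 hx.1
    rw [diag_zero]
    rfl
  | succ n ih =>
    obtain ⟨σ, hσ, hσI⟩ := ih fun j => hθ j.castSucc
    obtain ⟨h1, h2, h3⟩ := reachPair_nonneg fun j : Fin n => hθ j.castSucc
    suffices ∃ α c : ℝ → ℝ, ContinuousOn α (reachSet θ) ∧ ContinuousOn c (reachSet θ) ∧
        ∀ τ ∈ reachSet θ, α τ ∈ reachSet (fun j : Fin n => θ j.castSucc) ∧ (-1 ≤ c τ ∧ c τ ≤ 1) ∧
          cos τ * cos (α τ) + sin τ * sin (α τ) * c τ = cos (θ (Fin.last n)) by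
      obtain ⟨α, c, hα, hc, h⟩ := this
      obtain ⟨σ', hσ', h'⟩ := exists_section_step hσ hσI hα hc continuousOn_id
        (fun τ hτ => (h τ hτ).1) (fun τ hτ => (h τ hτ).2.1) (fun τ hτ => (h τ hτ).2.2)
      exact ⟨σ', hσ', fun τ hτ => (h' τ hτ).1⟩
    obtain ⟨h4, h5⟩ := hθ (Fin.last n)
    set ϑ := θ (Fin.last n) with hϑ
    rcases h4.eq_or_lt with h0 | h0
    · -- the last side is `1`
      refine ⟨id, fun _ => 1, continuousOn_id, continuousOn_const, fun τ hτ =>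
        ⟨?_, by norm_num, ?_⟩⟩
      · obtain ⟨⟨h6, h7⟩, h8, h9⟩ := mem_reachSet_succ.1 hτ
        rw [← hϑ, ← h0, abs_le] at h8 h9
        exact ⟨h6, h7, by dsimp only [id]; linarith, by dsimp only [id]; linarith⟩
      · rw [← h0, cos_zero, id]
        linear_combination sin_sq_add_cos_sq τ
    rcases h5.eq_or_lt with h0' | h0'
    · -- the last side is `-1`
      refine ⟨fun τ => π - τ, fun _ => -1, by fun_prop, continuousOn_const, fun τ hτ =>
        ⟨?_, by norm_num, ?_⟩⟩
      · obtain ⟨⟨h6, h7⟩, h8, h9⟩ := mem_reachSet_succ.1 hτ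
        rw [← hϑ, h0', abs_le] at h8 h9
        exact ⟨by linarith, by linarith, by linarith, by linarith⟩
      · rw [h0', cos_pi, cos_pi_sub, sin_pi_sub]
        linear_combination - sin_sq_add_cos_sq τ
    set lo := max 0 (π - (reachPair fun j : Fin n => θ j.castSucc).2) with hlo
    set hi := min π (reachPair fun j : Fin n => θ j.castSucc).1 with hhi
    have hI : reachSet (fun j : Fin n => θ j.castSucc) = Set.Icc lo hi := reachSet_eq_Icc _
    have hlohi : lo ≤ hi := max_le (le_min pi_pos.le h1) (le_min (by linarith) (by linarith))
    have hlo0 : 0 ≤ lo := le_max_left _ _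
    have hhipi : hi ≤ π := min_le_left _ _
    have hS : ∀ τ ∈ reachSet θ, (0 ≤ τ ∧ τ ≤ π) ∧ |ϑ - τ| ≤ hi ∧ lo ≤ π - |π - ϑ - τ| := by
      intro τ hτ
      obtain ⟨⟨h6, h7⟩, h8, h9⟩ := mem_reachSet_succ.1 hτ
      refine ⟨⟨h6, h7⟩, le_min (abs_le.2 ⟨by linarith, by linarith⟩) h8, max_le ?_ ?_⟩
      · have : |π - ϑ - τ| ≤ π := abs_le.2 ⟨by linarith, by linarith⟩
        linarith
      · linarith
    rw [hI]
    by_cases hne : lo < hi ∨ 0 < sin lo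
    · obtain ⟨c, hc, h⟩ := exists_triangle h0 h0' hlo0 hlohi hhipi hne hS
      have hX : ContinuousOn (fun τ => cos ϑ * cos τ + sin ϑ * sin τ * c τ) (reachSet θ) := by
        fun_prop
      have hsin : ∀ τ ∈ reachSet θ,
          0 < sin (arccos (cos ϑ * cos τ + sin ϑ * sin τ * c τ)) := fun τ hτ => by
        rw [sin_arccos]
        exact sqrt_pos.2 (by linarith [(h τ hτ).2.2.2])
      refine ⟨fun τ => arccos (cos ϑ * cos τ + sin ϑ * sin τ * c τ),
        fun τ => (cos ϑ * sin τ - sin ϑ * cos τ * c τ) /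
          sin (arccos (cos ϑ * cos τ + sin ϑ * sin τ * c τ)),
        continuous_arccos.comp_continuousOn hX, ?_, fun τ hτ => ?_⟩
      · refine ContinuousOn.div (by fun_prop) (continuous_sin.comp_continuousOn
          (continuous_arccos.comp_continuousOn hX)) fun τ hτ => (hsin τ hτ).ne'
      · obtain ⟨⟨h6, h7⟩, h8, h9, h10⟩ := h τ hτ
        have hpos := hsin τ hτ
        have hcos : cos (arccos (cos ϑ * cos τ + sin ϑ * sin τ * c τ)) =
            cos ϑ * cos τ + sin ϑ * sin τ * c τ :=
          cos_arccos ((neg_one_le_cos _).trans h8) (h9.trans (cos_le_one _))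
        have hsq := sin_sq_add_cos_sq (arccos (cos ϑ * cos τ + sin ϑ * sin τ * c τ))
        have e1 := sin_sq_add_cos_sq ϑ
        have e2 := sin_sq_add_cos_sq τ
        rw [hcos] at hsq
        refine ⟨⟨?_, ?_⟩, abs_le.1 ?_, ?_⟩
        · rw [← arccos_cos hlo0 (hlohi.trans hhipi)]
          exact arccos_le_arccos h9
        · rw [← arccos_cos (hlo0.trans hlohi) hhipi]
          exact arccos_le_arccos h8
        · rw [abs_div, div_le_one (abs_pos.2 hpos.ne')]
          refine sq_le_sq.1 ?_
          have h11 : sin ϑ ^ 2 * c τ ^ 2 ≤ sin ϑ ^ 2 :=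
            mul_le_of_le_one_right (sq_nonneg _) (by nlinarith)
          linear_combination h11 - hsq + e1 + (cos ϑ ^ 2 + sin ϑ ^ 2 * c τ ^ 2) * e2
        · rw [hcos, mul_assoc (sin τ), mul_div_cancel₀ _ hpos.ne']
          linear_combination cos ϑ * e2
    · -- the product of the other sides is `1` or `-1`
      rw [not_or, not_lt, not_lt] at hne
      have hlh : lo = hi := le_antisymm hlohi hne.1
      refine ⟨fun _ => lo, fun _ => 0, continuousOn_const, continuousOn_const, fun τ hτ =>
        ⟨⟨le_rfl, hlohi⟩, by norm_num, ?_⟩⟩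
      obtain ⟨⟨h6, h7⟩, h8, h9⟩ := hS τ hτ
      rw [mul_zero, add_zero]
      rcases hlo0.eq_or_lt with h10 | h10
      · rw [← hlh, ← h10] at h8
        rw [← h10, cos_zero, mul_one, sub_eq_zero.1 (abs_nonpos_iff.1 h8)]
      · obtain h11 : lo = π := by
          by_contra h
          exact hne.2.not_gt (sin_pos_of_pos_of_lt_pi h10 (lt_of_le_of_ne (hlohi.trans hhipi) h))
        rw [h11] at h9
        have h12 : τ = π - ϑ := by
          have := abs_nonpos_iff.1 (by linarith : |π - ϑ - τ| ≤ 0)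
          linarith
        rw [h11, h12, cos_pi, cos_pi_sub]
        ring

end SU2

end

section

/-! ### Path connectedness of the spaces of polygons -/

namespace SU2

open Real

/-- The triangle inequalities for spherical triangles. -/
theorem abs_sub_le {g u : SU2} {θ α τ : ℝ} (hθ : 0 ≤ θ ∧ θ ≤ π) (hα : 0 ≤ α ∧ α ≤ π)
    (hτ : 0 ≤ τ ∧ τ ≤ π) (h1 : half g = cos θ) (h2 : half u = cos α) (h3 : half (g * u) = cos τ) :
    |θ - τ| ≤ α ∧ |π - θ - τ| ≤ π - α := by
  obtain ⟨k, rfl⟩ := exists_conj_diag g h1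
  set v := k⁻¹ * (k * diag θ * k⁻¹ * u) * k with hv
  have hvτ : half v = cos τ := by
    rw [← h3, hv]
    have := half_conj k⁻¹ (k * diag θ * k⁻¹ * u)
    rwa [inv_inv] at this
  have huα : half (diag (-θ) * v) = cos α := by
    rw [← h2, ← half_conj k⁻¹ u, hv, diag_neg]
    congr 1
    group
  have hn := norm_sq v
  rw [Complex.normSq_apply, ← half, hvτ] at hn
  have hsτ := sin_nonneg_of_nonneg_of_le_pi hτ.1 hτ.2
  have hsθ := sin_nonneg_of_nonneg_of_le_pi hθ.1 hθ.2
  have him : |(a v).im| ≤ sin τ := by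
    rw [← abs_of_nonneg hsτ]
    refine sq_le_sq.1 ?_
    nlinarith [Complex.normSq_nonneg (b v), sin_sq_add_cos_sq τ]
  rw [abs_le] at him
  have hcα : cos α = cos θ * cos τ + sin θ * (a v).im := by
    rw [← huα, half, a_mul, a_diag, b_diag, coe_exp_eq, ← hvτ, half, cos_neg, sin_neg]
    simp
  have hanti : ∀ {x y : ℝ}, 0 ≤ y → x ≤ π → cos y ≤ cos x → x ≤ y := fun hy hx h => by
    by_contra hlt
    exact (cos_lt_cos_of_nonneg_of_le_pi hy hx (not_le.1 hlt)).not_ge h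
  constructor
  · refine hanti hα.1 (abs_le.2 ⟨by linarith, by linarith⟩) ?_
    rw [cos_abs, cos_sub]
    nlinarith
  · refine hanti (by linarith) (abs_le.2 ⟨by linarith, by linarith⟩) ?_
    rw [cos_abs, cos_pi_sub, show π - θ - τ = π - (θ + τ) by ring, cos_pi_sub, cos_add]
    nlinarith

/-- The angle of the product of elements with given angles. -/
theorem arccos_half_mem_reachSet {n : ℕ} {θ : Fin n → ℝ} (hθ : ∀ j, 0 ≤ θ j ∧ θ j ≤ π)
    {g : Fin n → SU2} (hg : ∀ j, half (g j) = cos (θ j)) :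
    arccos (half (revProd g)) ∈ reachSet θ := by
  induction n with
  | zero => simp [revProd_zero, reachSet, reachPair, pi_pos.le]
  | succ n ih =>
    have h1 := ih (fun j => hθ j.castSucc) (fun j => hg j.castSucc)
    have h2 : ∀ u : SU2, half u = cos (arccos (half u)) := fun u =>
      (cos_arccos (half_mem u).1 (half_mem u).2).symm
    have h3 : ∀ u : SU2, 0 ≤ arccos (half u) ∧ arccos (half u) ≤ π := fun u =>
      ⟨arccos_nonneg _, arccos_le_pi _⟩
    have h4 := abs_sub_le (hθ (Fin.last n)) (h3 (revProd fun i : Fin n => g i.castSucc))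
      (h3 (revProd g)) (hg _) (h2 _) (h2 _)
    exact mem_reachSet_succ.2 ⟨h3 _, h4.1.trans h1.2.2.1, h4.2.trans h1.2.2.2⟩

theorem joinedIn_image {X Y : Type*} [TopologicalSpace X] [TopologicalSpace Y] {S : Set X}
    {T : Set Y} {x y : X} (h : JoinedIn S x y) {f : X → Y} (hf : Continuous f)
    (hST : ∀ x ∈ S, f x ∈ T) : JoinedIn T (f x) (f y) := by
  obtain ⟨γ, hγ⟩ := h
  exact ⟨γ.map hf, fun t => hST _ (hγ t)⟩

theorem joined_one (g : SU2) : Joined 1 g := by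
  obtain ⟨k, hk⟩ := exists_conj_diag g (cos_arccos (half_mem g).1 (half_mem g).2).symm
  refine ⟨⟨⟨fun t => k * diag (t * arccos (half g)) * k⁻¹, ?_⟩, ?_, ?_⟩⟩
  · exact (continuous_const.mul (continuous_diag.comp (by fun_prop))).mul continuous_const
  · simp [diag_zero]
  · simpa using hk.symm

/-- Conjugating a polygon along a path in the centralizer of its end point. -/
theorem joinedIn_conj {n : ℕ} {θ : Fin n → ℝ} {t : SU2} {g : Fin n → SU2} (hg : g ∈ polygon θ t)
    {k : SU2} (γ : Path 1 k) (hγ : ∀ s, γ s * t * (γ s)⁻¹ = t) :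
    JoinedIn (polygon θ t) g (fun j => k * g j * k⁻¹) := by
  refine ⟨⟨⟨fun s j => γ s * g j * (γ s)⁻¹, ?_⟩, ?_, ?_⟩, fun s => ?_⟩
  · exact continuous_pi fun j => (γ.continuous.mul continuous_const).mul γ.continuous.inv
  · simp
  · simp
  · have := conj_mem_polygon (γ s) hg
    rwa [hγ] at this

/-- Polygons with the same last side are joined if the remaining polygons are. -/
theorem joinedIn_of_last {n : ℕ} {θ : Fin (n + 1) → ℝ} {t : SU2}
    (ih : ∀ t, ∀ g ∈ polygon (fun j : Fin n => θ j.castSucc) t,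
      ∀ h ∈ polygon (fun j : Fin n => θ j.castSucc) t,
      JoinedIn (polygon (fun j : Fin n => θ j.castSucc) t) g h)
    {g h : Fin (n + 1) → SU2} (hg : g ∈ polygon θ t) (hh : h ∈ polygon θ t)
    (hgh : g (Fin.last n) = h (Fin.last n)) : JoinedIn (polygon θ t) g h := by
  have h1 := init_mem_polygon hg
  have h2 := init_mem_polygon hh
  rw [← hgh] at h2
  have h3 := joinedIn_image (T := polygon θ t) (ih _ _ h1 _ h2)
    (f := fun x => (Fin.snoc x (g (Fin.last n)) : Fin (n + 1) → SU2)) ?_ fun x hx =>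
      snoc_mem_polygon hx (hg.1 _) (mul_inv_cancel_left _ _)
  · convert h3 using 1
    · exact (Fin.snoc_init_self g).symm
    · rw [hgh]
      exact (Fin.snoc_init_self h).symm
  · refine continuous_pi fun j => ?_
    refine Fin.lastCases ?_ (fun i => ?_) j
    · simp only [Fin.snoc_last]
      exact continuous_const
    · simp only [Fin.snoc_castSucc]
      exact continuous_apply i

/-- The cosine of the angle between the sides `α` and `τ` of a spherical triangle with sides `α`,
`τ`, `θ` depends continuously on `α`. Where the triangle degenerates, the limit is zero, in
accordance with the value of the division by zero. -/
theorem continuousOn_angle {θ τ : ℝ} (hτ : 0 < sin τ) {S : Set ℝ}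
    (hS : ∀ α ∈ S, (0 ≤ α ∧ α ≤ π) ∧ |θ - τ| ≤ α ∧ |π - θ - τ| ≤ π - α) :
    ContinuousOn (fun α => (cos θ - cos τ * cos α) / (sin τ * sin α)) S := by
  intro α hα
  obtain ⟨⟨h1, h2⟩, h3, h4⟩ := hS α hα
  by_cases h0 : sin α = 0
  · rcases h1.eq_or_lt with h5 | h5
    · subst h5
      have h6 : θ = τ := sub_eq_zero.1 (abs_nonpos_iff.1 h3)
      have h7 : ContinuousAt (fun α => cos τ * sin α / (sin τ * (1 + cos α))) 0 := by
        refine ContinuousAt.div (by fun_prop) (by fun_prop) ?_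
        rw [cos_zero]
        positivity
      have h8 : ∀ x, (cos θ - cos τ * cos x) / (sin τ * sin x) =
          cos τ * sin x / (sin τ * (1 + cos x)) := by
        intro x
        by_cases hsx : sin x = 0
        · simp [hsx]
        · have h9 : 1 + cos x ≠ 0 := by
            intro h
            apply hsx
            have := sin_sq_add_cos_sq x
            rw [show cos x = -1 by linarith] at this
            nlinarith
          rw [div_eq_div_iff (mul_ne_zero hτ.ne' hsx) (mul_ne_zero hτ.ne' h9), h6]
          linear_combination - cos τ * sin τ * sin_sq_add_cos_sq x
      simp only [h8]
      exact h7.continuousWithinAt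
    · obtain rfl : α = π := by
        by_contra h
        exact (sin_pos_of_pos_of_lt_pi h5 (lt_of_le_of_ne h2 h)).ne' h0
      have h6 : θ = π - τ := by
        rw [sub_self, abs_nonpos_iff] at h4
        linarith
      have h7 : ContinuousAt (fun α => - cos τ * sin α / (sin τ * (1 - cos α))) π := by
        refine ContinuousAt.div (by fun_prop) (by fun_prop) ?_
        rw [cos_pi]
        exact mul_ne_zero hτ.ne' (by norm_num)
      have h8 : ∀ x, (cos θ - cos τ * cos x) / (sin τ * sin x) =
          - cos τ * sin x / (sin τ * (1 - cos x)) := by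
        intro x
        by_cases hsx : sin x = 0
        · simp [hsx]
        · have h9 : 1 - cos x ≠ 0 := by
            intro h
            apply hsx
            have := sin_sq_add_cos_sq x
            rw [show cos x = 1 by linarith] at this
            nlinarith
          rw [div_eq_div_iff (mul_ne_zero hτ.ne' hsx) (mul_ne_zero hτ.ne' h9), h6, cos_pi_sub]
          linear_combination cos τ * sin τ * sin_sq_add_cos_sq x
      simp only [h8]
      exact h7.continuousWithinAt
  · exact (ContinuousAt.div (f := fun α => cos θ - cos τ * cos α)
      (g := fun α => sin τ * sin α) (by fun_prop) (by fun_prop)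
      (mul_ne_zero hτ.ne' h0)).continuousWithinAt

/-- Polygons with the same angle between the origin and the next to last vertex are joined. -/
theorem joinedIn_of_half_eq {n : ℕ} {θ : Fin (n + 1) → ℝ} {τ : ℝ} (hτ : 0 < sin τ)
    (ih : ∀ t, ∀ g ∈ polygon (fun j : Fin n => θ j.castSucc) t,
      ∀ h ∈ polygon (fun j : Fin n => θ j.castSucc) t,
      JoinedIn (polygon (fun j : Fin n => θ j.castSucc) t) g h)
    {g h : Fin (n + 1) → SU2} (hg : g ∈ polygon θ (diag τ)) (hh : h ∈ polygon θ (diag τ))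
    (hgh : half (revProd fun j : Fin n => g j.castSucc) =
      half (revProd fun j : Fin n => h j.castSucc)) : JoinedIn (polygon θ (diag τ)) g h := by
  have him : ∀ f ∈ polygon θ (diag τ), cos (θ (Fin.last n)) =
      cos τ * half (revProd fun j : Fin n => f j.castSucc) +
      sin τ * (a (revProd fun j : Fin n => f j.castSucc)).im := by
    intro f hf
    rw [← hf.1, (init_mem_polygon hf).2]
    have : f (Fin.last n) = diag τ * ((f (Fin.last n))⁻¹ * diag τ)⁻¹ := by group
    conv_lhs => rw [this]
    rw [half, a_mul, b_diag, a_diag, coe_exp_eq, half, a_inv]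
    simp
    ring
  have ha : a (revProd fun j : Fin n => g j.castSucc) =
      a (revProd fun j : Fin n => h j.castSucc) := by
    refine Complex.ext hgh ?_
    have h1 := him g hg
    rw [him h hh, hgh] at h1
    exact (mul_left_cancel₀ hτ.ne' (add_left_cancel h1)).symm
  obtain ⟨δ, hδ⟩ := exists_diag_conj ha
  let γ : Path 1 (diag δ) := ⟨⟨fun s => diag (s * δ), continuous_diag.comp (by fun_prop)⟩,
    by simp [diag_zero], by simp⟩
  have h1 := joinedIn_conj hg γ fun s => by
    change diag (s * δ) * diag τ * (diag (s * δ))⁻¹ = diag τ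
    rw [← diag_add, add_comm, diag_add, mul_inv_cancel_right]
  refine h1.trans (joinedIn_of_last ih h1.target_mem hh ?_)
  have h2 := map_revProd (MulAut.conj (diag δ)).toMonoidHom fun j : Fin n => g j.castSucc
  have h3 : (revProd fun i : Fin n => diag δ * g i.castSucc * (diag δ)⁻¹) =
      revProd fun j : Fin n => h j.castSucc := h2.symm.trans hδ
  have h4 := h1.target_mem.2
  rw [revProd_succ, h3, ← hh.2, revProd_succ] at h4
  exact mul_right_cancel h4

/-- The spaces of spherical polygons are path connected. -/
theorem joinedIn_polygon {n : ℕ} {θ : Fin n → ℝ} (hθ : ∀ j, 0 ≤ θ j ∧ θ j ≤ π) (t : SU2)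
    {g h : Fin n → SU2} (hg : g ∈ polygon θ t) (hh : h ∈ polygon θ t) :
    JoinedIn (polygon θ t) g h := by
  induction n generalizing t with
  | zero =>
    rw [Subsingleton.elim h g]
    exact JoinedIn.refl hg
  | succ n ih =>
    have ih' : ∀ t, ∀ g ∈ polygon (fun j : Fin n => θ j.castSucc) t,
        ∀ h ∈ polygon (fun j : Fin n => θ j.castSucc) t,
        JoinedIn (polygon (fun j : Fin n => θ j.castSucc) t) g h :=
      fun t g hg h hh => ih (fun j => hθ j.castSucc) t hg hh
    suffices H : ∀ τ, 0 ≤ τ → τ ≤ π → ∀ g ∈ polygon θ (diag τ), ∀ h ∈ polygon θ (diag τ),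
        JoinedIn (polygon θ (diag τ)) g h by
      obtain ⟨k, hk⟩ := exists_conj_diag t (cos_arccos (half_mem t).1 (half_mem t).2).symm
      have hk' : k⁻¹ * t * k⁻¹⁻¹ = diag (arccos (half t)) := by
        conv_lhs => rw [hk]
        group
      have hg' := conj_mem_polygon k⁻¹ hg
      have hh' := conj_mem_polygon k⁻¹ hh
      rw [hk'] at hg' hh'
      have := joinedIn_image (T := polygon θ t)
        (H _ (arccos_nonneg _) (arccos_le_pi _) _ hg' _ hh')
        (f := fun x j => k * x j * k⁻¹)
        (continuous_pi fun j => (continuous_const.mul (continuous_apply j)).mul continuous_const)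
        fun x hx => by
          have := conj_mem_polygon k hx
          rwa [← hk] at this
      convert this using 1 <;> ext j : 1 <;> group
    intro τ hτ0 hτπ g hg h hh
    rcases (sin_nonneg_of_nonneg_of_le_pi hτ0 hτπ).eq_or_lt with h0 | h0
    · -- the end point is central, so the last side can be rotated to a fixed position.
      have hc : ∀ x : SU2, x * diag τ * x⁻¹ = diag τ := by
        intro x
        rw [mul_inv_eq_iff_eq_mul]
        refine ext_ab ?_ ?_
        · simp only [a_mul, b_diag, map_zero, mul_zero, zero_mul, sub_zero]
          exact mul_comm _ _
        · simp only [b_mul, b_diag, a_diag, mul_zero, zero_mul, zero_add, add_zero, coe_exp_eq, ← h0]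
          rw [mul_comm]
          congr 1
          exact Complex.ext rfl neg_zero
      have hl : ∀ f ∈ polygon θ (diag τ), ∃ f' ∈ polygon θ (diag τ),
          f' (Fin.last n) = diag (θ (Fin.last n)) ∧ JoinedIn (polygon θ (diag τ)) f f' := by
        intro f hf
        obtain ⟨k, hk⟩ := exists_conj_diag _ (hf.1 (Fin.last n))
        have := joinedIn_conj hf (joined_one k⁻¹).somePath fun s => hc _
        refine ⟨_, this.target_mem, ?_, this⟩
        conv_lhs => rw [hk]
        group
      obtain ⟨g', hg', hg1, hg2⟩ := hl g hg
      obtain ⟨h', hh', hh1, hh2⟩ := hl h hh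
      exact (hg2.trans (joinedIn_of_last ih' hg' hh' (hg1.trans hh1.symm))).trans hh2.symm
    · -- the angle of the next to last vertex ranges over an interval `S`; over `S` there is a
      -- continuous family of polygons, and each polygon is joined to the member with its angle
      obtain ⟨σ, hσ, hσI⟩ := exists_section fun j : Fin n => hθ j.castSucc
      let S : Set ℝ := reachSet (fun j : Fin n => θ j.castSucc) ∩
        {α | |θ (Fin.last n) - τ| ≤ α ∧ |π - θ (Fin.last n) - τ| ≤ π - α}
      have hS : ∀ α ∈ S, (0 ≤ α ∧ α ≤ π) ∧ |θ (Fin.last n) - τ| ≤ α ∧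
        |π - θ (Fin.last n) - τ| ≤ π - α := fun α hα => ⟨⟨hα.1.1, hα.1.2.1⟩, hα.2⟩
      have hconv : Convex ℝ S := by
        have : S = reachSet (fun j : Fin n => θ j.castSucc) ∩
            Set.Icc |θ (Fin.last n) - τ| (π - |π - θ (Fin.last n) - τ|) := by
          ext α
          exact and_congr_right fun _ => and_congr_right fun _ => le_sub_comm
        rw [this, reachSet_eq_Icc]
        exact (convex_Icc _ _).inter (convex_Icc _ _)
      have hsum : ∀ α ∈ S, cos (τ + α) ≤ cos (θ (Fin.last n)) ∧
          cos (θ (Fin.last n)) ≤ cos (τ - α) := by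
        intro α hα
        obtain ⟨⟨h1, h2⟩, h3, h4⟩ := hS α hα
        obtain ⟨h5, h6⟩ := hθ (Fin.last n)
        rw [abs_le] at h3 h4
        constructor
        · have h7 : |π - τ - α| ≤ π - θ (Fin.last n) :=
            abs_le.2 ⟨by linarith, by linarith⟩
          have h8 := cos_le_cos_of_nonneg_of_le_pi (abs_nonneg _) (by linarith) h7
          rw [cos_abs, cos_pi_sub, show π - τ - α = π - (τ + α) by ring, cos_pi_sub] at h8
          linarith
        · rw [← cos_abs (τ - α)]
          exact cos_le_cos_of_nonneg_of_le_pi (abs_nonneg _) h6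
            (abs_le.2 ⟨by linarith, by linarith⟩)
      obtain ⟨σ', hσ', h'⟩ := exists_section_step hσ hσI continuousOn_id
        (continuousOn_angle h0 hS) (continuousOn_const (c := τ)) (fun α hα => hα.1)
        (fun α hα => by
          have h1 := hsum α hα
          rw [cos_add, cos_sub] at h1
          have h2 : 0 ≤ sin τ * sin α :=
            mul_nonneg h0.le (sin_nonneg_of_nonneg_of_le_pi (hS α hα).1.1 (hS α hα).1.2)
          constructor
          · rcases h2.eq_or_lt with h3 | h3
            · rw [← h3, div_zero]
              norm_num
            · rw [le_div_iff₀ h3]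
              linarith
          · exact div_le_one_of_le₀ (by linarith) h2)
        (fun α hα => by
          have h1 := hsum α hα
          rw [cos_add, cos_sub] at h1
          dsimp only [id]
          by_cases h2 : sin τ * sin α = 0
          · rw [h2] at h1 ⊢
            linarith
          · rw [mul_div_cancel₀ _ h2]
            ring)
      have hmem : ∀ f ∈ polygon θ (diag τ),
          arccos (half (revProd fun j : Fin n => f j.castSucc)) ∈ S ∧
          JoinedIn (polygon θ (diag τ)) f
            (σ' (arccos (half (revProd fun j : Fin n => f j.castSucc)))) := by
        intro f hf
        have h1 : arccos (half (revProd fun j : Fin n => f j.castSucc)) ∈ S := by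
          refine ⟨arccos_half_mem_reachSet (fun j => hθ j.castSucc) fun j => hf.1 _, ?_⟩
          refine abs_sub_le (g := f (Fin.last n)) (u := revProd fun j : Fin n => f j.castSucc)
            (hθ _) ⟨arccos_nonneg _, arccos_le_pi _⟩ ⟨hτ0, hτπ⟩ (hf.1 _)
            (cos_arccos (half_mem _).1 (half_mem _).2).symm ?_
          rw [← revProd_succ, hf.2, half_diag]
        refine ⟨h1, joinedIn_of_half_eq h0 ih' hf (h' _ h1).1 ?_⟩
        rw [(h' _ h1).2, id, cos_arccos (half_mem _).1 (half_mem _).2]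
      have h1 := (hconv.isPathConnected ⟨_, (hmem g hg).1⟩).image' hσ'
      have h2 := (h1.joinedIn _ ⟨_, (hmem g hg).1, rfl⟩ _ ⟨_, (hmem h hh).1, rfl⟩).mono
        (show σ' '' S ⊆ polygon θ (diag τ) by
          rintro _ ⟨α, hα, rfl⟩
          exact (h' α hα).1)
      exact ((hmem g hg).2.trans h2).trans (hmem h hh).2.symm

end SU2

end

section

/-! ### The polygon inequalities -/

namespace SU2

open Real

/-- The sum of the angles `θ j`, those for which `ε j` is true being replaced by their supplements.
-/
noncomputable def signedSum {n : ℕ} (θ : Fin n → ℝ) (ε : Fin n → Bool) : ℝ :=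
  ∑ j, if ε j then π - θ j else θ j

theorem signedSum_snoc {n : ℕ} (θ : Fin (n + 1) → ℝ) (ε : Fin n → Bool) (x : Bool) :
    signedSum θ (Fin.snoc ε x : Fin (n + 1) → Bool) = signedSum (fun j : Fin n => θ j.castSucc) ε +
      if x then π - θ (Fin.last n) else θ (Fin.last n) := by
  simp [signedSum, Fin.sum_univ_castSucc]

theorem sum_toNat_snoc {n : ℕ} (ε : Fin n → Bool) (x : Bool) :
    ∑ j, ((Fin.snoc ε x : Fin (n + 1) → Bool) j).toNat = ∑ j, (ε j).toNat + x.toNat := by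
  simp [Fin.sum_univ_castSucc]

/-- The recursive bounds of `reachPair` are minima of signed sums: `reachPair_le` and `le_reachPair`
are the two inequalities. The signs with an even number of supplements belong to the product, those
with an odd number to its negative. -/
theorem reachPair_le {n : ℕ} (θ : Fin n → ℝ) (ε : Fin n → Bool) :
    (Even (∑ j, (ε j).toNat) → (reachPair θ).1 ≤ signedSum θ ε) ∧
      (Odd (∑ j, (ε j).toNat) → (reachPair θ).2 ≤ signedSum θ ε) := by
  induction n with
  | zero => simp [reachPair, signedSum]
  | succ n ih =>
    obtain ⟨h1, h2⟩ := ih (fun j => θ j.castSucc) (fun j => ε j.castSucc)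
    have hε : ε = (Fin.snoc (fun j : Fin n => ε j.castSucc) (ε (Fin.last n)) : Fin (n + 1) → Bool) :=
      (Fin.snoc_init_self ε).symm
    rw [hε, sum_toNat_snoc, signedSum_snoc]
    simp only [reachPair]
    cases ε (Fin.last n)
    · simp only [Bool.toNat_false, add_zero, Bool.false_eq_true, if_false]
      exact ⟨fun h => (min_le_left _ _).trans (by linarith [h1 h]),
        fun h => (min_le_left _ _).trans (by linarith [h2 h])⟩
    · simp only [Bool.toNat_true, if_true]
      refine ⟨fun h => (min_le_right _ _).trans ?_, fun h => (min_le_right _ _).trans ?_⟩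
      · have := h2 (Nat.not_even_iff_odd.1 fun h' => (Nat.even_add_one.1 h) h')
        linarith
      · have := h1 (Nat.not_odd_iff_even.1 fun h' => (Nat.odd_add_one.1 h) h')
        linarith

theorem le_reachPair {n : ℕ} {θ : Fin n → ℝ} (hθ : ∀ j, 0 ≤ θ j ∧ θ j ≤ π) {x : ℝ} (hx : x ≤ π) :
    ((∀ ε : Fin n → Bool, Even (∑ j, (ε j).toNat) → x ≤ signedSum θ ε) → x ≤ (reachPair θ).1) ∧
      ((∀ ε : Fin n → Bool, Odd (∑ j, (ε j).toNat) → x ≤ signedSum θ ε) →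
        x ≤ (reachPair θ).2) := by
  induction n generalizing x with
  | zero =>
    refine ⟨fun h => ?_, fun _ => hx⟩
    simpa [reachPair, signedSum] using h fun j => j.elim0
  | succ n ih =>
    obtain ⟨h4, h5⟩ := hθ (Fin.last n)
    have h6 := ih (fun j => hθ j.castSucc) (x := x - θ (Fin.last n)) (by linarith)
    have h7 := ih (fun j => hθ j.castSucc) (x := x - (π - θ (Fin.last n))) (by linarith)
    simp only [reachPair]
    refine ⟨fun h => le_min ?_ ?_, fun h => le_min ?_ ?_⟩
    · refine sub_le_iff_le_add'.1 (h6.1 fun ε hε => ?_)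
      have := h (Fin.snoc ε false) (by rw [sum_toNat_snoc]; exact hε)
      rw [signedSum_snoc] at this
      simp only [Bool.false_eq_true, if_false] at this
      linarith
    · refine sub_le_iff_le_add'.1 (h7.2 fun ε hε => ?_)
      have := h (Fin.snoc ε true) (by rw [sum_toNat_snoc]; exact hε.add_one)
      rw [signedSum_snoc] at this
      simp only [if_true] at this
      linarith
    · refine sub_le_iff_le_add'.1 (h6.2 fun ε hε => ?_)
      have := h (Fin.snoc ε false) (by rw [sum_toNat_snoc]; exact hε)
      rw [signedSum_snoc] at this
      simp only [Bool.false_eq_true, if_false] at this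
      linarith
    · refine sub_le_iff_le_add'.1 (h7.1 fun ε hε => ?_)
      have := h (Fin.snoc ε true) (by rw [sum_toNat_snoc]; exact hε.add_one)
      rw [signedSum_snoc] at this
      simp only [if_true] at this
      linarith

theorem sum_toNat_eq {n : ℕ} (J : Finset (Fin n)) :
    ∑ j, (decide (j ∈ J)).toNat = J.card := by
  simp [Bool.toNat, Bool.cond_decide]

theorem signedSum_eq {n : ℕ} (θ : Fin n → ℝ) (J : Finset (Fin n)) :
    signedSum θ (fun j => decide (j ∈ J)) = ∑ j ∈ J, (π - θ j) + ∑ j ∈ Jᶜ, θ j := by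
  rw [signedSum, ← Finset.sum_add_sum_compl J]
  congr 1
  · exact Finset.sum_congr rfl fun j hj => by simp [hj]
  · exact Finset.sum_congr rfl fun j hj => by simp [Finset.mem_compl.1 hj]

/-- Closed spherical polygons with prescribed sides exist if and only if the sides satisfy the
polygon inequalities. -/
theorem polygon_one_nonempty_iff {n : ℕ} {θ : Fin n → ℝ} (hθ : ∀ j, 0 ≤ θ j ∧ θ j ≤ π) :
    (polygon θ 1).Nonempty ↔
      ∀ J : Finset (Fin n), Odd J.card → π ≤ ∑ j ∈ J, (π - θ j) + ∑ j ∈ Jᶜ, θ j := by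
  constructor
  · rintro ⟨g, hg1, hg2⟩ J hJ
    have h := arccos_half_mem_reachSet hθ hg1
    rw [hg2, half_one, arccos_one] at h
    rw [← signedSum_eq]
    have h1 := (reachPair_le θ fun j => decide (j ∈ J)).2 (by rwa [sum_toNat_eq])
    linarith [h.2.2.2]
  · intro h
    obtain ⟨σ, -, hσ⟩ := exists_section hθ
    have h1 := (le_reachPair hθ le_rfl).2 fun ε hε => ?_
    · refine ⟨σ 0, ?_⟩
      rw [← diag_zero]
      exact hσ 0 ⟨le_rfl, pi_pos.le, (reachPair_nonneg hθ).1, by linarith⟩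
    · have h2 : ε = fun j => decide (j ∈ Finset.univ.filter fun j => ε j = true) := by
        ext j
        simp
      rw [h2] at hε ⊢
      rw [sum_toNat_eq] at hε
      rw [signedSum_eq]
      exact h _ hε

end SU2

end

section

/-! ### Irreducible representations -/

namespace SU2

open ComplexConjugate

theorem mulVec_zero (g : SU2) (w : Fin 2 → ℂ) :
    ((g : Matrix (Fin 2) (Fin 2) ℂ) *ᵥ w) 0 = a g * w 0 + b g * w 1 := by
  rw [coe_eq]
  simp [Matrix.mulVec, dotProduct, Fin.sum_univ_two]

theorem mulVec_one (g : SU2) (w : Fin 2 → ℂ) :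
    ((g : Matrix (Fin 2) (Fin 2) ℂ) *ᵥ w) 1 = - conj (b g) * w 0 + conj (a g) * w 1 := by
  rw [coe_eq]
  simp [Matrix.mulVec, dotProduct, Fin.sum_univ_two]

theorem coe_mul_mulVec (g h : SU2) (w : Fin 2 → ℂ) :
    ((g * h : SU2) : Matrix (Fin 2) (Fin 2) ℂ) *ᵥ w =
      (g : Matrix (Fin 2) (Fin 2) ℂ) *ᵥ ((h : Matrix (Fin 2) (Fin 2) ℂ) *ᵥ w) :=
  (Matrix.mulVec_mulVec w _ _).symm

/-- An eigenvalue of an element of `SU(2)` is determined by its half trace. -/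
theorem eigenvalue_eq {g : SU2} {w : Fin 2 → ℂ} (hw : w ≠ 0) {c : ℂ} {θ : ℝ}
    (h : (g : Matrix (Fin 2) (Fin 2) ℂ) *ᵥ w = c • w) (hg : half g = Real.cos θ) :
    c = Circle.exp θ ∨ c = Circle.exp (-θ) := by
  obtain ⟨k, rfl⟩ := exists_conj_diag g hg
  set v := ((k⁻¹ : SU2) : Matrix (Fin 2) (Fin 2) ℂ) *ᵥ w with hv
  have h1 : (diag θ : Matrix (Fin 2) (Fin 2) ℂ) *ᵥ v = c • v := by
    rw [hv, ← Matrix.mulVec_smul, ← h, ← coe_mul_mulVec, ← coe_mul_mulVec]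
    congr 2
    group
  have hv0 : v ≠ 0 := by
    intro h0
    apply hw
    have : (k : Matrix (Fin 2) (Fin 2) ℂ) *ᵥ v = w := by
      rw [hv, ← coe_mul_mulVec, mul_inv_cancel]
      exact Matrix.one_mulVec w
    rw [← this, h0, Matrix.mulVec_zero]
  have h2 := congrFun h1 0
  have h3 := congrFun h1 1
  rw [mulVec_zero, b_diag, zero_mul, add_zero, a_diag, Pi.smul_apply, smul_eq_mul] at h2
  rw [mulVec_one, b_diag, map_zero, neg_zero, zero_mul, zero_add, a_diag, Pi.smul_apply,
    smul_eq_mul, ← Circle.coe_inv_eq_conj, ← Circle.exp_neg] at h3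
  by_cases h4 : v 0 = 0
  · right
    refine (mul_right_cancel₀ (fun h5 => hv0 ?_) h3).symm
    ext i
    fin_cases i
    · exact h4
    · exact h5
  · exact Or.inl (mul_right_cancel₀ h4 h2).symm

theorem half_sq_eq_one_iff (g : SU2) : half g ^ 2 = 1 ↔ b g = 0 ∧ (a g).im = 0 := by
  have h := norm_sq g
  rw [Complex.normSq_apply, ← half] at h
  have h1 := Complex.normSq_nonneg (b g)
  have h2 := mul_self_nonneg (a g).im
  constructor
  · intro h3
    have h4 : Complex.normSq (b g) = 0 := by nlinarith
    have h5 : (a g).im * (a g).im = 0 := by nlinarith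
    exact ⟨Complex.normSq_eq_zero.1 h4, mul_self_eq_zero.1 h5⟩
  · rintro ⟨h3, h4⟩
    rw [h3, h4, map_zero] at h
    linarith

variable {Y : Type} [TopologicalSpace Y] {y : Y}

/-- Schur's lemma. -/
theorem half_sq_eq_one_of_commute {ρ : HolRep Y y} (hρ : ρ.IsIrreducible) {g : SU2}
    (hg : ∀ γ, Commute g (ρ γ)) : half g ^ 2 = 1 := by
  obtain ⟨c, hc⟩ := Module.End.exists_eigenvalue (Matrix.toLin' (g : Matrix (Fin 2) (Fin 2) ℂ))
  have h1 := hρ (Module.End.eigenspace (Matrix.toLin' (g : Matrix (Fin 2) (Fin 2) ℂ)) c) ?_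
  · rcases h1 with h1 | h1
    · exact absurd h1 hc
    · have h2 : ∀ w : Fin 2 → ℂ, (g : Matrix (Fin 2) (Fin 2) ℂ) *ᵥ w = c • w := fun w => by
        have : w ∈ Module.End.eigenspace (Matrix.toLin' (g : Matrix (Fin 2) (Fin 2) ℂ)) c := by
          rw [h1]; trivial
        simpa using Module.End.mem_eigenspace_iff.1 this
      have h3 := congrFun (h2 ![0, 1]) 0
      have h4 := congrFun (h2 ![0, 1]) 1
      have h5 := congrFun (h2 ![1, 0]) 0
      rw [mulVec_zero] at h3 h5
      rw [mulVec_one] at h4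
      simp at h3 h4 h5
      refine (half_sq_eq_one_iff g).2 ⟨h3, Complex.conj_eq_iff_im.1 (h4.trans h5.symm)⟩
  · intro γ w hw
    rw [Module.End.mem_eigenspace_iff, Matrix.toLin'_apply] at hw ⊢
    rw [← coe_mul_mulVec, (hg γ).eq, coe_mul_mulVec, hw, Matrix.mulVec_smul]

/-- A representation is irreducible if and only if there is no common eigenvector. -/
theorem isIrreducible_iff {ρ : HolRep Y y} : ρ.IsIrreducible ↔
    ∀ w : Fin 2 → ℂ, (∀ γ, ∃ c : ℂ, (ρ γ : Matrix (Fin 2) (Fin 2) ℂ) *ᵥ w = c • w) → w = 0 := by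
  constructor
  · intro h w hw
    by_contra hw0
    have h0 := h (Submodule.span ℂ {w}) fun γ v hv => ?_
    · rcases h0 with h1 | h1
      · exact hw0 (Submodule.span_singleton_eq_bot.1 h1)
      · have h2 := finrank_span_singleton (K := ℂ) hw0
        rw [h1, finrank_top] at h2
        simp at h2
    · obtain ⟨d, rfl⟩ := Submodule.mem_span_singleton.1 hv
      obtain ⟨c, hc⟩ := hw γ
      rw [Matrix.mulVec_smul, hc]
      exact Submodule.smul_mem _ _ (Submodule.smul_mem _ _ (Submodule.mem_span_singleton_self w))
  · intro h W hW
    by_contra! hne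
    obtain ⟨w, hw, hw0⟩ := W.ne_bot_iff.1 hne.1
    have h1 : Module.finrank ℂ W < 2 := by
      have := Submodule.finrank_lt hne.2
      simpa using this
    have h2 : 0 < Module.finrank ℂ W := Module.finrank_pos_iff_exists_ne_zero.2
      ⟨⟨w, hw⟩, fun h => hw0 (congrArg Subtype.val h)⟩
    have h3 : Module.finrank ℂ W = 1 := by omega
    rw [finrank_eq_one_iff_of_nonzero' (⟨w, hw⟩ : W)
      (fun h => hw0 (congrArg Subtype.val h))] at h3
    refine hw0 (h w fun γ => ?_)
    obtain ⟨c, hc⟩ := h3 ⟨_, hW γ w hw⟩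
    exact ⟨c, (congrArg Subtype.val hc).symm⟩

theorem isIrreducible_conj {ρ ρ' : HolRep Y y} (hρ : ρ.IsIrreducible) (g : SU2)
    (h : ∀ γ, ρ' γ = g * ρ γ * g⁻¹) : ρ'.IsIrreducible := by
  refine isIrreducible_iff.2 fun w hw => ?_
  have h1 := isIrreducible_iff.1 hρ (((g⁻¹ : SU2) : Matrix (Fin 2) (Fin 2) ℂ) *ᵥ w) fun γ => by
    obtain ⟨c, hc⟩ := hw γ
    refine ⟨c, ?_⟩
    rw [← Matrix.mulVec_smul, ← hc, ← coe_mul_mulVec, ← coe_mul_mulVec, h]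
    congr 2
    group
  have h2 : (g : Matrix (Fin 2) (Fin 2) ℂ) *ᵥ (((g⁻¹ : SU2) : Matrix (Fin 2) (Fin 2) ℂ) *ᵥ w) = w := by
    rw [← coe_mul_mulVec, mul_inv_cancel]
    exact Matrix.one_mulVec w
  rw [← h2, h1, Matrix.mulVec_zero]

/-- The elements of `SU(2)` with a given eigenvector. -/
def eigenSubgroup (w : Fin 2 → ℂ) : Subgroup SU2 where
  carrier := {g | ∃ c : ℂ, c ≠ 0 ∧ (g : Matrix (Fin 2) (Fin 2) ℂ) *ᵥ w = c • w}
  one_mem' := ⟨1, one_ne_zero, by rw [one_smul]; exact Matrix.one_mulVec w⟩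
  mul_mem' := by
    rintro g h ⟨c, hc0, hc⟩ ⟨d, hd0, hd⟩
    exact ⟨d * c, mul_ne_zero hd0 hc0, by
      rw [coe_mul_mulVec, hd, Matrix.mulVec_smul, hc, smul_smul]⟩
  inv_mem' := by
    rintro g ⟨c, hc0, hc⟩
    refine ⟨c⁻¹, inv_ne_zero hc0, ?_⟩
    have : w = c⁻¹ • (g : Matrix (Fin 2) (Fin 2) ℂ) *ᵥ w := by rw [hc, inv_smul_smul₀ hc0]
    conv_lhs => rw [this]
    rw [Matrix.mulVec_smul, ← coe_mul_mulVec, inv_mul_cancel]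
    congr 1
    exact Matrix.one_mulVec w

theorem mem_eigenSubgroup {w : Fin 2 → ℂ} (hw : w ≠ 0) {g : SU2} {c : ℂ}
    (h : (g : Matrix (Fin 2) (Fin 2) ℂ) *ᵥ w = c • w) : g ∈ eigenSubgroup w := by
  refine ⟨c, ?_, h⟩
  rintro rfl
  apply hw
  have h1 : ((g⁻¹ : SU2) : Matrix (Fin 2) (Fin 2) ℂ) *ᵥ
      ((g : Matrix (Fin 2) (Fin 2) ℂ) *ᵥ w) = w := by
    rw [← coe_mul_mulVec, inv_mul_cancel]
    exact Matrix.one_mulVec w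
  rw [← h1, h, zero_smul, Matrix.mulVec_zero]

theorem mem_eigenSubgroup_of_mem_center {w : Fin 2 → ℂ} {g : SU2} (hg : half g ^ 2 = 1) :
    g ∈ eigenSubgroup w := by
  obtain ⟨h1, h2⟩ := (half_sq_eq_one_iff g).1 hg
  refine ⟨a g, ?_, ?_⟩
  · intro h
    rw [half, h] at hg
    norm_num at hg
  · ext i
    fin_cases i
    · exact (mulVec_zero g w).trans (by simp [h1])
    · exact (mulVec_one g w).trans (by simp [h1, Complex.conj_eq_iff_im.2 h2])

end SU2

theorem revProd_mulVec {n : ℕ} (g : Fin n → SU2) (c : Fin n → ℂ) (w : Fin 2 → ℂ)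
    (h : ∀ j, (g j : Matrix (Fin 2) (Fin 2) ℂ) *ᵥ w = c j • w) :
    ((revProd g : SU2) : Matrix (Fin 2) (Fin 2) ℂ) *ᵥ w = (∏ j, c j) • w := by
  induction n with
  | zero =>
    rw [Fin.prod_univ_zero, one_smul]
    exact Matrix.one_mulVec w
  | succ n ih =>
    rw [revProd_succ, SU2.coe_mul_mulVec, ih _ _ fun j => h _, Matrix.mulVec_smul, h, smul_smul,
      Fin.prod_univ_castSucc]

/-! ### Arithmetic -/

theorem dvd_of_sum_div_eq_int {r : ℕ} {p : Fin r → ℕ} (hp : ∀ j, 0 < p j)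
    (hcop : ∀ i j, i ≠ j → Nat.Coprime (p i) (p j)) (m : Fin r → ℤ) (N : ℤ)
    (h : ∑ j, (m j : ℚ) / p j = N) (k : Fin r) : (p k : ℤ) ∣ m k := by
  have h1 : ∑ j, m j * ∏ i ∈ Finset.univ.erase j, (p i : ℤ) = N * ∏ i, (p i : ℤ) := by
    have : (∑ j, m j * ∏ i ∈ Finset.univ.erase j, (p i : ℚ)) = N * ∏ i, (p i : ℚ) := by
      rw [← h, Finset.sum_mul]
      refine Finset.sum_congr rfl fun j _ => ?_
      rw [← Finset.mul_prod_erase _ _ (Finset.mem_univ j)]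
      have := (hp j).ne'
      field_simp
    exact_mod_cast this
  have h2 : (p k : ℤ) ∣ m k * ∏ i ∈ Finset.univ.erase k, (p i : ℤ) := by
    have h3 : (p k : ℤ) ∣ ∑ j, m j * ∏ i ∈ Finset.univ.erase j, (p i : ℤ) := by
      rw [h1]
      exact (Finset.dvd_prod_of_mem _ (Finset.mem_univ k)).mul_left _
    rw [← Finset.add_sum_erase _ _ (Finset.mem_univ k)] at h3
    refine (dvd_add_left (Finset.dvd_sum fun j hj => ?_)).1 h3
    exact (Finset.dvd_prod_of_mem _ (Finset.mem_erase.2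
      ⟨(Finset.ne_of_mem_erase hj).symm, Finset.mem_univ k⟩)).mul_left _
  refine IsCoprime.dvd_of_dvd_mul_right (IsCoprime.prod_right fun i hi => ?_) h2
  exact Nat.isCoprime_iff_coprime.2 (hcop k i (Finset.ne_of_mem_erase hi).symm)

/-- The numbers of twists of a normalized section at the other boundary circles determine the
parity of the first one. -/
theorem odd_of_sum_eq {r : ℕ} {p : Fin r → ℕ} {q n : Fin r → ℤ} (hp : ∀ j, 0 < p j)
    (hsum : (∏ j, (p j : ℚ)) * ∑ j, (q j : ℚ) / p j = 1) (hn : ∑ j, n j = 0)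
    (k : Fin r) (he : ∀ j, j ≠ k → Even (q j + n j * p j)) : Odd (q k + n k * p k) := by
  have h1 : ∑ j, (q j + n j * p j) * ∏ i ∈ Finset.univ.erase j, (p i : ℤ) = 1 := by
    have : (∑ j, (q j + n j * p j) * ∏ i ∈ Finset.univ.erase j, (p i : ℚ)) = 1 := by
      have h2 : ∀ j, (q j + n j * p j) * ∏ i ∈ Finset.univ.erase j, (p i : ℚ) =
          (∏ i, (p i : ℚ)) * (q j / p j) + (∏ i, (p i : ℚ)) * n j := by
        intro j
        rw [← Finset.mul_prod_erase _ _ (Finset.mem_univ j)]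
        have := (hp j).ne'
        field_simp
      rw [Finset.sum_congr rfl fun j _ => h2 j, Finset.sum_add_distrib, ← Finset.mul_sum, hsum,
        ← Finset.mul_sum]
      have : ∑ j, (n j : ℚ) = 0 := by exact_mod_cast hn
      rw [this, mul_zero, add_zero]
    exact_mod_cast this
  rw [← Finset.add_sum_erase _ _ (Finset.mem_univ k)] at h1
  have h2 : Even (∑ j ∈ Finset.univ.erase k,
      (q j + n j * p j) * ∏ i ∈ Finset.univ.erase j, (p i : ℤ)) :=
    Finset.even_sum _ fun j hj => (he j (Finset.ne_of_mem_erase hj)).mul_right _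
  by_contra h3
  rw [Int.not_odd_iff_even] at h3
  have h4 := (h3.mul_right (∏ i ∈ Finset.univ.erase k, (p i : ℤ))).add h2
  rw [h1] at h4
  exact absurd h4 (by decide)

end

/-! ### Flat connections on the holed sphere -/

section Moduli

variable {Y : Type} [TopologicalSpace Y] {y : Y}

theorem FlatModuli.mk_eq_mk_iff {ρ ρ' : HolRep Y y} :
    FlatModuli.mk ρ = FlatModuli.mk ρ' ↔ ∃ g : SU2, ∀ γ, ρ' γ = g * ρ γ * g⁻¹ :=
  Quotient.eq (r := gaugeSetoid Y y)

theorem FlatModuli.exists_mk (x : FlatModuli Y y) : ∃ ρ, FlatModuli.mk ρ = x :=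
  Quotient.exists_rep x

theorem FlatModuli.mk_mem_irrModuli {ρ : HolRep Y y} :
    FlatModuli.mk ρ ∈ irrModuli Y y ↔ ρ.IsIrreducible := by
  constructor
  · rintro ⟨ρ', h, h'⟩
    obtain ⟨g, hg⟩ := FlatModuli.mk_eq_mk_iff.1 h'
    exact SU2.isIrreducible_conj h g hg
  · exact fun h => ⟨ρ, h, rfl⟩

end Moduli

namespace HoledSphere

variable {r : ℕ} {p : Fin r → ℕ}

theorem hasHolonomy_iff (ρ : HolRep (HoledSphere r) (base r)) (j : Fin r) (α : ℝ) :
    HasHolonomy ρ j (ConjClasses.mk (SU2.diag α)) ↔ SU2.half (ρ (meridian j)) = Real.cos α := by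
  have key : ∀ γ : Path (base r) (boundary j 1),
      SU2.half (ρ (FundamentalGroup.fromPath
        (Path.Homotopic.Quotient.mk (γ.trans ((boundaryLoop j).trans γ.symm))))) =
      SU2.half ((Transport.ofHom ρ).toFun (boundaryLoop j)) := by
    intro γ
    rw [← Transport.ofHom_toFun, Transport.map_trans, Transport.map_trans, Transport.map_symm]
    have := SU2.half_conj ((Transport.ofHom ρ).toFun γ)⁻¹
      ((Transport.ofHom ρ).toFun (boundaryLoop j))
    rwa [inv_inv] at this
  have hm : SU2.half (ρ (meridian j)) =
      SU2.half ((Transport.ofHom ρ).toFun (boundaryLoop j)) := key (boundaryTether j)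
  constructor
  · rintro ⟨γ, hγ⟩
    rw [SU2.mk_eq_mk_diag_iff, key] at hγ
    rw [hm, hγ]
  · intro h
    exact ⟨boundaryTether j, by rw [SU2.mk_eq_mk_diag_iff, key, ← hm, h]⟩

theorem mk_mem_moduli {ℓ : Fin r → ℤ} {ρ : HolRep (HoledSphere r) (base r)} :
    FlatModuli.mk ρ ∈ moduli (holClass p ℓ) ↔
      ∀ j, SU2.half (ρ (meridian j)) = Real.cos (Real.pi * ℓ j / p j) := by
  constructor
  · rintro ⟨ρ', h, h'⟩ j
    obtain ⟨g, hg⟩ := FlatModuli.mk_eq_mk_iff.1 h'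
    rw [hg, SU2.half_conj]
    exact (hasHolonomy_iff _ _ _).1 (h j)
  · exact fun h => ⟨ρ, fun j => (hasHolonomy_iff _ _ _).2 (h j), rfl⟩

theorem angle_mem {ℓ : Fin r → ℤ} (hp : ∀ j, 0 < p j) (h : ∀ j, 0 ≤ ℓ j ∧ ℓ j ≤ p j) (j : Fin r) :
    0 ≤ Real.pi * ℓ j / p j ∧ Real.pi * ℓ j / p j ≤ Real.pi := by
  have h1 : (0 : ℝ) < p j := by exact_mod_cast hp j
  have h2 : (0 : ℝ) ≤ ℓ j := by exact_mod_cast (h j).1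
  have h3 : (ℓ j : ℝ) ≤ p j := by exact_mod_cast (h j).2
  refine ⟨by positivity, ?_⟩
  rw [div_le_iff₀ h1]
  exact mul_le_mul_of_nonneg_left h3 Real.pi_pos.le

/-- If one of the angles is not a multiple of `π`, a flat connection with these angles is
irreducible: the eigenvalues of the holonomies on a common eigenvector would multiply to one, so a
sum of the numbers `± ℓ j / p j` would be an integer. -/
theorem isIrreducible_of_half_eq (hr : 2 ≤ r) (hp : ∀ j, 0 < p j)
    (hcop : ∀ i j, i ≠ j → Nat.Coprime (p i) (p j)) {ℓ : Fin r → ℤ} {k : Fin r}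
    (hk : ¬ (p k : ℤ) ∣ ℓ k) {ρ : HolRep (HoledSphere r) (base r)}
    (hρ : ∀ j, SU2.half (ρ (meridian j)) = Real.cos (Real.pi * ℓ j / p j)) :
    ρ.IsIrreducible := by
  refine SU2.isIrreducible_iff.2 fun w hw => ?_
  by_contra hw0
  choose c hc using fun j => hw (meridian j)
  have h1 : ∀ j, ∃ e : ℤ, (e = 1 ∨ e = -1) ∧
      c j = Circle.exp (e * (Real.pi * ℓ j / p j)) := by
    intro j
    rcases SU2.eigenvalue_eq hw0 (hc j) (hρ j) with h | h
    · exact ⟨1, Or.inl rfl, by rw [h, Int.cast_one, one_mul]⟩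
    · exact ⟨-1, Or.inr rfl, by rw [h, Int.cast_neg, Int.cast_one, neg_one_mul]⟩
  choose e he hce using h1
  have h2 := revProd_mulVec (fun j => ρ (meridian j)) c w hc
  rw [revProd_meridian hr] at h2
  have h3 : ∏ j, c j = 1 := by
    have h4 : w = (∏ j, c j) • w := (Matrix.one_mulVec w).symm.trans h2
    obtain ⟨i, hi⟩ := Function.ne_iff.1 hw0
    have h5 := congrFun h4 i
    rw [Pi.smul_apply, smul_eq_mul] at h5
    exact (mul_eq_right₀ hi).1 h5.symm
  have h6 : Circle.exp (∑ j, e j * (Real.pi * ℓ j / p j)) = Circle.exp 0 := by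
    have h7 : Circle.exp (∑ j, e j * (Real.pi * ℓ j / p j)) =
        ∏ j, Circle.exp (e j * (Real.pi * ℓ j / p j)) := by
      induction (Finset.univ : Finset (Fin r)) using Finset.induction_on with
      | empty => simp
      | insert a s ha ih => rw [Finset.sum_insert ha, Finset.prod_insert ha, Circle.exp_add, ih]
    rw [h7, Circle.exp_zero]
    refine Circle.ext ?_
    rw [Circle.coe_one, ← h3]
    exact (map_prod Circle.coeHom _ _).trans (Finset.prod_congr rfl fun j _ => (hce j).symm)
  obtain ⟨N, hN⟩ := Circle.exp_eq_exp_iff.1 h6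
  have h8 : ∑ j, ((e j * ℓ j : ℤ) : ℚ) / p j = (2 * N : ℤ) := by
    have h9 : Real.pi * ∑ j, ((e j * ℓ j : ℤ) : ℝ) / p j = Real.pi * (2 * N : ℤ) := by
      rw [Finset.mul_sum]
      push_cast
      rw [zero_add] at hN
      rw [← mul_assoc, mul_comm Real.pi 2, ← hN]
      exact Finset.sum_congr rfl fun j _ => by ring
    have h10 := mul_left_cancel₀ Real.pi_ne_zero h9
    exact_mod_cast h10
  have h11 := dvd_of_sum_div_eq_int hp hcop _ _ h8 k
  rcases he k with h | h
  · rw [h, one_mul] at h11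
    exact hk h11
  · rw [h, neg_one_mul, dvd_neg] at h11
    exact hk h11

theorem exists_not_dvd {ℓ : Fin r → ℤ} (hℓ : ℓ ∈ setL p) : ∃ k, ¬ (p k : ℤ) ∣ ℓ k := by
  have h := hℓ.2.1
  obtain ⟨k, hk⟩ := Finset.card_pos.1 (by omega :
    0 < (Finset.univ.filter fun j => ¬ ((p j : ℤ) ∣ ℓ j)).card)
  exact ⟨k, (Finset.mem_filter.1 hk).2⟩

theorem sum_angles (hp : ∀ j, 0 < p j) (ℓ : Fin r → ℤ) (J : Finset (Fin r)) :
    ∑ j ∈ J, (Real.pi - Real.pi * ℓ j / p j) + ∑ j ∈ Jᶜ, Real.pi * ℓ j / p j =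
      Real.pi * ((∑ j ∈ J, ((p j : ℚ) - ℓ j) / p j + ∑ j ∈ Jᶜ, (ℓ j : ℚ) / p j : ℚ) : ℝ) := by
  push_cast
  rw [mul_add, Finset.mul_sum, Finset.mul_sum]
  congr 1
  · refine Finset.sum_congr rfl fun j _ => ?_
    have : (p j : ℝ) ≠ 0 := by exact_mod_cast (hp j).ne'
    field_simp
  · exact Finset.sum_congr rfl fun j _ => by ring

/-- The polygon inequalities are strict, as otherwise a sum of the numbers `± ℓ j / p j` would be an
integer. -/
theorem mem_setR_iff (hp : ∀ j, 0 < p j) (hcop : ∀ i j, i ≠ j → Nat.Coprime (p i) (p j))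
    {ℓ : Fin r → ℤ} (hℓ : ℓ ∈ setL p) :
    ℓ ∈ setR p ↔ (SU2.polygon (fun j => Real.pi * ℓ j / p j) 1).Nonempty := by
  rw [SU2.polygon_one_nonempty_iff (angle_mem hp hℓ.1)]
  simp only [sum_angles hp]
  constructor
  · intro h J hJ
    have h1 : (1 : ℝ) ≤ ((∑ j ∈ J, ((p j : ℚ) - ℓ j) / p j + ∑ j ∈ Jᶜ, (ℓ j : ℚ) / p j : ℚ) : ℝ) := by
      exact_mod_cast (h.2 J hJ).le
    exact le_mul_of_one_le_right Real.pi_pos.le h1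
  · refine fun h => ⟨hℓ, fun J hJ => ?_⟩
    have h1 : (1 : ℚ) ≤ ∑ j ∈ J, ((p j : ℚ) - ℓ j) / p j + ∑ j ∈ Jᶜ, (ℓ j : ℚ) / p j := by
      have := (le_mul_iff_one_le_right Real.pi_pos).1 (h J hJ)
      exact_mod_cast this
    refine lt_of_le_of_ne h1 fun h2 => ?_
    have h3 : ∑ j, ((if j ∈ J then p j - ℓ j else ℓ j : ℤ) : ℚ) / p j = (1 : ℤ) := by
      rw [Int.cast_one, h2, ← Finset.sum_add_sum_compl J]
      congr 1
      · exact Finset.sum_congr rfl fun j hj => by simp [hj]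
      · exact Finset.sum_congr rfl fun j hj => by simp [Finset.mem_compl.1 hj]
    obtain ⟨k, hk⟩ := exists_not_dvd hℓ
    have h4 := dvd_of_sum_div_eq_int hp hcop _ _ h3 k
    split_ifs at h4
    · exact hk ((dvd_sub_right (dvd_refl _)).1 h4)
    · exact hk h4

theorem exists_half_eq (hr : 2 ≤ r) (hp : ∀ j, 0 < p j)
    (hcop : ∀ i j, i ≠ j → Nat.Coprime (p i) (p j)) {ℓ : Fin r → ℤ} (hℓ : ℓ ∈ setR p) :
    ∃ ρ : HolRep (HoledSphere r) (base r),
      ∀ j, SU2.half (ρ (meridian j)) = Real.cos (Real.pi * ℓ j / p j) := by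
  obtain ⟨g, hg⟩ := (mem_setR_iff hp hcop hℓ.1).1 hℓ
  obtain ⟨ρ, hρ⟩ := exists_hom hr g hg.2
  exact ⟨ρ, fun j => by rw [hρ, hg.1]⟩

theorem moduli_eq_irrModuli (hr : 2 ≤ r) (hp : ∀ j, 0 < p j)
    (hcop : ∀ i j, i ≠ j → Nat.Coprime (p i) (p j)) {ℓ : Fin r → ℤ} (hℓ : ℓ ∈ setL p) :
    moduli (holClass p ℓ) = irrModuli (holClass p ℓ) := by
  refine (Set.inter_eq_left.2 fun x hx => ?_).symm
  obtain ⟨ρ, rfl⟩ := FlatModuli.exists_mk x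
  obtain ⟨k, hk⟩ := exists_not_dvd hℓ
  exact FlatModuli.mk_mem_irrModuli.2
    (isIrreducible_of_half_eq hr hp hcop hk (mk_mem_moduli.1 hx))

end HoledSphere

section

/-! ### Normalized sections -/

namespace SeifertManifold

theorem direction_mul {z w : ℂ} (hz : z ≠ 0) (hw : w ≠ 0) :
    direction (z * w) = direction z * direction w := by
  refine Circle.ext (mul_left_cancel₀ (a := ((‖z * w‖ : ℝ) : ℂ)) ?_ ?_)
  · exact_mod_cast norm_ne_zero_iff.2 (mul_ne_zero hz hw)
  · rw [norm_mul_direction, norm_mul, Circle.coe_mul, Complex.ofReal_mul, mul_mul_mul_comm,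
      norm_mul_direction, norm_mul_direction]

theorem direction_one : direction 1 = 1 := by simp [direction]

/-- A circle of radius `1/3` around a nonzero integer does not wind around the origin. -/
theorem exists_direction_eq_exp {c : ℤ} (hc : c ≠ 0) :
    ∃ a : C(Circle, ℝ), ∀ u : Circle, direction (c + u / 3) = Circle.exp (a u) := by
  have hc' : (c : ℂ) ≠ 0 := by exact_mod_cast hc
  have h1 : ∀ u : Circle, 1 + (u / 3 / c : ℂ) ∈ Complex.slitPlane := by
    intro u
    left
    have h2 : ‖(u / 3 / c : ℂ)‖ ≤ 1 / 3 := by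
      rw [norm_div, norm_div, Circle.norm_coe, Complex.norm_intCast]
      have : (1 : ℝ) ≤ |(c : ℝ)| := by exact_mod_cast Int.one_le_abs hc
      norm_num
      rw [div_le_iff₀ (by linarith)]
      linarith
    have h3 := (abs_le.1 ((Complex.abs_re_le_norm _).trans h2)).1
    rw [Complex.add_re, Complex.one_re]
    linarith
  refine ⟨⟨fun u => Complex.arg c + Complex.arg (1 + (u / 3 / c : ℂ)), ?_⟩, fun u => ?_⟩
  · refine continuous_const.add (continuous_iff_continuousAt.2 fun u => ?_)
    exact (Complex.continuousAt_arg (h1 u)).comp (f := fun u : Circle => 1 + (u / 3 / c : ℂ))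
      (by fun_prop)
  · have h4 : (c + u / 3 : ℂ) = c * (1 + (u / 3 / c : ℂ)) := by
      rw [mul_add, mul_one, mul_div_cancel₀ _ hc']
    rw [h4, direction_mul hc' (Complex.slitPlane_ne_zero (h1 u))]
    exact (Circle.exp_add _ _).symm

end SeifertManifold

section Winding

variable {r : ℕ} {s s' : C(HoledSphere r, Circle)} {j : Fin r} {n m : ℤ}

theorem HasWinding.one : HasWinding (1 : C(HoledSphere r, Circle)) j 0 :=
  ⟨0, fun u => by simp⟩

theorem HasWinding.mul (h : HasWinding s j n) (h' : HasWinding s' j m) :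
    HasWinding (s * s') j (n + m) := by
  obtain ⟨a, ha⟩ := h
  obtain ⟨a', ha'⟩ := h'
  refine ⟨a + a', fun u => ?_⟩
  rw [ContinuousMap.mul_apply, ha, ha', ContinuousMap.add_apply, Circle.exp_add, zpow_add,
    mul_mul_mul_comm]

theorem HasWinding.zpow (h : HasWinding s j n) (m : ℤ) : HasWinding (s ^ m) j (n * m) := by
  obtain ⟨a, ha⟩ := h
  refine ⟨m • a, fun u => ?_⟩
  rw [ContinuousMap.zpow_apply, ha, mul_zpow, ← zpow_mul, ContinuousMap.smul_apply,
    Circle.exp_zsmul]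

theorem HasWinding.prod {ι : Type*} (S : Finset ι) {s : ι → C(HoledSphere r, Circle)} {n : ι → ℤ}
    (h : ∀ i, HasWinding (s i) j (n i)) : HasWinding (∏ i ∈ S, s i) j (∑ i ∈ S, n i) := by
  classical
  induction S using Finset.induction_on with
  | empty => simpa using HasWinding.one
  | insert i S hi ih =>
    rw [Finset.prod_insert hi, Finset.sum_insert hi]
    exact (h i).mul ih

end Winding

namespace HoledSphere

open SeifertManifold

variable {r : ℕ}

theorem continuousAt_elim_sub (k : ℂ) {x : OnePoint ℂ} (hx : x ≠ ((0 : ℂ) : OnePoint ℂ)) :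
    ContinuousAt (fun x : OnePoint ℂ => x.elim (1 : ℂ) fun z => 1 - k * z⁻¹) x := by
  induction x using OnePoint.rec with
  | infty =>
    rw [OnePoint.continuousAt_infty']
    have h1 : Filter.Tendsto (fun z : ℂ => 1 - k * z⁻¹) (Filter.coclosedCompact ℂ)
        (nhds (1 - k * 0)) := by
      rw [Filter.coclosedCompact_eq_cocompact]
      exact tendsto_const_nhds.sub ((Filter.tendsto_inv₀_cobounded (α := ℂ)).comp
        (by rw [Metric.cobounded_eq_cocompact]; exact Filter.tendsto_id) |>.const_mul k)
    rw [mul_zero, sub_zero] at h1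
    exact h1
  | coe z =>
    have hz : z ≠ 0 := fun h => hx (by rw [h])
    rw [OnePoint.continuousAt_coe]
    change ContinuousAt (fun z : ℂ => 1 - k * z⁻¹) z
    fun_prop (disch := exact hz)

theorem ne_coe (x : HoledSphere r) (k : Fin r) : x.1 ≠ (((k : ℕ) : ℂ) : OnePoint ℂ) := by
  intro h
  refine x.2 (Set.mem_iUnion.2 ⟨k, _, Metric.mem_ball_self (by norm_num), h.symm⟩)

/-- Away from the first boundary circle, the section given by the direction of `1 - k / z` winds
around the fibre along the `k`-th boundary circle only, where it winds once. -/
theorem exists_section (k : Fin r) :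
    ∃ s : C(HoledSphere r, Circle), s (base r) = 1 ∧
      ∀ j : Fin r, (j : ℕ) ≠ 0 → HasWinding s j (if j = k then 1 else 0) := by
  have h0 : ∀ x : HoledSphere r, x.1 ≠ ((0 : ℂ) : OnePoint ℂ) := fun x => by
    have := ne_coe x ⟨0, k.pos⟩
    simpa using this
  have hne : ∀ x : HoledSphere r, (x.1.elim (1 : ℂ) fun z => 1 - (k : ℕ) * z⁻¹ : ℂ) ≠ 0 := by
    rintro ⟨x, hx⟩
    have h1 := ne_coe ⟨x, hx⟩ k
    have h2 := h0 ⟨x, hx⟩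
    induction x using OnePoint.rec with
    | infty => exact one_ne_zero
    | coe z =>
      have hz : z ≠ 0 := fun h => h2 (congrArg _ h)
      intro h3
      change 1 - ((k : ℕ) : ℂ) * z⁻¹ = 0 at h3
      refine h1 (congrArg OnePoint.some (?_ : z = (k : ℕ)))
      field_simp at h3
      linear_combination h3
  refine ⟨⟨fun x => direction (x.1.elim (1 : ℂ) fun z => 1 - (k : ℕ) * z⁻¹), ?_⟩, direction_one,
    fun j hj => ?_⟩
  · refine continuous_iff_continuousAt.2 fun x => ?_
    exact (continuousAt_direction (hne x)).comp (f := fun x : HoledSphere r =>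
      (x.1.elim (1 : ℂ) fun z => 1 - (k : ℕ) * z⁻¹ : ℂ)) (ContinuousAt.comp
        (f := fun x : HoledSphere r => x.1) (continuousAt_elim_sub _ (h0 x))
        continuous_subtype_val.continuousAt)
  · obtain ⟨a, ha⟩ := exists_direction_eq_exp (c := (j : ℕ)) (by exact_mod_cast hj)
    have h1 : ∀ u : Circle, direction (1 - (k : ℕ) * (((j : ℕ) : ℂ) + u / 3)⁻¹) =
        direction (((j : ℕ) : ℂ) + u / 3 - (k : ℕ)) * (Circle.exp (a u))⁻¹ := by
      intro u
      have h2 : ((j : ℕ) : ℂ) + u / 3 ≠ 0 := fun h => h0 (boundary j u) (congrArg _ h)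
      have h3 := hne (boundary j u)
      change 1 - ((k : ℕ) : ℂ) * (((j : ℕ) : ℂ) + u / 3)⁻¹ ≠ 0 at h3
      rw [eq_mul_inv_iff_mul_eq, ← ha, Int.cast_natCast, ← direction_mul h3 h2, sub_mul, one_mul,
        inv_mul_cancel_right₀ h2]
    have h4 : ∃ b : C(Circle, ℝ), ∀ u : Circle, direction (((j : ℕ) : ℂ) + u / 3 - (k : ℕ)) =
        u ^ (if j = k then 1 else 0 : ℤ) * Circle.exp (b u) := by
      split_ifs with hjk
      · refine ⟨0, fun u => ?_⟩
        have h5 : ((j : ℕ) : ℂ) + u / 3 - (k : ℕ) = (u : ℂ) * ((1 / 3 : ℝ) : ℂ) := by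
          rw [hjk]; push_cast; ring
        rw [h5, direction_mul (Circle.coe_ne_zero u) (by norm_num), direction_circle]
        rw [direction, Complex.arg_ofReal_of_nonneg (by norm_num), zpow_one]
        rfl
      · obtain ⟨b, hb⟩ := exists_direction_eq_exp (c := (j : ℕ) - (k : ℕ))
          (fun h => hjk (Fin.ext (by omega)))
        refine ⟨b, fun u => ?_⟩
        rw [zpow_zero, one_mul, ← hb]
        congr 1
        push_cast
        ring
    obtain ⟨b, hb⟩ := h4
    refine ⟨b - a, fun u => ?_⟩
    have h5 : u ^ (if j = k then 1 else 0 : ℤ) * Circle.exp ((b - a) u) =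
        direction (1 - (k : ℕ) * (((j : ℕ) : ℂ) + u / 3)⁻¹) := by
      rw [ContinuousMap.sub_apply, Circle.exp_sub, div_eq_mul_inv, ← mul_assoc, ← hb, ← h1]
    exact h5.symm

end HoledSphere

theorem exists_isNormalizedSection {r : ℕ} {p : Fin r → ℕ} {q : Fin r → ℤ}
    (hodd : ∀ j : Fin r, (j : ℕ) ≠ 0 → Odd (p j)) :
    ∃ s : C(HoledSphere r, Circle), IsNormalizedSection p q s := by
  have h1 : ∀ k : Fin r, ∃ s : C(HoledSphere r, Circle), s (HoledSphere.base r) = 1 ∧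
      ∀ j : Fin r, (j : ℕ) ≠ 0 → HasWinding s j (if j = k then q j else 0) := by
    intro k
    obtain ⟨s, hs, h⟩ := HoledSphere.exists_section k
    refine ⟨s ^ q k, by rw [ContinuousMap.zpow_apply, hs, one_zpow], fun j hj => ?_⟩
    have := (h j hj).zpow (q k)
    rw [ite_mul, one_mul, zero_mul] at this
    convert this using 1
    split_ifs with hjk
    · rw [hjk]
    · rfl
  choose s hs hw using h1
  refine ⟨∏ k, s k, ?_, fun j hj => ⟨q j, ?_, ?_⟩⟩
  · rw [ContinuousMap.prod_apply]
    exact Finset.prod_eq_one fun k _ => hs k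
  · simpa using HasWinding.prod Finset.univ fun k => hw k j hj
  · have : q j + q j * p j = q j * (1 + p j) := by ring
    rw [this]
    exact (Odd.add_odd odd_one (by exact_mod_cast hodd j hj)).mul_left _

end

section

/-! ### Flat connections on the Seifert manifold and their pull-backs -/

section Group

variable {G : Type*} [Group G]

theorem zpow_neg_mul_pow_eq_iff {e b : G} (h : Commute e b) (m k : ℤ) (l : ℕ) :
    (e ^ (-m) * b) ^ l = e ^ k ↔ b ^ l = e ^ (k + m * l) := by
  rw [(h.zpow_left _).mul_pow, ← zpow_natCast (e ^ (-m)), ← zpow_mul, neg_mul, zpow_neg,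
    inv_mul_eq_iff_eq_mul, ← zpow_add, add_comm]

theorem zpow_eq_one_of_even {e : G} (he : e ^ 2 = 1) {m : ℤ} (hm : Even m) : e ^ m = 1 := by
  obtain ⟨k, rfl⟩ := hm
  rw [← two_mul, zpow_mul, zpow_ofNat, he, one_zpow]

theorem zpow_eq_self_of_odd {e : G} (he : e ^ 2 = 1) {m : ℤ} (hm : Odd m) : e ^ m = e := by
  obtain ⟨k, rfl⟩ := hm
  rw [zpow_add_one, zpow_mul, zpow_ofNat, he, one_zpow, one_mul]

end Group

namespace SU2

theorem commute_of_half_sq {g : SU2} (hg : half g ^ 2 = 1) (h : SU2) : Commute g h := by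
  obtain ⟨hb, ha⟩ := (half_sq_eq_one_iff g).1 hg
  have hc : starRingEnd ℂ (a g) = a g := Complex.conj_eq_iff_im.2 ha
  refine ext_ab ?_ ?_
  · simp only [a_mul, hb, map_zero, mul_zero, zero_mul, sub_zero]
    exact mul_comm _ _
  · simp only [b_mul, hb, mul_zero, zero_mul, hc]
    ring

theorem sq_eq_one_of_half_sq {g : SU2} (hg : half g ^ 2 = 1) : g ^ 2 = 1 := by
  obtain ⟨hb, ha⟩ := (half_sq_eq_one_iff g).1 hg
  have h1 : a g = (half g : ℂ) := Complex.ext rfl ha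
  refine ext_ab ?_ ?_
  · rw [sq, a_mul, hb, map_zero, mul_zero, sub_zero, h1, ← sq, a_one]
    exact_mod_cast hg
  · rw [sq, b_mul, hb, mul_zero, zero_mul, add_zero, b_one]

theorem half_diag_pi_mul (l : ℤ) : half (diag (Real.pi * l)) ^ 2 = 1 := by
  rw [half_diag, mul_comm, Real.cos_int_mul_pi, ← zpow_natCast, ← zpow_mul, mul_comm, zpow_mul]
  simp

theorem diag_pi_mul_eq_one_iff (l : ℤ) : diag (Real.pi * l) = 1 ↔ Even l := by
  constructor
  · intro h
    have h1 := congrArg half h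
    rw [half_diag, mul_comm, Real.cos_int_mul_pi, half_one] at h1
    by_contra h2
    rw [Int.not_even_iff_odd] at h2
    rw [h2.neg_one_zpow] at h1
    norm_num at h1
  · rintro ⟨m, rfl⟩
    rw [← two_mul, Int.cast_mul, Int.cast_two, ← mul_assoc, mul_comm Real.pi, mul_right_comm,
      mul_assoc, ← mul_one (diag _)]
    refine ext_ab ?_ (by simp)
    rw [mul_one, a_diag, a_one, Circle.exp_eq_one.2 ⟨m, by ring⟩, Circle.coe_one]

theorem diag_nsmul (α : ℝ) (m : ℕ) : diag (m * α) = diag α ^ m := by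
  induction m with
  | zero => simp [diag_zero]
  | succ m ih => rw [Nat.cast_succ, add_mul, one_mul, diag_add, ih, pow_succ]

theorem pow_eq_of_half_eq {g : SU2} {m : ℕ} (hm : 0 < m) {l : ℤ}
    (h : half g = Real.cos (Real.pi * l / m)) : g ^ m = diag (Real.pi * l) := by
  obtain ⟨k, rfl⟩ := exists_conj_diag g h
  have hm' : (m : ℝ) ≠ 0 := by exact_mod_cast hm.ne'
  rw [conj_pow, ← diag_nsmul, mul_div_cancel₀ _ hm',
    ← (commute_of_half_sq (half_diag_pi_mul l) k).eq, mul_inv_cancel_right]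

theorem exists_half_eq_of_half_pow {g : SU2} {m : ℕ} (hm : 0 < m) (h : half (g ^ m) ^ 2 = 1) :
    ∃ l : ℤ, (0 ≤ l ∧ l ≤ m) ∧ half g = Real.cos (Real.pi * l / m) := by
  have hm' : (0 : ℝ) < m := by exact_mod_cast hm
  obtain ⟨h1, h2⟩ := half_mem g
  have h3 := Real.cos_arccos h1 h2
  obtain ⟨k, hk⟩ := exists_conj_diag g h3.symm
  rw [hk, conj_pow, ← diag_nsmul, half_conj, half_diag, Real.cos_sq', sub_eq_self, sq_eq_zero_iff,
    Real.sin_eq_zero_iff] at h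
  obtain ⟨l, hl⟩ := h
  have h4 : Real.pi * l / m = Real.arccos (half g) := by
    rw [mul_comm, hl, mul_div_cancel_left₀ _ hm'.ne']
  refine ⟨l, ⟨?_, ?_⟩, by rw [h4, h3]⟩
  · have h5 : 0 ≤ (l : ℝ) * Real.pi := by
      rw [hl]; exact mul_nonneg hm'.le (Real.arccos_nonneg _)
    exact_mod_cast nonneg_of_mul_nonneg_left h5 Real.pi_pos
  · have h5 : (l : ℝ) * Real.pi ≤ m * Real.pi := by
      rw [hl]; exact mul_le_mul_of_nonneg_left (Real.arccos_le_pi _) hm'.le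
    exact_mod_cast le_of_mul_le_mul_right h5 Real.pi_pos

/-- If all but two boundary holonomies of a flat connection on the holed sphere are central, then
these two commute, as the ordered product of all of them is one. So one of them commutes with the
whole representation. -/
theorem two_lt_card_of_isIrreducible {r : ℕ} (hr : 2 ≤ r)
    {ρ : HolRep (HoledSphere r) (HoledSphere.base r)} (hρ : ρ.IsIrreducible) :
    2 < (Finset.univ.filter fun j => half (ρ (HoledSphere.meridian j)) ^ 2 ≠ 1).card := by
  by_contra! hcard
  set N := Finset.univ.filter fun j => half (ρ (HoledSphere.meridian j)) ^ 2 ≠ 1 with hN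
  have hN' : ∀ j, j ∉ N → ∀ g, Commute (ρ (HoledSphere.meridian j)) g := fun j hj g =>
    commute_of_half_sq (by_contra fun h => hj (Finset.mem_filter.2 ⟨Finset.mem_univ j, h⟩)) g
  obtain ⟨g, hg, hc⟩ : ∃ g : SU2, half g ^ 2 ≠ 1 ∧
      ∀ j, Commute g (ρ (HoledSphere.meridian j)) := by
    rcases N.eq_empty_or_nonempty with h0 | ⟨k, hk⟩
    · refine ⟨diag (Real.pi / 2), by simp, fun j => (hN' j (by simp [h0]) _).symm⟩
    · refine ⟨_, (Finset.mem_filter.1 hk).2, ?_⟩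
      obtain ⟨i, hi⟩ : ∃ i, ∀ j, j ≠ i → j ≠ k → j ∉ N := by
        have h1 : (N.erase k).card ≤ 1 := by rw [Finset.card_erase_of_mem hk]; omega
        have : Nonempty (Fin r) := ⟨k⟩
        obtain ⟨i, hi⟩ := Finset.card_le_one_iff_subset_singleton.1 h1
        exact ⟨i, fun j hj hjk hjN =>
          hj (Finset.mem_singleton.1 (hi (Finset.mem_erase.2 ⟨hjk, hjN⟩)))⟩
      have h2 := eq_of_revProd_eq (k := i)
        (b := fun j => (MulAut.conj (ρ (HoledSphere.meridian k))).toMonoidHom.comp ρ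
          (HoledSphere.meridian j))
        (b' := fun j => ρ (HoledSphere.meridian j)) (fun j hj => ?_)
        ((HoledSphere.revProd_meridian hr _).trans (HoledSphere.revProd_meridian hr _).symm)
      · exact fun j => mul_inv_eq_iff_eq_mul.1 (congrFun h2 j)
      · change ρ (HoledSphere.meridian k) * ρ (HoledSphere.meridian j) *
          (ρ (HoledSphere.meridian k))⁻¹ = _
        by_cases hjk : j = k
        · rw [hjk, mul_inv_cancel_right]
        · rw [← (hN' j (hi j hj hjk) _).eq, mul_inv_cancel_right]
  refine hg (half_sq_eq_one_of_commute hρ fun γ => ?_)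
  have h3 : (MulAut.conj g).toMonoidHom.comp ρ = ρ := HoledSphere.hom_ext hr fun j =>
    mul_inv_eq_iff_eq_mul.2 (hc j).eq
  exact mul_inv_eq_iff_eq_mul.1 (DFunLike.congr_fun h3 γ)

end SU2

/-- The integers `n j` are winding numbers of the normalized section `s`, the first of them being
determined by the condition that they sum to zero. -/
structure IsNormalizedWinding {r : ℕ} (p : Fin r → ℕ) (q : Fin r → ℤ)
    (s : C(HoledSphere r, Circle)) (n : Fin r → ℤ) : Prop where
  map_base : s (HoledSphere.base r) = 1
  sum_eq : ∑ j, n j = 0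
  hasWinding : ∀ j : Fin r, (j : ℕ) ≠ 0 → HasWinding s j (n j)
  even : ∀ j : Fin r, (j : ℕ) ≠ 0 → Even (q j + n j * p j)

theorem IsNormalizedSection.exists_isNormalizedWinding {r : ℕ} (hr : 2 ≤ r) {p : Fin r → ℕ}
    {q : Fin r → ℤ} {s : C(HoledSphere r, Circle)} (h : IsNormalizedSection p q s) :
    ∃ n, IsNormalizedWinding p q s n := by
  have h1 : ∀ j : Fin r, ∃ n : ℤ, (j : ℕ) ≠ 0 → HasWinding s j n ∧ Even (q j + n * p j) := by
    intro j
    by_cases hj : (j : ℕ) = 0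
    · exact ⟨0, fun h => absurd hj h⟩
    · obtain ⟨n, hn⟩ := h.2 j hj
      exact ⟨n, fun _ => hn⟩
  choose n hn using h1
  obtain ⟨k, hk⟩ : ∃ k : Fin r, (k : ℕ) = 0 := ⟨⟨0, by omega⟩, rfl⟩
  have h2 : ∀ j : Fin r, (j : ℕ) ≠ 0 →
      Function.update n k (-∑ i ∈ Finset.univ.erase k, n i) j = n j := fun j hj =>
    Function.update_of_ne (fun h => hj (by rw [h, hk])) _ _
  refine ⟨Function.update n k (-∑ i ∈ Finset.univ.erase k, n i), h.1, ?_, fun j hj => ?_,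
    fun j hj => ?_⟩
  · rw [← Finset.add_sum_erase _ _ (Finset.mem_univ k), Function.update_self,
      Finset.sum_congr rfl fun j hj => Function.update_of_ne (Finset.ne_of_mem_erase hj) _ n,
      neg_add_cancel]
  · rw [h2 j hj]
    exact (hn j hj).1
  · rw [h2 j hj]
    exact (hn j hj).2

namespace IsNormalizedWinding

open SeifertManifold

variable {r : ℕ} {p : Fin r → ℕ} {q n : Fin r → ℤ} {s : C(HoledSphere r, Circle)}

/-- The fibre is mapped to `± 1` by an irreducible representation. -/
theorem half_fiber_sq {ρ : HolRep (SeifertManifold p q) (base p q)} (hρ : ρ.IsIrreducible) :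
    SU2.half (ρ (fiber p q)) ^ 2 = 1 :=
  SU2.half_sq_eq_one_of_commute hρ fun γ => commute_fiber ρ γ

/-- The fundamental group is generated by the holed sphere and the fibre, whose value is a scalar;
so a common eigenvector of the pull-back is one of the whole representation. -/
theorem isIrreducible_comp (D : IsNormalizedWinding p q s n) (hr : 2 ≤ r)
    {ρ : HolRep (SeifertManifold p q) (base p q)} (hρ : ρ.IsIrreducible) :
    HolRep.IsIrreducible (ρ.comp (embedHom p q D.map_base)) := by
  refine SU2.isIrreducible_iff.2 fun w hw => ?_
  by_contra hw0
  refine hw0 (SU2.isIrreducible_iff.1 hρ w fun γ => ?_)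
  obtain ⟨c, -, hc⟩ := range_le hr D.map_base D.sum_eq D.hasWinding ρ (SU2.eigenSubgroup w)
    (fun γ => by
      obtain ⟨c, hc⟩ := hw γ
      exact SU2.mem_eigenSubgroup hw0 hc)
    (SU2.commute_of_half_sq (half_fiber_sq hρ))
    (SU2.mem_eigenSubgroup_of_mem_center (half_fiber_sq hρ)) γ
  exact ⟨c, hc⟩

theorem meridian_pow_eq (D : IsNormalizedWinding p q s n) (hr : 2 ≤ r)
    {ρ : HolRep (SeifertManifold p q) (base p q)} (hρ : ρ.IsIrreducible) (j : Fin r) :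
    ρ (embedHom p q D.map_base (HoledSphere.meridian j)) ^ p j =
      ρ (fiber p q) ^ (q j + n j * p j) :=
  (zpow_neg_mul_pow_eq_iff (SU2.commute_of_half_sq (half_fiber_sq hρ) _) _ _ _).1
    (pow_meridian hr D.map_base D.sum_eq D.hasWinding ρ j)

theorem meridian_pow_eq_one (D : IsNormalizedWinding p q s n) (hr : 2 ≤ r)
    {ρ : HolRep (SeifertManifold p q) (base p q)} (hρ : ρ.IsIrreducible) {j : Fin r}
    (hj : (j : ℕ) ≠ 0) :
    ρ (embedHom p q D.map_base (HoledSphere.meridian j)) ^ p j = 1 := by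
  rw [D.meridian_pow_eq hr hρ,
    zpow_eq_one_of_even (SU2.sq_eq_one_of_half_sq (half_fiber_sq hρ)) (D.even j hj)]

/-- The second entry of the first Seifert invariant relative to a normalized section is odd, as the
others are even and the manifold is a homology sphere. -/
theorem odd (D : IsNormalizedWinding p q s n) (hp : ∀ j, 0 < p j)
    (hsum : (∏ j, (p j : ℚ)) * ∑ j, (q j : ℚ) / p j = 1) {k : Fin r} (hk : (k : ℕ) = 0) :
    Odd (q k + n k * p k) :=
  odd_of_sum_eq hp hsum D.sum_eq k fun j hj => D.even j fun h => hj (Fin.ext (h.trans hk.symm))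

theorem meridian_pow_eq_fiber (D : IsNormalizedWinding p q s n) (hr : 2 ≤ r) (hp : ∀ j, 0 < p j)
    (hsum : (∏ j, (p j : ℚ)) * ∑ j, (q j : ℚ) / p j = 1)
    {ρ : HolRep (SeifertManifold p q) (base p q)} (hρ : ρ.IsIrreducible) {k : Fin r}
    (hk : (k : ℕ) = 0) :
    ρ (embedHom p q D.map_base (HoledSphere.meridian k)) ^ p k = ρ (fiber p q) := by
  rw [D.meridian_pow_eq hr hρ,
    zpow_eq_self_of_odd (SU2.sq_eq_one_of_half_sq (half_fiber_sq hρ)) (D.odd hp hsum hk)]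

/-- A power of a boundary holonomy is the image `± 1` of the fibre, and this image raised to an even
power is one. -/
theorem exists_half_meridian (D : IsNormalizedWinding p q s n) (hr : 2 ≤ r) (hp : ∀ j, 0 < p j)
    (hsum : (∏ j, (p j : ℚ)) * ∑ j, (q j : ℚ) / p j = 1)
    {ρ : HolRep (SeifertManifold p q) (base p q)} (hρ : ρ.IsIrreducible) (j : Fin r) :
    ∃ l : ℤ, (0 ≤ l ∧ l ≤ p j) ∧ ((j : ℕ) ≠ 0 → Even l) ∧
      SU2.half (ρ (embedHom p q D.map_base (HoledSphere.meridian j))) =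
        Real.cos (Real.pi * l / p j) := by
  by_cases hj : (j : ℕ) = 0
  · obtain ⟨l, hl, h⟩ := SU2.exists_half_eq_of_half_pow
      (g := ρ (embedHom p q D.map_base (HoledSphere.meridian j))) (hp j) (by
        rw [D.meridian_pow_eq_fiber hr hp hsum hρ hj, half_fiber_sq hρ])
    exact ⟨l, hl, fun h => absurd hj h, h⟩
  · have h1 := D.meridian_pow_eq_one hr hρ hj
    obtain ⟨l, hl, h⟩ := SU2.exists_half_eq_of_half_pow
      (g := ρ (embedHom p q D.map_base (HoledSphere.meridian j))) (hp j) (by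
        rw [h1, SU2.half_one, one_pow])
    rw [SU2.pow_eq_of_half_eq (hp j) h, SU2.diag_pi_mul_eq_one_iff] at h1
    exact ⟨l, hl, fun _ => h1, h⟩

/-- The pull-back of an irreducible flat connection has boundary holonomies of the angles
`π * ℓ j / p j` for some `ℓ` in `ℜ(p_1, …, p_r)`. -/
theorem exists_mem_setR (D : IsNormalizedWinding p q s n) (hr : 2 ≤ r) (hp : ∀ j, 0 < p j)
    (hcop : ∀ i j, i ≠ j → Nat.Coprime (p i) (p j))
    (hsum : (∏ j, (p j : ℚ)) * ∑ j, (q j : ℚ) / p j = 1)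
    {ρ : HolRep (SeifertManifold p q) (base p q)} (hρ : ρ.IsIrreducible) :
    ∃ ℓ ∈ setR p, ∀ j, SU2.half (ρ (embedHom p q D.map_base (HoledSphere.meridian j))) =
      Real.cos (Real.pi * ℓ j / p j) := by
  choose ℓ hℓ hev hhalf using D.exists_half_meridian hr hp hsum hρ
  have hL : ℓ ∈ setL p := by
    refine ⟨hℓ, (SU2.two_lt_card_of_isIrreducible hr (D.isIrreducible_comp hr hρ)).trans_le
      (Finset.card_le_card fun j hj => ?_), hev⟩
    refine Finset.mem_filter.2 ⟨Finset.mem_univ j, fun ⟨m, hm⟩ => (Finset.mem_filter.1 hj).2 ?_⟩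
    have hp' : (p j : ℝ) ≠ 0 := by exact_mod_cast (hp j).ne'
    rw [MonoidHom.comp_apply, hhalf, hm, ← SU2.half_diag_pi_mul m, SU2.half_diag]
    congr 2
    push_cast
    field_simp
  exact ⟨ℓ, (HoledSphere.mem_setR_iff hp hcop hL).2 ⟨_, hhalf, HoledSphere.revProd_meridian hr
    (ρ.comp (embedHom p q D.map_base))⟩, hhalf⟩

/-- A family of flat connections on the holed sphere with boundary holonomies of the angles
`π * ℓ j / p j` extends to the Seifert manifold, the fibre being mapped to `(-1) ^ ℓ 0`. -/
theorem exists_lift (D : IsNormalizedWinding p q s n) (hr : 2 ≤ r) (hp : ∀ j, 0 < p j)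
    (hsum : (∏ j, (p j : ℚ)) * ∑ j, (q j : ℚ) / p j = 1) {ℓ : Fin r → ℤ} (hℓ : ℓ ∈ setL p)
    {T : Type} [TopologicalSpace T]
    (σ : FundamentalGroup (HoledSphere r) (HoledSphere.base r) →* C(T, SU2))
    (hσ : ∀ j t, SU2.half (σ (HoledSphere.meridian j) t) = Real.cos (Real.pi * ℓ j / p j)) :
    ∃ ρ : FundamentalGroup (SeifertManifold p q) (base p q) →* C(T, SU2),
      ρ.comp (embedHom p q D.map_base) = σ := by
  obtain ⟨k, hk⟩ : ∃ k : Fin r, (k : ℕ) = 0 := ⟨⟨0, by omega⟩, rfl⟩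
  have hsq : SU2.diag (Real.pi * ℓ k) ^ 2 = 1 :=
    SU2.sq_eq_one_of_half_sq (SU2.half_diag_pi_mul _)
  have he : ∀ g : C(T, SU2), Commute (ContinuousMap.const T (SU2.diag (Real.pi * ℓ k))) g :=
    fun g => ContinuousMap.ext fun t => SU2.commute_of_half_sq (SU2.half_diag_pi_mul _) (g t)
  have hsq' : ContinuousMap.const T (SU2.diag (Real.pi * ℓ k)) ^ 2 = 1 :=
    ContinuousMap.ext fun t => hsq
  obtain ⟨ρ, hρ, -⟩ := exists_hom (p := p) (q := q) hr D.map_base D.sum_eq D.hasWinding σ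
    (ContinuousMap.const T (SU2.diag (Real.pi * ℓ k))) he fun j => by
      refine (zpow_neg_mul_pow_eq_iff (he _) _ _ _).2 ?_
      have h1 : σ (HoledSphere.meridian j) ^ p j =
          ContinuousMap.const T (SU2.diag (Real.pi * ℓ j)) :=
        ContinuousMap.ext fun t => SU2.pow_eq_of_half_eq (hp j) (hσ j t)
      by_cases hj : (j : ℕ) = 0
      · obtain rfl : j = k := Fin.ext (hj.trans hk.symm)
        rw [h1, zpow_eq_self_of_odd hsq' (D.odd hp hsum hk)]
      · rw [h1, zpow_eq_one_of_even hsq' (D.even j hj),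
          (SU2.diag_pi_mul_eq_one_iff _).2 (hℓ.2.2 j hj)]
        rfl
  exact ⟨ρ, hρ⟩

end IsNormalizedWinding

end

section

/-! ### The topology of the moduli spaces -/

section Moduli

variable {Y : Type} [TopologicalSpace Y] {y : Y}

theorem HolRep.continuous_eval (γ : FundamentalGroup Y y) :
    Continuous fun ρ : HolRep Y y => ρ γ :=
  (continuous_apply γ).comp continuous_induced_dom

theorem HolRep.continuous_iff {T : Type*} [TopologicalSpace T] {f : T → HolRep Y y} :
    Continuous f ↔ ∀ γ, Continuous fun t => f t γ :=
  continuous_induced_rng.trans continuous_pi_iff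

/-- The universal family of representations parametrized by a space of representations. -/
noncomputable def HolRep.universal {T : Type*} [TopologicalSpace T] (f : T → HolRep Y y)
    (hf : Continuous f) :
    FundamentalGroup Y y →* C(T, SU2) where
  toFun γ := ⟨fun t => f t γ, HolRep.continuous_iff.1 hf γ⟩
  map_one' := ContinuousMap.ext fun t => map_one (f t)
  map_mul' γ δ := ContinuousMap.ext fun t => map_mul (f t) γ δ

/-- The member at `t` of a family of representations. -/
noncomputable def HolRep.at {T : Type*} [TopologicalSpace T] (ρ : FundamentalGroup Y y →* C(T, SU2))
    (t : T) :
    HolRep Y y where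
  toFun γ := ρ γ t
  map_one' := by rw [map_one]; rfl
  map_mul' γ δ := by rw [map_mul]; rfl

theorem HolRep.continuous_at {T : Type*} [TopologicalSpace T]
    (ρ : FundamentalGroup Y y →* C(T, SU2)) : Continuous (HolRep.at ρ) :=
  HolRep.continuous_iff.2 fun γ => (ρ γ).continuous

theorem FlatModuli.isOpenQuotientMap_mk : IsOpenQuotientMap (FlatModuli.mk (Y := Y) (y := y)) := by
  refine ⟨FlatModuli.exists_mk, continuous_quot_mk, fun U hU => ?_⟩
  refine isOpen_coinduced.2 ?_
  have h1 : FlatModuli.mk ⁻¹' (FlatModuli.mk '' U) =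
      ⋃ g : SU2, {ρ : HolRep Y y | (MulAut.conj g).toMonoidHom.comp ρ ∈ U} := by
    ext ρ
    simp only [Set.mem_preimage, Set.mem_image, Set.mem_iUnion]
    constructor
    · rintro ⟨ρ', h, h'⟩
      obtain ⟨g, hg⟩ := FlatModuli.mk_eq_mk_iff.1 h'.symm
      refine ⟨g, ?_⟩
      have h2 : (MulAut.conj g).toMonoidHom.comp ρ = ρ' := MonoidHom.ext fun γ => (hg γ).symm
      exact (congrArg (· ∈ U) h2).mpr h
    · rintro ⟨g, hg⟩
      exact ⟨_, hg, (FlatModuli.mk_eq_mk_iff.2 ⟨g, fun γ => rfl⟩).symm⟩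
  have h2 : IsOpen (FlatModuli.mk ⁻¹' (FlatModuli.mk '' U)) := by
    rw [h1]
    refine isOpen_iUnion fun g => hU.preimage (HolRep.continuous_iff.2 fun γ => ?_)
    exact (continuous_const.mul (HolRep.continuous_eval γ)).mul continuous_const
  exact h2

theorem FlatModuli.continuous_pullback {Z : Type} [TopologicalSpace Z] {z : Z} (f : C(Z, Y))
    (h : f z = y) : Continuous (FlatModuli.pullback f h) :=
  FlatModuli.isOpenQuotientMap_mk.isQuotientMap.continuous_iff.2
    (FlatModuli.isOpenQuotientMap_mk.continuous.comp
      (HolRep.continuous_iff.2 fun _ => HolRep.continuous_eval _))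

end Moduli

namespace HoledSphere

variable {r : ℕ} {p : Fin r → ℕ}

/-- Half the trace of the holonomy around the `j`-th boundary component. -/
noncomputable def halfTrace (j : Fin r) : FlatModuli (HoledSphere r) (base r) → ℝ :=
  Quotient.lift (fun ρ => SU2.half (ρ (meridian j))) fun _ _ ⟨g, hg⟩ => by
    rw [hg, SU2.half_conj]

theorem continuous_halfTrace (j : Fin r) : Continuous (halfTrace j) :=
  FlatModuli.isOpenQuotientMap_mk.isQuotientMap.continuous_iff.2
    (SU2.continuous_half.comp (HolRep.continuous_eval _))

theorem mem_moduli_iff {ℓ : Fin r → ℤ} {x : FlatModuli (HoledSphere r) (base r)} :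
    x ∈ moduli (holClass p ℓ) ↔ ∀ j, halfTrace j x = Real.cos (Real.pi * ℓ j / p j) := by
  obtain ⟨ρ, rfl⟩ := FlatModuli.exists_mk x
  exact mk_mem_moduli

theorem eq_of_mem_moduli (hp : ∀ j, 0 < p j) {ℓ ℓ' : Fin r → ℤ} (hℓ : ℓ ∈ setL p)
    (hℓ' : ℓ' ∈ setL p) {x : FlatModuli (HoledSphere r) (base r)}
    (h : x ∈ moduli (holClass p ℓ)) (h' : x ∈ moduli (holClass p ℓ')) : ℓ = ℓ' := by
  rw [mem_moduli_iff] at h h'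
  funext j
  have h1 := Real.injOn_cos (angle_mem hp hℓ.1 j) (angle_mem hp hℓ'.1 j) ((h j).symm.trans (h' j))
  have h2 : (p j : ℝ) ≠ 0 := by exact_mod_cast (hp j).ne'
  have h3 := mul_left_cancel₀ Real.pi_ne_zero ((div_left_inj' h2).1 h1)
  exact_mod_cast h3

/-- The moduli spaces with fixed boundary holonomies are path connected, since so are the spaces of
polygons with fixed side lengths. -/
theorem joined_moduli (hr : 2 ≤ r) (hp : ∀ j, 0 < p j)
    (hcop : ∀ i j, i ≠ j → Nat.Coprime (p i) (p j)) {ℓ : Fin r → ℤ} (hℓ : ℓ ∈ setL p)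
    (x y : irrModuli (holClass p ℓ)) : Joined x y := by
  obtain ⟨x, hx⟩ := x
  obtain ⟨y, hy⟩ := y
  obtain ⟨ρ, rfl⟩ := FlatModuli.exists_mk x
  obtain ⟨ρ', rfl⟩ := FlatModuli.exists_mk y
  obtain ⟨γ, hγ⟩ := SU2.joinedIn_polygon (angle_mem hp hℓ.1) 1
    (g := fun j => ρ (meridian j)) (h := fun j => ρ' (meridian j))
    ⟨mk_mem_moduli.1 hx.1, revProd_meridian hr ρ⟩ ⟨mk_mem_moduli.1 hy.1, revProd_meridian hr ρ'⟩
  let b : Fin r → C(unitInterval, SU2) := fun j =>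
    ⟨fun t => γ t j, (continuous_apply j).comp γ.continuous⟩
  have hb : revProd b = 1 := by
    refine ContinuousMap.ext fun t => ?_
    have h1 := map_revProd (G := C(unitInterval, SU2)) (Pi.evalMonoidHom (fun _ => SU2) t |>.comp
      ContinuousMap.coeFnMonoidHom) b
    exact h1.trans (hγ t).2
  obtain ⟨σ, hσ⟩ := exists_hom hr b hb
  have hmem : ∀ t, FlatModuli.mk (HolRep.at σ t) ∈ irrModuli (holClass p ℓ) := fun t => by
    rw [← moduli_eq_irrModuli hr hp hcop hℓ, mk_mem_moduli]
    intro j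
    have h1 : HolRep.at σ t (meridian j) = γ t j := DFunLike.congr_fun (hσ j) t
    rw [h1]
    exact (hγ t).1 j
  refine ⟨⟨⟨fun t => ⟨FlatModuli.mk (HolRep.at σ t), hmem t⟩, ?_⟩, Subtype.ext ?_, Subtype.ext ?_⟩⟩
  · exact (FlatModuli.isOpenQuotientMap_mk.continuous.comp (HolRep.continuous_at σ)).subtype_mk _
  · refine congrArg FlatModuli.mk (hom_ext hr fun j => ?_)
    exact (DFunLike.congr_fun (hσ j) 0).trans (congrFun γ.source j)
  · refine congrArg FlatModuli.mk (hom_ext hr fun j => ?_)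
    exact (DFunLike.congr_fun (hσ j) 1).trans (congrFun γ.target j)

end HoledSphere

theorem isOpen_preimage_singleton_of_finite_range {X Y : Type*} [TopologicalSpace X]
    [TopologicalSpace Y] [T1Space Y] {f : X → Y} (hf : Continuous f) (h : (Set.range f).Finite)
    (y : Y) : IsOpen (f ⁻¹' {y}) := by
  have h1 : f ⁻¹' {y} = f ⁻¹' (Set.range f \ {y})ᶜ := by
    ext x
    simp
  rw [h1]
  exact (h.subset Set.sdiff_subset).isClosed.isOpen_compl.preimage hf

namespace IsNormalizedWinding

open SeifertManifold

variable {r : ℕ} {p : Fin r → ℕ} {q n : Fin r → ℤ} {s : C(HoledSphere r, Circle)}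

/-- Pull-back of flat connections along the section. -/
noncomputable abbrev pullback (D : IsNormalizedWinding p q s n) :
    FlatModuli (SeifertManifold p q) (base p q) →
      FlatModuli (HoledSphere r) (HoledSphere.base r) :=
  FlatModuli.pullback (embed p q s) (embed_base p q s D.map_base)

theorem pullback_mk (D : IsNormalizedWinding p q s n)
    (ρ : HolRep (SeifertManifold p q) (base p q)) :
    D.pullback (FlatModuli.mk ρ) = FlatModuli.mk (ρ.comp (embedHom p q D.map_base)) := rfl

/-- The value on the fibre is a power of the first boundary holonomy, so that the pull-back
determines the representation. -/
theorem injOn_pullback (D : IsNormalizedWinding p q s n) (hr : 2 ≤ r) (hp : ∀ j, 0 < p j)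
    (hsum : (∏ j, (p j : ℚ)) * ∑ j, (q j : ℚ) / p j = 1) :
    Set.InjOn D.pullback (irrModuli (SeifertManifold p q) (base p q)) := by
  rintro _ ⟨ρ, hρ, rfl⟩ _ ⟨ρ', hρ', rfl⟩ h
  rw [D.pullback_mk, D.pullback_mk, FlatModuli.mk_eq_mk_iff] at h
  obtain ⟨g, hg⟩ := h
  obtain ⟨k, hk⟩ : ∃ k : Fin r, (k : ℕ) = 0 := ⟨⟨0, by omega⟩, rfl⟩
  have h1 : (MulAut.conj g).toMonoidHom.comp ρ = ρ' := by
    refine hom_ext D.map_base (MonoidHom.ext fun γ => (hg γ).symm) ?_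
    have h2 := hg (HoledSphere.meridian k)
    rw [MonoidHom.comp_apply, MonoidHom.comp_apply] at h2
    rw [← D.meridian_pow_eq_fiber hr hp hsum hρ' hk, h2, conj_pow,
      D.meridian_pow_eq_fiber hr hp hsum hρ hk]
    rfl
  exact FlatModuli.mk_eq_mk_iff.2 ⟨g, fun γ => (DFunLike.congr_fun h1 γ).symm⟩

theorem exists_pullback_mem (D : IsNormalizedWinding p q s n) (hr : 2 ≤ r) (hp : ∀ j, 0 < p j)
    (hcop : ∀ i j, i ≠ j → Nat.Coprime (p i) (p j))
    (hsum : (∏ j, (p j : ℚ)) * ∑ j, (q j : ℚ) / p j = 1)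
    (x : irrModuli (SeifertManifold p q) (base p q)) :
    ∃ ℓ : setR p, D.pullback x ∈ HoledSphere.irrModuli (holClass p ℓ) := by
  obtain ⟨_, ρ, hρ, rfl⟩ := x
  obtain ⟨ℓ, hℓ, h⟩ := D.exists_mem_setR hr hp hcop hsum hρ
  refine ⟨⟨ℓ, hℓ⟩, ?_⟩
  rw [← HoledSphere.moduli_eq_irrModuli hr hp hcop hℓ.1]
  exact HoledSphere.mk_mem_moduli.2 h

theorem isIrreducible_of_comp (D : IsNormalizedWinding p q s n)
    {ρ : HolRep (SeifertManifold p q) (base p q)}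
    (h : HolRep.IsIrreducible (ρ.comp (embedHom p q D.map_base))) : ρ.IsIrreducible :=
  fun W hW => h W fun _ => hW _

/-- The inverse of the pull-back is continuous: the universal family over the space of
representations with the prescribed boundary holonomies lifts to the Seifert manifold. -/
theorem exists_continuous_section (D : IsNormalizedWinding p q s n) (hr : 2 ≤ r)
    (hp : ∀ j, 0 < p j) (hsum : (∏ j, (p j : ℚ)) * ∑ j, (q j : ℚ) / p j = 1) {ℓ : Fin r → ℤ}
    (hℓ : ℓ ∈ setL p) :
    ∃ L : HoledSphere.irrModuli (holClass p ℓ) → irrModuli (SeifertManifold p q) (base p q),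
      Continuous L ∧ ∀ x, D.pullback (L x) = x := by
  set B := HoledSphere.irrModuli (holClass p ℓ) with hB
  let T : Type := FlatModuli.mk ⁻¹' B
  have hmk := FlatModuli.isOpenQuotientMap_mk (Y := HoledSphere r) (y := HoledSphere.base r)
  have hπ : Topology.IsQuotientMap (B.restrictPreimage FlatModuli.mk) :=
    (IsOpenQuotientMap.mk (Set.restrictPreimage_surjective B hmk.surjective)
      hmk.continuous.restrictPreimage (hmk.isOpenMap.restrictPreimage B)).isQuotientMap
  obtain ⟨ρ, hρ⟩ := D.exists_lift hr hp hsum hℓ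
    (HolRep.universal (fun t : T => t.1) continuous_subtype_val)
    fun j t => HoledSphere.mk_mem_moduli.1 t.2.1 j
  have hcomp : ∀ t : T, (HolRep.at ρ t).comp (embedHom p q D.map_base) = t.1 := fun t =>
    MonoidHom.ext fun γ => DFunLike.congr_fun (DFunLike.congr_fun hρ γ) t
  have hirr : ∀ t : T, (HolRep.at ρ t).IsIrreducible := fun t => by
    refine D.isIrreducible_of_comp ?_
    rw [hcomp]
    exact FlatModuli.mk_mem_irrModuli.1 t.2.2
  let f : T → irrModuli (SeifertManifold p q) (base p q) := fun t =>
    ⟨FlatModuli.mk (HolRep.at ρ t), FlatModuli.mk_mem_irrModuli.2 (hirr t)⟩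
  have hf : Continuous f := (FlatModuli.isOpenQuotientMap_mk.continuous.comp
    (HolRep.continuous_at ρ)).subtype_mk _
  have hfp : ∀ t, D.pullback (f t) = FlatModuli.mk t.1 := fun t =>
    (D.pullback_mk _).trans (congrArg _ (hcomp t))
  choose rep hrep using hπ.surjective
  have hrep' : ∀ x, FlatModuli.mk (rep x).1 = x.1 := fun x => congrArg Subtype.val (hrep x)
  refine ⟨fun x => f (rep x), hπ.continuous_iff.2 ?_, fun x => (hfp _).trans (hrep' x)⟩
  convert hf using 1
  funext t
  refine Subtype.ext (D.injOn_pullback hr hp hsum (f _).2 (f t).2 ?_)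
  exact (hfp _).trans ((hrep' _).trans (hfp t).symm)

/-- The boundary holonomies of the pull-back of an irreducible flat connection are locally
constant up to conjugation, since there are only finitely many possibilities for them. -/
theorem isOpen_pullback_mem (D : IsNormalizedWinding p q s n) (hr : 2 ≤ r) (hp : ∀ j, 0 < p j)
    (hcop : ∀ i j, i ≠ j → Nat.Coprime (p i) (p j))
    (hsum : (∏ j, (p j : ℚ)) * ∑ j, (q j : ℚ) / p j = 1) (ℓ : Fin r → ℤ) :
    IsOpen {x : irrModuli (SeifertManifold p q) (base p q) |
      D.pullback x ∈ HoledSphere.moduli (holClass p ℓ)} := by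
  have h1 : {x : irrModuli (SeifertManifold p q) (base p q) |
      D.pullback x ∈ HoledSphere.moduli (holClass p ℓ)} =
      ⋂ j, (fun x : irrModuli (SeifertManifold p q) (base p q) =>
        HoledSphere.halfTrace j (D.pullback x)) ⁻¹' {Real.cos (Real.pi * ℓ j / p j)} := by
    ext x
    simp [HoledSphere.mem_moduli_iff]
  rw [h1]
  refine isOpen_iInter_of_finite fun j => isOpen_preimage_singleton_of_finite_range
    ((HoledSphere.continuous_halfTrace j).comp
      ((FlatModuli.continuous_pullback _ _).comp continuous_subtype_val)) ?_ _
  refine ((Set.finite_Icc (0 : ℤ) (p j)).image fun l : ℤ => Real.cos (Real.pi * l / p j)).subset ?_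
  rintro _ ⟨x, rfl⟩
  obtain ⟨ℓ', h⟩ := D.exists_pullback_mem hr hp hcop hsum x
  exact ⟨ℓ'.1 j, ℓ'.2.1.1 j, (HoledSphere.mem_moduli_iff.1 h.1 j).symm⟩

/-- The pull-back is continuous and injective, its image is the union of the moduli spaces with
fixed boundary holonomies, the preimages of these are open, and it has a continuous inverse over
each of them. -/
theorem exists_homeomorph (D : IsNormalizedWinding p q s n) (hr : 2 ≤ r) (hp : ∀ j, 0 < p j)
    (hcop : ∀ i j, i ≠ j → Nat.Coprime (p i) (p j))
    (hsum : (∏ j, (p j : ℚ)) * ∑ j, (q j : ℚ) / p j = 1) :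
    ∃ Φ : irrModuli (SeifertManifold p q) (base p q) ≃ₜ
        (Σ ℓ : setR p, HoledSphere.irrModuli (holClass p ℓ.1)),
      ∀ x, ((Φ x).2 : FlatModuli (HoledSphere r) (HoledSphere.base r)) = D.pullback x := by
  choose idx hidx using D.exists_pullback_mem hr hp hcop hsum
  choose L hLc hL using fun ℓ : setR p => D.exists_continuous_section hr hp hsum ℓ.2.1
  have hidx_eq : ∀ (x : irrModuli (SeifertManifold p q) (base p q)) (ℓ : setR p),
      D.pullback x ∈ HoledSphere.moduli (holClass p ℓ.1) ↔ idx x = ℓ := by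
    refine fun x ℓ => ⟨fun h => ?_, fun h => h ▸ (hidx x).1⟩
    exact Subtype.ext (HoledSphere.eq_of_mem_moduli hp (idx x).2.1 ℓ.2.1 (hidx x).1 h)
  have hinv : ∀ ℓ y, (⟨idx (L ℓ y), D.pullback (L ℓ y), hidx _⟩ :
      Σ ℓ : setR p, HoledSphere.irrModuli (holClass p ℓ.1)) = ⟨ℓ, y⟩ := by
    intro ℓ y
    have h1 : idx (L ℓ y) = ℓ := (hidx_eq _ _).1 (by rw [hL]; exact y.2.1)
    have h2 := hL ℓ y
    have h3 : ∀ (m : setR p) (h : D.pullback (L ℓ y) ∈ HoledSphere.irrModuli (holClass p m.1)),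
        m = ℓ → (⟨m, D.pullback (L ℓ y), h⟩ :
          Σ ℓ : setR p, HoledSphere.irrModuli (holClass p ℓ.1)) = ⟨ℓ, y⟩ := by
      rintro m h rfl
      exact Sigma.ext rfl (heq_of_eq (Subtype.ext h2))
    exact h3 _ _ h1
  refine ⟨{ toFun := fun x => ⟨idx x, D.pullback x, hidx x⟩
            invFun := fun y => L y.1 y.2
            left_inv := fun x => Subtype.ext
              (D.injOn_pullback hr hp hsum (L _ _).2 x.2 (hL _ _))
            right_inv := fun y => hinv y.1 y.2
            continuous_toFun := ?_
            continuous_invFun := continuous_sigma hLc }, fun x => rfl⟩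
  refine continuous_def.2 fun V hV => ?_
  have h1 : ∀ ℓ : setR p, ∃ W : Set (FlatModuli (HoledSphere r) (HoledSphere.base r)),
      IsOpen W ∧ Subtype.val ⁻¹' W = Sigma.mk ℓ ⁻¹' V := fun ℓ =>
    isOpen_induced_iff.1 (isOpen_sigma_iff.1 hV ℓ)
  choose W hW hWV using h1
  have h2 : (fun x : irrModuli (SeifertManifold p q) (base p q) => (⟨idx x, D.pullback x, hidx x⟩ :
      Σ ℓ : setR p, HoledSphere.irrModuli (holClass p ℓ.1))) ⁻¹' V =
      ⋃ ℓ : setR p, {x | D.pullback x.1 ∈ HoledSphere.moduli (holClass p ℓ.1)} ∩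
        {x | D.pullback x.1 ∈ W ℓ} := by
    ext x
    have h3 : (⟨idx x, D.pullback x, hidx x⟩ :
        Σ ℓ : setR p, HoledSphere.irrModuli (holClass p ℓ.1)) ∈ V ↔ D.pullback x ∈ W (idx x) :=
      (Set.ext_iff.1 (hWV (idx x)) ⟨_, hidx x⟩).symm
    rw [Set.mem_preimage, h3, Set.mem_iUnion]
    constructor
    · exact fun h => ⟨idx x, (hidx x).1, h⟩
    · rintro ⟨ℓ, h4, h5⟩
      rwa [(hidx_eq x ℓ).1 h4]
  rw [h2]
  exact isOpen_iUnion fun ℓ => (D.isOpen_pullback_mem hr hp hcop hsum ℓ).inter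
    ((hW ℓ).preimage ((FlatModuli.continuous_pullback _ _).comp continuous_subtype_val))

end IsNormalizedWinding

/-- A homeomorphism to a disjoint union of nonempty path connected spaces identifies the path
components with the index set. -/
theorem exists_zerothHomotopy_equiv {X ι : Type*} {B : ι → Type*} [TopologicalSpace X]
    [∀ i, TopologicalSpace (B i)] (Φ : X ≃ₜ Σ i, B i) (hne : ∀ i, Nonempty (B i))
    (hB : ∀ i (x y : B i), Joined x y) :
    ∃ e : ZerothHomotopy X ≃ ι, ∀ x, e (ZerothHomotopy.mk x) = (Φ x).1 := by
  let _ : TopologicalSpace ι := ⊥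
  have : DiscreteTopology ι := ⟨rfl⟩
  have hc : Continuous fun x => (Φ x).1 :=
    (continuous_sigma fun i => continuous_const : Continuous (Sigma.fst : (Σ i, B i) → ι)).comp
      Φ.continuous
  have h1 : ∀ x y, Joined x y → (Φ x).1 = (Φ y).1 := fun x y ⟨γ⟩ => by
    have := PreconnectedSpace.constant inferInstance (hc.comp γ.continuous) (x := 0) (y := 1)
    simpa using this
  have h2 : ∀ x y, (Φ x).1 = (Φ y).1 → Joined x y := by
    intro x y h
    rw [← Φ.symm_apply_apply x, ← Φ.symm_apply_apply y]
    generalize Φ x = u at h ⊢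
    generalize Φ y = v at h ⊢
    obtain ⟨i, u⟩ := u
    obtain ⟨k, v⟩ := v
    obtain rfl : i = k := h
    exact ((hB i u v).map continuous_sigmaMk).map Φ.symm.continuous
  refine ⟨Equiv.ofBijective (Quotient.lift (fun x => (Φ x).1) h1) ⟨?_, ?_⟩, fun x => rfl⟩
  · rintro ⟨x⟩ ⟨y⟩ h
    exact Quotient.sound (h2 x y h)
  · intro i
    obtain ⟨u⟩ := hne i
    exact ⟨ZerothHomotopy.mk (Φ.symm ⟨i, u⟩),
      congrArg Sigma.fst (Φ.apply_symm_apply ⟨i, u⟩)⟩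

end

theorem mainTheorem3 (r : ℕ) (hr : 3 ≤ r) (p : Fin r → ℕ) (q : Fin r → ℤ)
    (hp : ∀ j, 0 < p j)
    (hcop : ∀ i j, i ≠ j → Nat.Coprime (p i) (p j))
    (hodd : ∀ j : Fin r, (j : ℕ) ≠ 0 → Odd (p j))
    (hsum : (∏ j, (p j : ℚ)) * ∑ j, (q j : ℚ) / p j = 1) :
    (∀ ℓ ∈ setR p,
      HoledSphere.moduli (holClass p ℓ) = HoledSphere.irrModuli (holClass p ℓ) ∧
      (HoledSphere.moduli (holClass p ℓ)).Nonempty) ∧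
    (∃ s : C(HoledSphere r, Circle), IsNormalizedSection p q s) ∧
    ∀ (s : C(HoledSphere r, Circle)) (hs : IsNormalizedSection p q s),
      ∃ Φ : irrModuli (SeifertManifold p q) (SeifertManifold.base p q) ≃ₜ
          (Σ ℓ : setR p, HoledSphere.irrModuli (holClass p ℓ.1)),
        (∀ a, ((Φ a).2 : FlatModuli (HoledSphere r) (HoledSphere.base r)) =
          FlatModuli.pullback (SeifertManifold.embed p q s)
            (SeifertManifold.embed_base p q s hs.1) a.1) ∧
        ∃ e : ZerothHomotopy (irrModuli (SeifertManifold p q) (SeifertManifold.base p q)) ≃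
            setR p,
          ∀ a, e (ZerothHomotopy.mk a) = (Φ a).1 := by
  have hr2 : 2 ≤ r := by omega
  have h1 : ∀ ℓ ∈ setR p,
      HoledSphere.moduli (holClass p ℓ) = HoledSphere.irrModuli (holClass p ℓ) :=
    fun ℓ hℓ => HoledSphere.moduli_eq_irrModuli hr2 hp hcop hℓ.1
  have h2 : ∀ ℓ ∈ setR p, (HoledSphere.moduli (holClass p ℓ)).Nonempty := fun ℓ hℓ => by
    obtain ⟨ρ, hρ⟩ := HoledSphere.exists_half_eq hr2 hp hcop hℓ
    exact ⟨_, HoledSphere.mk_mem_moduli.2 hρ⟩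
  refine ⟨fun ℓ hℓ => ⟨h1 ℓ hℓ, h2 ℓ hℓ⟩, exists_isNormalizedSection hodd, fun s hs => ?_⟩
  obtain ⟨n, D⟩ := hs.exists_isNormalizedWinding hr2
  obtain ⟨Φ, hΦ⟩ := D.exists_homeomorph hr2 hp hcop hsum
  exact ⟨Φ, hΦ, exists_zerothHomotopy_equiv Φ
    (fun ℓ => Set.nonempty_coe_sort.2 (h1 ℓ.1 ℓ.2 ▸ h2 ℓ.1 ℓ.2))
    fun ℓ => HoledSphere.joined_moduli hr2 hp hcop ℓ.2.1⟩
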